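/- Let $m,n$ be coprime positive integers and $\mathbb H_{m/n}=\{(z_1,z_2)\in\mathbb C^2: |z_1|^{m/n}<|z_2|<1\}$. For $1<r<\infty$ let $A^r=A^r(\mathbb H_{m/n})$ be the Bergman space of holomorphic functions in $L^r(\mathbb H_{m/n})$ (Lebesgue measure), with the $L^r$ norm, and let $(A^r)'$ be its space of bounded linear functionals. Put $e_\alpha(z)=z_1^{\alpha_1}z_2^{\alpha_2}$ for $\alpha\in\mathbb Z^2$ and $\mathcal S(L^r)=\{\alpha\in\mathbb Z^2: e_\alpha\in A^r\}$. If $f$ is holomorphic on $\mathbb H_{m/n}$, let $f=\sum_{\alpha\in\mathbb Z^2}a_\alpha(f)e_\alpha$ be its unique Laurent expansion, converging uniformly on compact sets. Let $2<p<\infty$ and let $q$ be the conjugate exponent, $\frac1p+\frac1q=1$. Put $$G=\Big\{f\in A^q: f=\sum_{\alpha\in\mathcal S(L^p)}a_\alpha(f)e_\alpha\Big\},$$ and for conjugate exponents $r,s$ put $\Phi_r:A^s\to (A^r)'$, $\Phi_r(g)(f)=\int_{\mathbb H_{m/n}} f\,\overline g\,dV$. (1) $G$ is a proper linear subspace of $A^q$,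 and $(A^p)'\cong G$: the map $\Phi_p$ restricts to a conjugate-linear homeomorphism of $G$ onto $(A^p)'$, and there is also a (complex-)linear homeomorphism $(A^p)'\to G$. (2) The functionals $a_\alpha$ are bounded on $A^q$. Let $M$ be the closure in $(A^q)'$ of the linear span of $\{a_\alpha:\alpha\in\mathcal S(L^q)\setminus\mathcal S(L^p)\}$. Then $(A^q)'\cong A^p\oplus M$: the map $\Phi_q$ is a conjugate-linear homeomorphism of $A^p$ onto its range, $(A^q)'=\Phi_q(A^p)\oplus M$ as a topological direct sum, and there is also a (complex-)linear homeomorphism $(A^q)'\to A^p\oplus M$. -/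

import Mathlib

open MeasureTheory
open scoped ENNReal ComplexConjugate Topology

noncomputable section

/-- The power-generalized Hartogs triangle `{(z₁, z₂) ∈ ℂ² : |z₁|^γ < |z₂| < 1}`. -/
def genHartogs (γ : ℝ) : Set (ℂ × ℂ) :=
  {z | ‖z.1‖ ^ γ < ‖z.2‖ ∧ ‖z.2‖ < 1}

/-- The Bergman space `A^p(Ω)`: the (classes of) functions in `L^p(Ω)`, with respect to Lebesgue
measure, that are represented by a function holomorphic on `Ω`. It carries the `L^p` norm. -/
def bergmanSpace (Ω : Set (ℂ × ℂ)) (p : ℝ≥0∞) :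
    Submodule ℂ (Lp ℂ p ((volume : Measure (ℂ × ℂ)).restrict Ω)) where
  carrier := {f | ∃ F : ℂ × ℂ → ℂ, DifferentiableOn ℂ F Ω ∧ f =ᵐ[volume.restrict Ω] F}
  add_mem' := by
    rintro f g ⟨F, hF, hfF⟩ ⟨G, hG, hgG⟩
    exact ⟨F + G, hF.add hG, (Lp.coeFn_add f g).trans (hfF.add hgG)⟩
  zero_mem' := ⟨0, differentiableOn_const 0, Lp.coeFn_zero _ _ _⟩
  smul_mem' := by
    rintro c f ⟨F, hF, hfF⟩
    exact ⟨c • F, hF.const_smul c, (Lp.coeFn_smul c f).trans (hfF.const_smul c)⟩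

/-- The Laurent monomial `e_α(z) = z₁^α₁ z₂^α₂`, `α ∈ ℤ²`. -/
def laurentMonomial (α : ℤ × ℤ) (z : ℂ × ℂ) : ℂ :=
  z.1 ^ α.1 * z.2 ^ α.2

/-- The set `S(Ω, L^p)` of `L^p`-allowable multi-indices: those `α` with `e_α ∈ A^p(Ω)`. -/
def allowable (Ω : Set (ℂ × ℂ)) (p : ℝ≥0∞) : Set (ℤ × ℤ) :=
  {α | DifferentiableOn ℂ (laurentMonomial α) Ω ∧
    MemLp (laurentMonomial α) p ((volume : Measure (ℂ × ℂ)).restrict Ω)}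

/-- `f = ∑_α c_α e_α` is a Laurent expansion on `Ω` of (the holomorphic representative of) the
element `f` of `A^p(Ω)`; the series converges locally uniformly on `Ω`. -/
def IsLaurentExpansion {Ω : Set (ℂ × ℂ)} {p : ℝ≥0∞} (f : bergmanSpace Ω p)
    (c : ℤ × ℤ → ℂ) : Prop :=
  ∃ F : ℂ × ℂ → ℂ, DifferentiableOn ℂ F Ω ∧
    (f : Lp ℂ p ((volume : Measure (ℂ × ℂ)).restrict Ω)) =ᵐ[volume.restrict Ω] F ∧
    HasSumLocallyUniformlyOn (fun α z => c α * laurentMonomial α z) F Ω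

/-- The subspace of `A^q(Ω)` of the functions whose Laurent series involves only
`L^p`-allowable monomials. -/
def allowableSubspace (Ω : Set (ℂ × ℂ)) (q p : ℝ≥0∞) : Submodule ℂ (bergmanSpace Ω q) where
  carrier := {f | ∃ c : ℤ × ℤ → ℂ, IsLaurentExpansion f c ∧ ∀ α ∉ allowable Ω p, c α = 0}
  add_mem' := by
    rintro f g ⟨c, ⟨F, hF, hfF, hc⟩, hc0⟩ ⟨d, ⟨G, hG, hgG, hd⟩, hd0⟩
    refine ⟨c + d, ⟨F + G, hF.add hG, ?_, ?_⟩, fun α hα => by simp [hc0 α hα, hd0 α hα]⟩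
    · exact (Lp.coeFn_add _ _).trans (hfF.add hgG)
    · have h := TendstoLocallyUniformlyOn.add hc hd
      refine h.congr (fun s z _ => ?_)
      simp [Finset.sum_add_distrib, add_mul]
  zero_mem' := by
    refine ⟨0, ⟨0, differentiableOn_const 0, Lp.coeFn_zero _ _ _, ?_⟩, fun _ _ => rfl⟩
    intro u hu x _
    exact ⟨Set.univ, Filter.univ_mem, Filter.Eventually.of_forall fun s z _ => by
      simpa using refl_mem_uniformity hu⟩
  smul_mem' := by
    rintro k f ⟨c, ⟨F, hF, hfF, hc⟩, hc0⟩
    refine ⟨k • c, ⟨k • F, hF.const_smul k, ?_, ?_⟩, fun α hα => by simp [hc0 α hα]⟩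
    · exact (Lp.coeFn_smul _ _).trans (hfF.const_smul k)
    · have h := (uniformContinuous_const_smul k).comp_tendstoLocallyUniformlyOn hc
      refine h.congr (fun s z _ => ?_)
      simp [Finset.mul_sum, mul_assoc]

theorem integrable_mul_conj {μ : Measure (ℂ × ℂ)} {p q : ℝ≥0∞} [ENNReal.HolderConjugate p q]
    (f : Lp ℂ p μ) (g : Lp ℂ q μ) : Integrable (fun z => f z * conj (g z)) μ :=
  (Lp.memLp f).integrable_mul (Lp.memLp g).star

theorem norm_integral_mul_conj_le {μ : Measure (ℂ × ℂ)} {p q : ℝ≥0∞}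
    [Fact (1 ≤ p)] [Fact (1 ≤ q)] [ENNReal.HolderConjugate p q]
    (f : Lp ℂ p μ) (g : Lp ℂ q μ) :
    ‖∫ z, f z * conj (g z) ∂μ‖ ≤ 1 * ‖g‖ * ‖f‖ := by
  have hstar : ‖star g‖ = ‖g‖ := by
    rw [Lp.norm_def, Lp.norm_def, eLpNorm_congr_ae (Lp.coeFn_star g)]
    congr 1
    exact eLpNorm_congr_norm_ae (Filter.Eventually.of_forall fun z => by simp)
  have h : ∫ z, f z * conj (g z) ∂μ
      = (ContinuousLinearMap.mul ℂ ℂ).lpPairing μ p q f (star g) := by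
    rw [ContinuousLinearMap.lpPairing_eq_integral]
    refine integral_congr_ae ?_
    filter_upwards [Lp.coeFn_star g] with z hz
    simp [hz]
  have h2 := (ContinuousLinearMap.mul ℂ ℂ).norm_holder_apply_apply_le (r := 1) f (star g)
  have h3 : ‖(ContinuousLinearMap.mul ℂ ℂ).lpPairing μ p q f (star g)‖
      ≤ ‖(ContinuousLinearMap.mul ℂ ℂ).holder 1 f (star g)‖ := by
    rw [ContinuousLinearMap.lpPairing_eq_integral]
    rw [integral_congr_ae ((ContinuousLinearMap.mul ℂ ℂ).coeFn_holder (r := 1) f (star g)).symm]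
    rw [← L1.integral_eq_integral]
    exact L1.norm_integral_le _
  rw [h]
  refine h3.trans (h2.trans ?_)
  rw [hstar]
  have := ContinuousLinearMap.opNorm_mul_le ℂ ℂ
  have h4 := mul_le_mul_of_nonneg_right this (mul_nonneg (norm_nonneg f) (norm_nonneg g))
  nlinarith [h4]

/-- The conjugate-linear map `Φ_p : A^q(Ω) → A^p(Ω)'`, `Φ_p(g)(f) = ∫_Ω f ḡ dV`, for conjugate
exponents `p` and `q`. -/
def dualityMap (Ω : Set (ℂ × ℂ)) (p q : ℝ≥0∞) [Fact (1 ≤ p)] [Fact (1 ≤ q)]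
    [ENNReal.HolderConjugate p q] :
    bergmanSpace Ω q →L⋆[ℂ] StrongDual ℂ (bergmanSpace Ω p) :=
  LinearMap.mkContinuous₂
    (LinearMap.mk₂'ₛₗ (starRingEnd ℂ) (RingHom.id ℂ)
      (fun (g : bergmanSpace Ω q) (f : bergmanSpace Ω p) =>
        ∫ z in Ω, f.1 z * conj (g.1 z))
      (by
        intro g₁ g₂ f
        rw [← integral_add (integrable_mul_conj f.1 g₁.1) (integrable_mul_conj f.1 g₂.1)]
        refine integral_congr_ae ?_
        filter_upwards [Lp.coeFn_add g₁.1 g₂.1] with z hz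
        have hz' : (g₁ + g₂).1 z = g₁.1 z + g₂.1 z := hz
        rw [hz', map_add, mul_add])
      (by
        intro c g f
        rw [smul_eq_mul, ← integral_const_mul]
        refine integral_congr_ae ?_
        filter_upwards [Lp.coeFn_smul c g.1] with z hz
        simp [hz]
        ring)
      (by
        intro g f₁ f₂
        rw [← integral_add (integrable_mul_conj f₁.1 g.1) (integrable_mul_conj f₂.1 g.1)]
        refine integral_congr_ae ?_
        filter_upwards [Lp.coeFn_add f₁.1 f₂.1] with z hz
        have hz' : (f₁ + f₂).1 z = f₁.1 z + f₂.1 z := hz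
        rw [hz', add_mul])
      (by
        intro c g f
        rw [RingHom.id_apply, smul_eq_mul, ← integral_const_mul]
        refine integral_congr_ae ?_
        filter_upwards [Lp.coeFn_smul c f.1] with z hz
        simp [hz, mul_assoc]))
    1 (fun g f => norm_integral_mul_conj_le f.1 g.1)

theorem dualityMap_apply (Ω : Set (ℂ × ℂ)) (p q : ℝ≥0∞) [Fact (1 ≤ p)] [Fact (1 ≤ q)]
    [ENNReal.HolderConjugate p q] (g : bergmanSpace Ω q) (f : bergmanSpace Ω p) :
    dualityMap Ω p q g f = ∫ z in Ω, f.1 z * conj (g.1 z) := rfl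

end

open MeasureTheory
open scoped ENNReal ComplexConjugate Topology

noncomputable section

/-! ### Riesz representation for `L^r` over a finite measure. -/

section LpDuality

variable {X : Type*} [MeasurableSpace X] {μ : Measure X}

/-! The domain is invariant under the torus, so a Laurent coefficient is a mean over a torus orbit.
By Hölder on the orbit, a monomial occurring in a function of `A^r` lies in `A^r` itself. In the
coordinates `(z₁ / |z₂|^(n/m), z₂)` the norms of monomials are explicit: `e_α ∈ A^r` exactly when `0
≤ α₁` and `-2(m+n)/r < n α₁ + m α₂` (`mem_allowable_iff`). The threshold grows with `r`, so `A^q`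
contains monomials that `A^p` does not. This makes `G` proper and produces the extra summand `M`.

The central object is the operator with kernel `K(z,w) = ∑ e_α(z) conj(e_α(w)) / ‖e_α‖₂²`, summed
over the `L^p`-allowable `α` only. Splitting by the residue of `α₁` mod `m` turns `K` into `m`
products of arithmetico-geometric series in `z₁^m / z₂^n` and in `z₂` (`hasSum_projKernel`). With `s
= z₁^m / z₂^n` and `t = w₁^m / w₂^n` this gives `|K| ≤ C |z₂|^κ |w₂|^κ |1 - s conj t|⁻² |1 - z₂ conj
w₂|⁻²`. There are finitely many residue classes, and each leading exponent exceeds the threshold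
strictly, so `κ` can be taken strictly above the critical value. That slack is what Schur's test
needs to bound the operator on `L^p` and on `L^q` at once
(`exists_lintegral_hartogsKernel_rpow_le`).

The result (`exists_bergman_projections`) is a pair `S` on `L^p`, `T` on `L^q`, adjoint to each
other because `K` is Hermitian. `S` is a projection onto `A^p` and `T` a projection onto `G`. The
rest is functional analysis. A functional `l` on `A^p` extends to `l ∘ S` on `L^p`, is represented
by some `y ∈ L^q`, and hence by `T y ∈ G`; injectivity on `G` follows from adjointness. On `(A^q)'`,
precomposition with `T` is a continuous idempotent whose range is `Φ_q(A^p)` and whose kernel is the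
annihilator of `G`. Reflexivity of the closed subspace `A^q` of `L^q` identifies this annihilator
with `M`. The linear homeomorphisms come from composing with the conjugate-linear isometry `f ↦ conj
(f (conj z))`. -/

theorem hasSum_indicatorConstLp_iUnion [IsFiniteMeasure μ] {r : ℝ≥0∞} [Fact (1 ≤ r)] (hr : r ≠ ∞)
    {f : ℕ → Set X} (hf : ∀ i, MeasurableSet (f i)) (hd : Pairwise (Function.onFun Disjoint f)) :
    HasSum (fun i => indicatorConstLp r (hf i) (measure_ne_top μ _) (1 : ℂ))
      (indicatorConstLp r (MeasurableSet.iUnion hf) (measure_ne_top μ _) (1 : ℂ)) := by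
  have hsum : ∀ F : Finset ℕ, ∑ i ∈ F, indicatorConstLp r (hf i) (measure_ne_top μ _) (1 : ℂ)
      = indicatorConstLp r (Finset.measurableSet_biUnion F fun i _ => hf i)
        (measure_ne_top μ _) (1 : ℂ) := by
    intro F
    induction F using Finset.induction_on with
    | empty => simp
    | insert a F ha ih =>
      rw [Finset.sum_insert ha, ih, ← indicatorConstLp_disjoint_union]
      · congr 1
        simp
      · rw [Set.disjoint_iUnion₂_right]
        intro i hi
        exact hd (by rintro rfl; exact ha hi)
  unfold HasSum
  simp only [SummationFilter.unconditional_filter]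
  simp_rw [hsum]
  refine tendsto_indicatorConstLp_set hr ?_
  have hfin : ∑' i, μ (f i) ≠ ∞ := by
    rw [← measure_iUnion hd hf]; exact measure_ne_top _ _
  refine tendsto_of_tendsto_of_tendsto_of_le_of_le tendsto_const_nhds
    (ENNReal.tendsto_tsum_compl_atTop_zero hfin) (fun _ => zero_le) fun F => ?_
  -- The union and a finite partial union differ only inside the tail, whose measures sum to
  -- something tending to zero.
  refine (measure_mono ?_).trans (measure_iUnion_le fun b : {x // x ∉ F} => f b)
  rintro x (⟨hx, hx'⟩ | ⟨hx, hx'⟩)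
  · simp only [Set.mem_iUnion] at hx hx'
    obtain ⟨i, _, hi⟩ := hx
    exact absurd ⟨i, hi⟩ hx'
  · simp only [Set.mem_iUnion] at hx hx'
    obtain ⟨i, hi⟩ := hx
    simp only [Set.mem_iUnion]
    exact ⟨⟨i, fun hF => hx' ⟨i, hF, hi⟩⟩, hi⟩

/-- Continuity of `φ` makes `E ↦ φ(1_E)` countably additive, hence a signed measure. It vanishes on
null sets because their indicators are zero in `L^r`, so Radon–Nikodym applies. -/
theorem exists_real_density_of_functional [IsFiniteMeasure μ] {r : ℝ≥0∞} [Fact (1 ≤ r)]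
    (hr : r ≠ ∞) (φ : Lp ℂ r μ →+ ℝ) (hφ : Continuous φ) :
    ∃ g : X → ℝ, Integrable g μ ∧ ∀ (E : Set X) (hE : MeasurableSet E),
      φ (indicatorConstLp r hE (measure_ne_top μ _) (1 : ℂ)) = ∫ x in E, g x ∂μ := by
  classical
  let ν : SignedMeasure X :=
    { measureOf' := fun E => if hE : MeasurableSet E then
        φ (indicatorConstLp r hE (measure_ne_top μ _) (1 : ℂ)) else 0
      empty' := by simp
      not_measurable' := fun E hE => by simp [hE]
      m_iUnion' := fun f hf hd => by
        simp only [hf, MeasurableSet.iUnion hf, dif_pos]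
        exact (hasSum_indicatorConstLp_iUnion hr hf hd).map φ hφ }
  have hν : ∀ (E : Set X) (hE : MeasurableSet E),
      ν E = φ (indicatorConstLp r hE (measure_ne_top μ _) (1 : ℂ)) := fun E hE => by
    change (if hE : MeasurableSet E then _ else _) = _
    simp [hE]
  have hac : ν ≪ᵥ μ.toENNRealVectorMeasure := by
    refine VectorMeasure.AbsolutelyContinuous.mk fun E hE h0 => ?_
    rw [Measure.toENNRealVectorMeasure_apply_measurable hE] at h0
    rw [hν E hE]
    have : indicatorConstLp r hE (measure_ne_top μ _) (1 : ℂ) = 0 := by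
      rw [← norm_eq_zero]
      rw [norm_indicatorConstLp (zero_lt_one.trans_le Fact.out).ne' hr]
      have hr0 : r.toReal ≠ 0 := (ENNReal.toReal_pos (zero_lt_one.trans_le Fact.out).ne' hr).ne'
      simp [Measure.real, h0, hr0]
    rw [this, map_zero]
  refine ⟨ν.rnDeriv μ, SignedMeasure.integrable_rnDeriv _ _, fun E hE => ?_⟩
  rw [← hν E hE, ← withDensityᵥ_apply (SignedMeasure.integrable_rnDeriv _ _) hE,
    SignedMeasure.withDensityᵥ_rnDeriv_eq _ _ hac]

theorem exists_density_of_dual [IsFiniteMeasure μ] {r : ℝ≥0∞} [Fact (1 ≤ r)]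
    (hr : r ≠ ∞) (φ : StrongDual ℂ (Lp ℂ r μ)) :
    ∃ g : X → ℂ, Integrable g μ ∧ ∀ (E : Set X) (hE : MeasurableSet E),
      φ (indicatorConstLp r hE (measure_ne_top μ _) (1 : ℂ)) = ∫ x in E, g x ∂μ := by
  obtain ⟨u, hu, hu'⟩ := exists_real_density_of_functional hr
    (Complex.reAddGroupHom.comp φ.toLinearMap.toAddMonoidHom)
    (Complex.continuous_re.comp φ.continuous)
  obtain ⟨v, hv, hv'⟩ := exists_real_density_of_functional hr
    (Complex.imAddGroupHom.comp φ.toLinearMap.toAddMonoidHom)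
    (Complex.continuous_im.comp φ.continuous)
  refine ⟨fun x => u x + v x * Complex.I, hu.ofReal.add (hv.ofReal.mul_const _), fun E hE => ?_⟩
  have hadd : ∫ x in E, ((u x : ℂ) + v x * Complex.I) ∂μ
      = (∫ x in E, (u x : ℂ) ∂μ) + ∫ x in E, v x * Complex.I ∂μ :=
    integral_add hu.integrableOn.ofReal (hv.integrableOn.ofReal.mul_const _)
  rw [hadd, integral_mul_const, integral_complex_ofReal, integral_complex_ofReal, ← hu' E hE, ← hv' E hE]
  exact (Complex.re_add_im _).symm

/-- Two continuous functionals on `L^r` that agree on indicators are equal. -/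
theorem dual_ext_of_indicator [IsFiniteMeasure μ] {r : ℝ≥0∞} [Fact (1 ≤ r)] (hr : r ≠ ∞)
    {φ ψ : StrongDual ℂ (Lp ℂ r μ)}
    (h : ∀ (E : Set X) (hE : MeasurableSet E),
      φ (indicatorConstLp r hE (measure_ne_top μ _) (1 : ℂ))
        = ψ (indicatorConstLp r hE (measure_ne_top μ _) (1 : ℂ))) : φ = ψ := by
  ext f
  induction f using Lp.induction hr with
  | indicatorConst c hs hμs =>
    rename_i s
    have : (Lp.simpleFunc.indicatorConst r hs hμs.ne c : Lp ℂ r μ)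
        = c • indicatorConstLp r hs (measure_ne_top μ _) (1 : ℂ) := by
      rw [Lp.simpleFunc.coe_indicatorConst, indicatorConstLp, indicatorConstLp,
        ← MemLp.toLp_const_smul]
      refine (MemLp.toLp_eq_toLp_iff _ _).2 (Filter.Eventually.of_forall fun x => ?_)
      by_cases hx : x ∈ s <;> simp [hx]
    rw [this, map_smul, map_smul, h s hs]
  | add hf hg _ h1 h2 => rw [map_add, map_add, h1, h2]
  | isClosed => exact isClosed_eq φ.continuous ψ.continuous

/-- The functional `f ↦ ∫ f * conj y` on `L^r` given by an element `y` of the conjugate `L^s`. -/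
def lpDual {r s : ℝ≥0∞} [Fact (1 ≤ r)] [Fact (1 ≤ s)] [ENNReal.HolderConjugate r s]
    (y : Lp ℂ s μ) : StrongDual ℂ (Lp ℂ r μ) :=
  haveI : ENNReal.HolderConjugate s r := ENNReal.HolderConjugate.symm
  (ContinuousLinearMap.mul ℂ ℂ).lpPairing μ s r (star y)

theorem lpDual_apply {r s : ℝ≥0∞} [Fact (1 ≤ r)] [Fact (1 ≤ s)] [ENNReal.HolderConjugate r s]
    (y : Lp ℂ s μ) (f : Lp ℂ r μ) : lpDual y f = ∫ x, f x * conj (y x) ∂μ := by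
  rw [lpDual, ContinuousLinearMap.lpPairing_eq_integral]
  refine integral_congr_ae ?_
  filter_upwards [Lp.coeFn_star y] with x hx
  simp [hx, mul_comm]

/-- Test on the extremal function `f = conj y · |y|^(s-2)`: then `f y = |y|^s = |f|^r`, and with `I
= ∫ |y|^s` the hypothesis reads `I ≤ ‖φ‖ I^(1/r)`. Boundedness of `y` makes `I` finite, so dividing
by `I^(1/r)` is legitimate. Only the norm of `φ` matters here. -/
theorem eLpNorm_le_of_dual_bound [IsFiniteMeasure μ] {r s : ℝ≥0∞} [Fact (1 ≤ r)]
    (hr : r ≠ ∞) (hs : s ≠ ∞) [ENNReal.HolderConjugate r s]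
    (φ : StrongDual ℂ (Lp ℂ r μ)) {y : X → ℂ} {N : ℝ} (hy : Measurable y) (hN : ∀ x, ‖y x‖ ≤ N)
    (h : ∀ (f : X → ℂ) (hf : MemLp f r μ), ‖∫ x, f x * y x ∂μ‖ ≤ ‖φ‖ * ‖hf.toLp f‖) :
    eLpNorm y s μ ≤ ENNReal.ofReal ‖φ‖ := by
  have hrs : r.toReal.HolderConjugate s.toReal :=
    ENNReal.HolderConjugate.toReal_of_ne_top hr hs
  set R := r.toReal
  set S := s.toReal
  have hr0 : r ≠ 0 := ENNReal.HolderConjugate.ne_zero r s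
  have hs0 : s ≠ 0 := ENNReal.HolderConjugate.ne_zero s r
  have hys : MemLp y s μ :=
    MemLp.of_bound hy.aestronglyMeasurable N (Filter.Eventually.of_forall hN)
  set f : X → ℂ := fun x => conj (y x) * ((‖y x‖ ^ (S - 2) : ℝ) : ℂ) with hfdef
  have hS1 : 1 < S := hrs.symm.lt
  have hfn : ∀ x, ‖f x‖ = ‖y x‖ ^ (S - 1) := by
    intro x
    rcases eq_or_ne (y x) 0 with h0 | h0
    · simp [hfdef, h0, Real.zero_rpow (sub_pos.2 hS1).ne']
    · have hpos : 0 < ‖y x‖ := norm_pos_iff.2 h0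
      simp only [hfdef, norm_mul, RCLike.norm_conj, Complex.norm_real, Real.norm_eq_abs,
        abs_of_nonneg (Real.rpow_nonneg (norm_nonneg _) _)]
      rw [← Real.rpow_one_add' hpos.le (by linarith)]
      ring_nf
  have hfm : Measurable f := by fun_prop
  have hN0 : ∀ x, ‖f x‖ ≤ N ^ (S - 1) := fun x => by
    rw [hfn]
    exact Real.rpow_le_rpow (norm_nonneg _) (hN x) (sub_pos.2 hS1).le
  have hf : MemLp f r μ :=
    MemLp.of_bound hfm.aestronglyMeasurable _ (Filter.Eventually.of_forall hN0)
  set I := ∫ x, ‖y x‖ ^ S ∂μ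
  have hI0 : 0 ≤ I := integral_nonneg fun x => Real.rpow_nonneg (norm_nonneg _) _
  have h1 : ∫ x, f x * y x ∂μ = (I : ℂ) := by
    rw [← integral_complex_ofReal]
    refine integral_congr_ae (Filter.Eventually.of_forall fun x => ?_)
    simp only [hfdef]
    rw [mul_right_comm, mul_comm (conj _), Complex.mul_conj, ← Complex.ofReal_mul,
      Complex.normSq_eq_norm_sq]
    rcases eq_or_ne (y x) 0 with h0 | h0
    · simp [h0, Real.zero_rpow (zero_lt_one.trans hS1).ne']
    · have hpos : 0 < ‖y x‖ := norm_pos_iff.2 h0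
      rw [← Real.rpow_natCast, ← Real.rpow_add hpos]
      norm_num
  have h2 : ‖hf.toLp f‖ = I ^ R⁻¹ := by
    rw [Lp.norm_toLp, hf.eLpNorm_eq_integral_rpow_norm hr0 hr, ENNReal.toReal_ofReal (by positivity)]
    congr 1
    refine integral_congr_ae (Filter.Eventually.of_forall fun x => ?_)
    simp only [hfn]
    rw [← Real.rpow_mul (norm_nonneg _)]
    congr 1
    exact hrs.symm.sub_one_mul_conj
  have h3 := h f hf
  rw [h1, h2, Complex.norm_real, Real.norm_of_nonneg hI0] at h3
  rw [hys.eLpNorm_eq_integral_rpow_norm hs0 hs]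
  refine ENNReal.ofReal_le_ofReal ?_
  change I ^ S⁻¹ ≤ _
  rcases hI0.eq_or_lt with h0 | hpos
  · rw [← h0, Real.zero_rpow (inv_pos.2 (zero_lt_one.trans hS1)).ne']
    exact norm_nonneg _
  · have h4 : I = I ^ S⁻¹ * I ^ R⁻¹ := by
      rw [← Real.rpow_add hpos, hrs.symm.inv_add_inv_eq_one, Real.rpow_one]
    have h5 : 0 < I ^ R⁻¹ := Real.rpow_pos_of_pos hpos _
    nth_rw 1 [h4] at h3
    exact le_of_mul_le_mul_right h3 h5

/-- Riesz representation: `(L^r)' = L^s` for a finite measure and conjugate finite exponents. -/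
theorem exists_eq_lpDual [IsFiniteMeasure μ] {r s : ℝ≥0∞} [Fact (1 ≤ r)] [Fact (1 ≤ s)]
    (hr : r ≠ ∞) (hs : s ≠ ∞) [ENNReal.HolderConjugate r s] (φ : StrongDual ℂ (Lp ℂ r μ)) :
    ∃ y : Lp ℂ s μ, φ = lpDual y := by
  obtain ⟨g₀, hg₀, hφ₀⟩ := exists_density_of_dual hr φ
  obtain ⟨g, hgm, hgg⟩ : ∃ g : X → ℂ, Measurable g ∧ g₀ =ᵐ[μ] g :=
    ⟨hg₀.1.aemeasurable.mk _, hg₀.1.aemeasurable.measurable_mk, hg₀.1.aemeasurable.ae_eq_mk⟩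
  have hφ : ∀ (E : Set X) (hE : MeasurableSet E),
      φ (indicatorConstLp r hE (measure_ne_top μ _) (1 : ℂ)) = ∫ x in E, g x ∂μ := fun E hE => by
    rw [hφ₀ E hE]
    exact integral_congr_ae (ae_restrict_of_ae hgg)
  -- So far the density `g` is only integrable. Cutting it off where `|g| ≤ N` gives bounded
  -- functions, to which the extremal test applies with a bound independent of `N`.
  let T : ℕ → Set X := fun N => {x | ‖g x‖ ≤ N}
  have hT : ∀ N, MeasurableSet (T N) := fun N => measurableSet_le hgm.norm measurable_const
  let y : ℕ → X → ℂ := fun N => (T N).indicator g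
  have hym : ∀ N, Measurable (y N) := fun N => hgm.indicator (hT N)
  have hyb : ∀ N x, ‖y N x‖ ≤ N := fun N x => by
    by_cases hx : x ∈ T N
    · simp only [y, Set.indicator_of_mem hx]
      exact hx
    · simp [y, hx]
  have hys : ∀ N, MemLp (fun x => conj (y N x)) s μ := fun N =>
    MemLp.of_bound (by fun_prop) N (Filter.Eventually.of_forall fun x => by simpa using hyb N x)
  let cut : ℕ → Lp ℂ r μ →L[ℂ] Lp ℂ r μ := fun N =>
    (ContinuousLinearMap.mul ℂ ℂ).holderL μ ∞ r r
      (indicatorConstLp ∞ (hT N) (measure_ne_top μ _) (1 : ℂ))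
  have hcut : ∀ N (f : Lp ℂ r μ), (cut N f : X → ℂ) =ᵐ[μ] (T N).indicator f := fun N f => by
    have h1 := (ContinuousLinearMap.mul ℂ ℂ).coeFn_holder (r := r)
      (indicatorConstLp ∞ (hT N) (measure_ne_top μ _) (1 : ℂ)) f
    filter_upwards [h1, indicatorConstLp_coeFn (p := ∞) (hs := hT N) (hμs := measure_ne_top μ _)
      (c := (1 : ℂ))] with x hx hx'
    simp only [cut, ContinuousLinearMap.holderL_apply_apply]
    rw [hx, hx']
    by_cases hxT : x ∈ T N <;> simp [hxT]
  have hrep : ∀ N, φ.comp (cut N) = lpDual (hys N).toLp := fun N => by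
    refine dual_ext_of_indicator hr fun E hE => ?_
    have h1 : cut N (indicatorConstLp r hE (measure_ne_top μ _) (1 : ℂ))
        = indicatorConstLp r ((hT N).inter hE) (measure_ne_top μ _) (1 : ℂ) := by
      refine Lp.ext ?_
      filter_upwards [hcut N (indicatorConstLp r hE (measure_ne_top μ _) (1 : ℂ)),
        indicatorConstLp_coeFn (p := r) (hs := hE) (hμs := measure_ne_top μ _) (c := (1 : ℂ)),
        indicatorConstLp_coeFn (p := r) (hs := (hT N).inter hE) (hμs := measure_ne_top μ _)
          (c := (1 : ℂ))] with x h1 h2 h3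
      rw [h1, h3]
      by_cases hxT : x ∈ T N <;> by_cases hxE : x ∈ E <;> simp [hxT, hxE, h2]
    rw [ContinuousLinearMap.comp_apply, h1, hφ, lpDual_apply,
      ← integral_indicator ((hT N).inter hE)]
    refine integral_congr_ae ?_
    filter_upwards [indicatorConstLp_coeFn (p := r) (hs := hE) (hμs := measure_ne_top μ _)
      (c := (1 : ℂ)), (hys N).coeFn_toLp] with x h1 h2
    rw [h1, h2]
    by_cases hxT : x ∈ T N <;> by_cases hxE : x ∈ E <;> simp [y, hxT, hxE]
  have hbound : ∀ N, eLpNorm (y N) s μ ≤ ENNReal.ofReal ‖φ‖ := fun N => by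
    refine eLpNorm_le_of_dual_bound hr hs φ (hym N) (hyb N) fun f hf => ?_
    have h1 : ∫ x, f x * y N x ∂μ = φ (cut N (hf.toLp f)) := by
      rw [← ContinuousLinearMap.comp_apply, hrep, lpDual_apply]
      refine integral_congr_ae ?_
      filter_upwards [hf.coeFn_toLp, (hys N).coeFn_toLp] with x hx hx'
      simp [hx, hx']
    rw [h1]
    refine (φ.le_opNorm _).trans (mul_le_mul_of_nonneg_left ?_ (norm_nonneg _))
    refine Lp.norm_le_norm_of_ae_le ?_
    filter_upwards [hcut N (hf.toLp f)] with x hx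
    rw [hx]
    exact norm_indicator_le_norm_self _ _
  have hlim : ∀ x, Filter.Tendsto (fun N => y N x) Filter.atTop (𝓝 (g x)) := fun x => by
    refine tendsto_const_nhds.congr' ?_
    filter_upwards [Filter.eventually_ge_atTop (⌈‖g x‖⌉₊ : ℕ)] with N hN
    have : x ∈ T N := (Nat.le_ceil ‖g x‖).trans (Nat.cast_le.2 hN)
    simp [y, this]
  -- Fatou's lemma carries the uniform bound on the truncations over to `g`.
  have hgs : MemLp g s μ := by
    refine ⟨hgm.aestronglyMeasurable, ?_⟩
    refine (Lp.eLpNorm_lim_le_liminf_eLpNorm (fun N => (hym N).aestronglyMeasurable) g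
      (Filter.Eventually.of_forall hlim)).trans_lt ?_
    refine lt_of_le_of_lt ?_ (ENNReal.ofReal_lt_top (r := ‖φ‖))
    refine (Filter.liminf_le_liminf (Filter.Eventually.of_forall hbound)).trans ?_
    simp
  refine ⟨hgs.star.toLp, dual_ext_of_indicator hr fun E hE => ?_⟩
  rw [hφ, lpDual_apply, ← integral_indicator hE]
  refine integral_congr_ae ?_
  filter_upwards [indicatorConstLp_coeFn (p := r) (hs := hE) (hμs := measure_ne_top μ _)
      (c := (1 : ℂ)), hgs.star.coeFn_toLp] with x h1 h2
  rw [h1, h2]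
  by_cases hxE : x ∈ E <;> simp [hxE]

/-- The measure being finite, indicators of all measurable sets are available as test functions, and
`y` is integrable. -/
theorem lpDual_injective [IsFiniteMeasure μ] {r s : ℝ≥0∞} [Fact (1 ≤ r)] [Fact (1 ≤ s)]
    [ENNReal.HolderConjugate r s] {y : Lp ℂ s μ} (h : ∀ f : Lp ℂ r μ, lpDual y f = 0) :
    y = 0 := by
  have hint : Integrable (fun x => conj (y x)) μ :=
    ((Lp.memLp y).star.integrable Fact.out)
  have h0 := hint.ae_eq_zero_of_forall_setIntegral_eq_zero fun E hE _ => by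
    have h1 := h (indicatorConstLp r hE (measure_ne_top μ _) (1 : ℂ))
    rw [lpDual_apply] at h1
    rw [← h1, ← integral_indicator hE]
    refine integral_congr_ae ?_
    filter_upwards [indicatorConstLp_coeFn (p := r) (hs := hE) (hμs := measure_ne_top μ _)
      (c := (1 : ℂ))] with x h1
    rw [h1]
    by_cases hxE : x ∈ E <;> simp [hxE]
  rw [Lp.eq_zero_iff_ae_eq_zero]
  filter_upwards [h0] with x hx
  simpa using hx

end LpDuality

/-- Schur's test for a nonnegative kernel `k` with test function `h`. -/
theorem lintegral_kernel_rpow_le {X : Type*} [MeasurableSpace X] {μ : Measure X} [SFinite μ]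
    {R S : ℝ} (hRS : R.HolderConjugate S) {k : X → X → ℝ≥0∞}
    (hk : Measurable (Function.uncurry k)) {h : X → ℝ≥0∞} (hh : Measurable h)
    (hpos : ∀ᵐ x ∂μ, h x ≠ 0 ∧ h x ≠ ∞) {C : ℝ≥0∞}
    (h₁ : ∀ᵐ x ∂μ, ∫⁻ y, k x y * h y ^ S ∂μ ≤ C * h x ^ S)
    (h₂ : ∀ᵐ y ∂μ, ∫⁻ x, k x y * h x ^ R ∂μ ≤ C * h y ^ R)
    {f : X → ℝ≥0∞} (hf : Measurable f) :
    ∫⁻ x, (∫⁻ y, k x y * f y ∂μ) ^ R ∂μ ≤ C ^ (R / S) * C * ∫⁻ y, f y ^ R ∂μ := by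
  have hR := hRS.pos
  have hS := hRS.symm.pos
  have hkx : ∀ x, Measurable (k x) := fun x => hk.comp measurable_prodMk_left
  have hky : ∀ y, Measurable (fun x => k x y) := fun y => hk.comp measurable_prodMk_right
  -- Hölder for the splitting `k f = (k^(1/S) h) · (k^(1/R) h⁻¹ f)`; the first factor is then
  -- controlled by `h₁`.
  have step : ∀ᵐ x ∂μ, (∫⁻ y, k x y * f y ∂μ) ^ R
      ≤ C ^ (R / S) * ∫⁻ y, h x ^ R * (k x y * ((h y)⁻¹ * f y) ^ R) ∂μ := by
    filter_upwards [h₁] with x hx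
    have e : ∫⁻ y, k x y * f y ∂μ
        = ∫⁻ y, ((fun y => k x y ^ (1 / S) * h y) * (fun y => k x y ^ (1 / R) * ((h y)⁻¹ * f y))) y ∂μ := by
      refine lintegral_congr_ae ?_
      filter_upwards [hpos] with y hy
      have hk1 : k x y ^ (1 / S) * k x y ^ (1 / R) = k x y := by
        rw [← ENNReal.rpow_add_of_nonneg _ _ (by positivity) (by positivity), one_div, one_div,
          hRS.symm.inv_add_inv_eq_one, ENNReal.rpow_one]
      calc k x y * f y = (k x y ^ (1 / S) * k x y ^ (1 / R)) * ((h y * (h y)⁻¹) * f y) := by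
            rw [hk1, ENNReal.mul_inv_cancel hy.1 hy.2, one_mul]
        _ = _ := by simp only [Pi.mul_apply]; ring
    have hol := ENNReal.lintegral_mul_le_Lp_mul_Lq μ hRS.symm
      (f := fun y => k x y ^ (1 / S) * h y) (g := fun y => k x y ^ (1 / R) * ((h y)⁻¹ * f y))
      (((hkx x).pow_const _).mul hh).aemeasurable
      (((hkx x).pow_const _).mul (hh.inv.mul hf)).aemeasurable
    rw [← e] at hol
    have e1 : ∀ y, (k x y ^ (1 / S) * h y) ^ S = k x y * h y ^ S := fun y => by
      rw [ENNReal.mul_rpow_of_nonneg _ _ hS.le, ← ENNReal.rpow_mul, one_div_mul_cancel hS.ne',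
        ENNReal.rpow_one]
    have e2 : ∀ y, (k x y ^ (1 / R) * ((h y)⁻¹ * f y)) ^ R = k x y * ((h y)⁻¹ * f y) ^ R := fun y => by
      rw [ENNReal.mul_rpow_of_nonneg _ _ hR.le, ← ENNReal.rpow_mul, one_div_mul_cancel hR.ne',
        ENNReal.rpow_one]
    simp only [e1, e2] at hol
    have hm : Measurable fun y => k x y * ((h y)⁻¹ * f y) ^ R :=
      (hkx x).mul ((hh.inv.mul hf).pow_const _)
    calc (∫⁻ y, k x y * f y ∂μ) ^ R
        ≤ ((C * h x ^ S) ^ (1 / S) * (∫⁻ y, k x y * ((h y)⁻¹ * f y) ^ R ∂μ) ^ (1 / R)) ^ R := by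
          refine ENNReal.rpow_le_rpow (hol.trans ?_) hR.le
          gcongr
      _ = _ := by
          rw [ENNReal.mul_rpow_of_nonneg _ _ hR.le, ← ENNReal.rpow_mul, ← ENNReal.rpow_mul,
            one_div_mul_cancel hR.ne', ENNReal.rpow_one,
            ENNReal.mul_rpow_of_nonneg _ _ (by positivity), ← ENNReal.rpow_mul,
            lintegral_const_mul _ hm]
          have : S * (1 / S * R) = R := by field_simp
          rw [this, one_div_mul_eq_div, mul_assoc]
  calc ∫⁻ x, (∫⁻ y, k x y * f y ∂μ) ^ R ∂μ
      ≤ ∫⁻ x, C ^ (R / S) * ∫⁻ y, h x ^ R * (k x y * ((h y)⁻¹ * f y) ^ R) ∂μ ∂μ :=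
        lintegral_mono_ae step
    _ = C ^ (R / S) * ∫⁻ x, ∫⁻ y, h x ^ R * (k x y * ((h y)⁻¹ * f y) ^ R) ∂μ ∂μ := by
        refine lintegral_const_mul _ (Measurable.lintegral_prod_right' (f := fun p : X × X =>
          h p.1 ^ R * (k p.1 p.2 * ((h p.2)⁻¹ * f p.2) ^ R)) ?_)
        have hk' : Measurable fun p : X × X => k p.1 p.2 := hk
        fun_prop
    _ = C ^ (R / S) * ∫⁻ y, ∫⁻ x, h x ^ R * (k x y * ((h y)⁻¹ * f y) ^ R) ∂μ ∂μ := by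
        rw [lintegral_lintegral_swap]
        have hk' : Measurable fun p : X × X => k p.1 p.2 := hk
        refine Measurable.aemeasurable ?_
        change Measurable fun p : X × X => h p.1 ^ R * (k p.1 p.2 * ((h p.2)⁻¹ * f p.2) ^ R)
        fun_prop
    _ ≤ C ^ (R / S) * ∫⁻ y, C * f y ^ R ∂μ := by
        refine mul_le_mul_right ?_ _
        refine lintegral_mono_ae ?_
        -- With the order of integration exchanged, the inner integral is the one estimated by `h₂`,
        -- and the powers of `h y` cancel.
        filter_upwards [h₂, hpos] with y hy hy'
        calc ∫⁻ x, h x ^ R * (k x y * ((h y)⁻¹ * f y) ^ R) ∂μ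
            = ((h y)⁻¹ * f y) ^ R * ∫⁻ x, k x y * h x ^ R ∂μ := by
              have hm : Measurable fun x => k x y * h x ^ R := (hky y).mul (hh.pow_const _)
              rw [← lintegral_const_mul _ hm]
              refine lintegral_congr fun x => by ring
          _ ≤ ((h y)⁻¹ * f y) ^ R * (C * h y ^ R) := by gcongr
          _ = C * (((h y)⁻¹ * h y) ^ R * f y ^ R) := by
              rw [ENNReal.mul_rpow_of_nonneg _ _ hR.le, ENNReal.mul_rpow_of_nonneg _ _ hR.le]; ring
          _ = C * f y ^ R := by
              rw [ENNReal.inv_mul_cancel hy'.1 hy'.2, ENNReal.one_rpow, one_mul]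
    _ = _ := by rw [lintegral_const_mul _ (hf.pow_const _), mul_assoc]

/-! ### Torus rotations and averages over their orbits. -/

instance isProbabilityMeasure_unitAddCircle :
    IsProbabilityMeasure (volume : Measure UnitAddCircle) :=
  ⟨by simp [AddCircle.measure_univ]⟩

/-- The action of the torus on `ℂ²` by rotations of the coordinates. -/
def torusRot (t : UnitAddCircle × UnitAddCircle) (z : ℂ × ℂ) : ℂ × ℂ :=
  (AddCircle.toCircle t.1 * z.1, AddCircle.toCircle t.2 * z.2)

@[simp] theorem torusRot_fst (t : UnitAddCircle × UnitAddCircle) (z : ℂ × ℂ) :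
    (torusRot t z).1 = AddCircle.toCircle t.1 * z.1 := rfl

@[simp] theorem torusRot_snd (t : UnitAddCircle × UnitAddCircle) (z : ℂ × ℂ) :
    (torusRot t z).2 = AddCircle.toCircle t.2 * z.2 := rfl

theorem norm_toCircle_mul (t : UnitAddCircle) (w : ℂ) : ‖(AddCircle.toCircle t : ℂ) * w‖ = ‖w‖ := by
  rw [norm_mul, Circle.norm_coe, one_mul]

theorem torusRot_zero (z : ℂ × ℂ) : torusRot 0 z = z := by
  ext <;> simp [AddCircle.toCircle_zero]

theorem continuous_torusRot :
    Continuous fun p : (UnitAddCircle × UnitAddCircle) × (ℂ × ℂ) => torusRot p.1 p.2 := by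
  have h : Continuous fun t : UnitAddCircle => ((AddCircle.toCircle t : Circle) : ℂ) :=
    continuous_subtype_val.comp AddCircle.continuous_toCircle
  refine Continuous.prodMk ?_ ?_
  · exact (h.comp (continuous_fst.comp continuous_fst)).mul (continuous_fst.comp continuous_snd)
  · exact (h.comp (continuous_snd.comp continuous_fst)).mul (continuous_snd.comp continuous_snd)

theorem continuous_torusRot_left (z : ℂ × ℂ) : Continuous fun t => torusRot t z :=
  continuous_torusRot.comp (continuous_id.prodMk continuous_const)

theorem measurePreserving_torusRot (t : UnitAddCircle × UnitAddCircle) :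
    MeasurePreserving (torusRot t) (volume : Measure (ℂ × ℂ)) volume :=
  ((rotation (AddCircle.toCircle t.1)).measurePreserving).prod
    ((rotation (AddCircle.toCircle t.2)).measurePreserving)

section Average

variable {μ : Measure (ℂ × ℂ)} [SFinite μ]

/-- Supplies the joint integrability on torus times space that Fubini requires in
`integral_eq_integral_torus`. -/
theorem measurePreserving_torusRot_skew (hμ : ∀ t, MeasurePreserving (torusRot t) μ μ) :
    MeasurePreserving (fun p : (UnitAddCircle × UnitAddCircle) × (ℂ × ℂ) => (p.1, torusRot p.1 p.2))
      ((volume : Measure (UnitAddCircle × UnitAddCircle)).prod μ) (volume.prod μ) :=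
  (MeasurePreserving.id volume).skew_product (g := torusRot) continuous_torusRot.measurable
    (Filter.Eventually.of_forall fun t => (hμ t).map_eq)

/-- After Tonelli, each rotation leaves the integral unchanged and the torus has total mass one. -/
theorem lintegral_eq_lintegral_torus (hμ : ∀ t, MeasurePreserving (torusRot t) μ μ)
    {f : ℂ × ℂ → ℝ≥0∞} (hf : Measurable f) :
    ∫⁻ z, f z ∂μ = ∫⁻ z, (∫⁻ t, f (torusRot t z)) ∂μ := by
  rw [lintegral_lintegral_swap]
  · simp_rw [(hμ _).lintegral_comp hf]
    simp
  · exact (hf.comp (continuous_torusRot.measurable.comp measurable_swap)).aemeasurable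

theorem integral_eq_integral_torus (hμ : ∀ t, MeasurePreserving (torusRot t) μ μ)
    {f : ℂ × ℂ → ℂ} (hf : Integrable f μ) :
    ∫ z, f z ∂μ = ∫ z, (∫ t, f (torusRot t z)) ∂μ := by
  have h1 : Integrable (fun p : (UnitAddCircle × UnitAddCircle) × (ℂ × ℂ) => f (torusRot p.1 p.2))
      ((volume : Measure (UnitAddCircle × UnitAddCircle)).prod μ) :=
    (measurePreserving_torusRot_skew hμ).integrable_comp_of_integrable (hf.comp_snd _)
  rw [integral_integral_swap (f := fun z t => f (torusRot t z)) h1.swap]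
  have h2 : ∀ t, ∫ z, f (torusRot t z) ∂μ = ∫ z, f z ∂μ := fun t => by
    have h := integral_map (hμ t).measurable.aemeasurable
      (f := f) (by rw [(hμ t).map_eq]; exact hf.1)
    rw [(hμ t).map_eq] at h
    exact h.symm
  simp_rw [h2]
  simp

end Average

/-! ### Means of holomorphic functions over circles. -/

section CircleMean

/-- Translation invariance on the circle absorbs the argument of `w`, so only its modulus survives;
the rest is the substitution `θ = 2πx`. -/
theorem integral_toCircle_mul_eq_circleAverage (g : ℂ → ℂ) (w : ℂ) :
    ∫ t : UnitAddCircle, g (AddCircle.toCircle t * w) = Real.circleAverage g 0 ‖w‖ := by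
  obtain ⟨s, hs⟩ : ∃ s : UnitAddCircle, (AddCircle.toCircle s : ℂ) * ‖w‖ = w := by
    refine ⟨((Complex.arg w / (2 * Real.pi) : ℝ) : UnitAddCircle), ?_⟩
    rw [AddCircle.toCircle_apply_mk, Circle.coe_exp, mul_comm]
    have : (2 * Real.pi / 1 * (Complex.arg w / (2 * Real.pi)) : ℝ) = Complex.arg w := by
      field_simp
    rw [this]
    exact Complex.norm_mul_exp_arg_mul_I w
  have h1 : ∫ t : UnitAddCircle, g (AddCircle.toCircle t * w)
      = ∫ t : UnitAddCircle, g (AddCircle.toCircle t * ‖w‖) := by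
    rw [← integral_add_right_eq_self (fun t : UnitAddCircle => g (AddCircle.toCircle t * ‖w‖)) s]
    refine integral_congr_ae (Filter.Eventually.of_forall fun t => ?_)
    simp only [AddCircle.toCircle_add, Circle.coe_mul]
    rw [mul_assoc, hs]
  rw [h1, ← UnitAddCircle.intervalIntegral_preimage 0, Real.circleAverage_def]
  have h2 := intervalIntegral.integral_comp_mul_left (a := 0) (b := 1)
    (fun θ : ℝ => g (circleMap 0 ‖w‖ θ)) (c := 2 * Real.pi) (by positivity)
  rw [mul_zero, mul_one] at h2
  rw [zero_add, ← h2]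
  refine intervalIntegral.integral_congr fun x _ => ?_
  simp only [AddCircle.toCircle_apply_mk, Circle.coe_exp, circleMap, zero_add]
  congr 1
  rw [mul_comm]
  simp

/-- The average is, up to a constant, the contour integral of `g(z)/z`, which Cauchy's theorem on
the annulus makes independent of the radius. -/
theorem circleAverage_eq_of_annulus {g : ℂ → ℂ} {r R : ℝ} (hr : 0 < r) (hrR : r ≤ R)
    (hg : ∀ ζ : ℂ, r ≤ ‖ζ‖ → ‖ζ‖ ≤ R → DifferentiableAt ℂ g ζ) :
    Real.circleAverage g 0 R = Real.circleAverage g 0 r := by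
  rw [Real.circleAverage_eq_circleIntegral hr.ne',
    Real.circleAverage_eq_circleIntegral (hr.trans_le hrR).ne']
  congr 1
  have hd : ∀ ζ : ℂ, r ≤ ‖ζ‖ → ‖ζ‖ ≤ R → DifferentiableAt ℂ (fun z => (z - 0)⁻¹ • g z) ζ := by
    intro ζ h1 h2
    have h0 : ζ - 0 ≠ 0 := by
      rw [sub_zero]; exact norm_pos_iff.1 (hr.trans_le h1)
    exact ((differentiableAt_id.sub_const (0 : ℂ)).inv h0).smul (hg ζ h1 h2)
  refine Complex.circleIntegral_eq_of_differentiable_on_annulus_off_countable hr hrR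
    Set.countable_empty ?_ ?_
  · intro ζ hζ
    simp only [Set.mem_sdiff, mem_closedBall_zero_iff, mem_ball_zero_iff, not_lt] at hζ
    exact (hd ζ hζ.2 hζ.1).continuousAt.continuousWithinAt
  · intro ζ hζ
    simp only [Set.mem_sdiff, mem_closedBall_zero_iff, mem_ball_zero_iff, not_le] at hζ
    exact hd ζ hζ.1.2.le hζ.1.1.le

/-- The mean of a holomorphic function over circles in an annulus does not depend on the radius. -/
theorem integral_toCircle_mul_eq_of_annulus {g : ℂ → ℂ} {w w' : ℂ} (hw : w ≠ 0)
    (hww : ‖w‖ ≤ ‖w'‖)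
    (hg : ∀ ζ : ℂ, ‖w‖ ≤ ‖ζ‖ → ‖ζ‖ ≤ ‖w'‖ → DifferentiableAt ℂ g ζ) :
    ∫ t : UnitAddCircle, g (AddCircle.toCircle t * w')
      = ∫ t : UnitAddCircle, g (AddCircle.toCircle t * w) := by
  rw [integral_toCircle_mul_eq_circleAverage, integral_toCircle_mul_eq_circleAverage,
    circleAverage_eq_of_annulus (norm_pos_iff.2 hw) hww hg]

theorem integral_toCircle_mul_eq_of_disc {g : ℂ → ℂ} {w : ℂ}
    (hg : ∀ ζ : ℂ, ‖ζ‖ ≤ ‖w‖ → DifferentiableAt ℂ g ζ) :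
    ∫ t : UnitAddCircle, g (AddCircle.toCircle t * w) = g 0 := by
  rw [integral_toCircle_mul_eq_circleAverage]
  refine DiffContOnCl.circleAverage (DifferentiableOn.diffContOnCl fun ζ hζ => ?_)
  refine (hg ζ ?_).differentiableWithinAt
  have := Metric.closure_ball_subset_closedBall hζ
  simpa using this

/-- The mean of the Poisson-type kernel `1 / ‖1 - ζ‖ ^ 2` over a circle. -/
theorem integral_toCircle_inv_norm_sq {x : ℂ} (hx : ‖x‖ < 1) :
    ∫ t : UnitAddCircle, (1 / ‖1 - AddCircle.toCircle t * x‖ ^ 2 : ℝ) = 1 / (1 - ‖x‖ ^ 2) := by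
  have h1 : 0 < 1 - ‖x‖ ^ 2 := by nlinarith [norm_nonneg x]
  have hne : ∀ ζ : ℂ, ‖ζ‖ ≤ ‖x‖ → 1 - ζ ≠ 0 := fun ζ hζ h => by
    rw [sub_eq_zero] at h
    rw [← h, norm_one] at hζ
    linarith
  -- On the circle `|ζ| = |x|` one has `(1 - |x|²) / |1 - ζ|² = Re ((1 + ζ)/(1 - ζ))`, and the
  -- holomorphic function on the right has mean equal to its value `1` at the origin.
  have hmean : ∫ t : UnitAddCircle,
      ((1 + AddCircle.toCircle t * x) / (1 - AddCircle.toCircle t * x) : ℂ) = 1 := by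
    rw [integral_toCircle_mul_eq_of_disc (g := fun ζ => (1 + ζ) / (1 - ζ))]
    · simp
    · intro ζ hζ
      exact ((differentiableAt_const _).add differentiableAt_id).div
        ((differentiableAt_const _).sub differentiableAt_id) (hne ζ hζ)
  have hcont : Continuous fun t : UnitAddCircle =>
      ((1 + AddCircle.toCircle t * x) / (1 - AddCircle.toCircle t * x) : ℂ) := by
    have h : Continuous fun t : UnitAddCircle => ((AddCircle.toCircle t : Circle) : ℂ) :=
      continuous_subtype_val.comp AddCircle.continuous_toCircle
    exact (continuous_const.add (h.mul continuous_const)).div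
      (continuous_const.sub (h.mul continuous_const)) fun t => hne _ (norm_toCircle_mul t x).le
  have hint : Integrable (fun t : UnitAddCircle =>
      ((1 + AddCircle.toCircle t * x) / (1 - AddCircle.toCircle t * x) : ℂ)) :=
    hcont.integrable_of_hasCompactSupport (HasCompactSupport.of_compactSpace _)
  have hre : ∫ t : UnitAddCircle,
      ((1 + AddCircle.toCircle t * x) / (1 - AddCircle.toCircle t * x) : ℂ).re = 1 := by
    have := integral_re hint
    simp only [RCLike.re_to_complex] at this
    rw [this, hmean, Complex.one_re]
  have hpt : ∀ ζ : ℂ, ‖ζ‖ = ‖x‖ →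
      (1 / ‖1 - ζ‖ ^ 2 : ℝ) = (1 / (1 - ‖x‖ ^ 2)) * ((1 + ζ) / (1 - ζ)).re := fun ζ hζ => by
    have h0 := hne ζ hζ.le
    have h2 : Complex.normSq (1 - ζ) ≠ 0 := by simpa using h0
    rw [Complex.div_re, ← Complex.normSq_eq_norm_sq, ← hζ, ← Complex.normSq_eq_norm_sq]
    rw [← hζ, ← Complex.normSq_eq_norm_sq] at h1
    field_simp
    simp [Complex.normSq_apply]
    ring
  have hn : ∀ t : UnitAddCircle, ‖(AddCircle.toCircle t : ℂ) * x‖ = ‖x‖ := fun t => norm_toCircle_mul t x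
  simp_rw [hpt _ (hn _)]
  rw [integral_const_mul, hre, mul_one]

end CircleMean

/-- The domain `{|z₁| ^ m < |z₂| ^ n, |z₂| < 1}`, i.e. `genHartogs (m / n)` without real powers. -/
def ratHartogs (m n : ℕ) : Set (ℂ × ℂ) :=
  {z | ‖z.1‖ ^ m < ‖z.2‖ ^ n ∧ ‖z.2‖ < 1}

theorem genHartogs_eq_ratHartogs {m n : ℕ} (hn : 0 < n) :
    genHartogs ((m : ℝ) / n) = ratHartogs m n := by
  ext z
  have h : (‖z.1‖ ^ ((m : ℝ) / n)) ^ n = ‖z.1‖ ^ m := by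
    rw [← Real.rpow_natCast (‖z.1‖ ^ ((m : ℝ) / n)), ← Real.rpow_mul (norm_nonneg _),
      div_mul_cancel₀ _ (by positivity), Real.rpow_natCast]
  change (_ ∧ _) ↔ (_ ∧ _)
  rw [← h, pow_lt_pow_iff_left₀ (by positivity) (norm_nonneg _) hn.ne']

/-! ### Elementary properties of the domain. -/

section Basic

variable {m n : ℕ}

theorem isOpen_ratHartogs : IsOpen (ratHartogs m n) := by
  have h1 : IsOpen {z : ℂ × ℂ | ‖z.1‖ ^ m < ‖z.2‖ ^ n} := isOpen_lt (by fun_prop) (by fun_prop)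
  have h2 : IsOpen {z : ℂ × ℂ | ‖z.2‖ < 1} := isOpen_lt (by fun_prop) (by fun_prop)
  exact h1.inter h2

theorem measurableSet_ratHartogs : MeasurableSet (ratHartogs m n) :=
  isOpen_ratHartogs.measurableSet

theorem snd_ne_zero_of_mem_ratHartogs (hn : 0 < n) {z : ℂ × ℂ} (hz : z ∈ ratHartogs m n) :
    z.2 ≠ 0 := fun h => by
  have h1 := hz.1
  rw [h, norm_zero, zero_pow hn.ne'] at h1
  exact absurd h1 (not_lt.2 (by positivity))

theorem norm_fst_lt_one_of_mem_ratHartogs {z : ℂ × ℂ} (hz : z ∈ ratHartogs m n) :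
    ‖z.1‖ < 1 := by
  by_contra h
  have h1 := one_le_pow₀ (not_lt.1 h) (n := m)
  have h2 := pow_le_one₀ (norm_nonneg _) hz.2.le (n := n)
  linarith [hz.1]

theorem torusRot_mem_ratHartogs {t : UnitAddCircle × UnitAddCircle} {z : ℂ × ℂ} :
    torusRot t z ∈ ratHartogs m n ↔ z ∈ ratHartogs m n := by
  change (_ ∧ _) ↔ (_ ∧ _)
  simp only [torusRot_fst, torusRot_snd, norm_toCircle_mul]

theorem measurePreserving_torusRot_restrict (t : UnitAddCircle × UnitAddCircle) :
    MeasurePreserving (torusRot t) (volume.restrict (ratHartogs m n))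
      (volume.restrict (ratHartogs m n)) := by
  have h := (measurePreserving_torusRot t).restrict_preimage
    (measurableSet_ratHartogs (m := m) (n := n))
  have h2 : torusRot t ⁻¹' ratHartogs m n = ratHartogs m n := by
    ext z
    exact torusRot_mem_ratHartogs
  rwa [h2] at h

instance isFiniteMeasure_restrict_ratHartogs :
    IsFiniteMeasure ((volume : Measure (ℂ × ℂ)).restrict (ratHartogs m n)) := by
  refine ⟨?_⟩
  rw [Measure.restrict_apply_univ]
  refine (measure_mono (t := Metric.ball 0 1) fun z hz => ?_).trans_lt measure_ball_lt_top
  rw [mem_ball_zero_iff, Prod.norm_def]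
  exact max_lt (norm_fst_lt_one_of_mem_ratHartogs hz) hz.2

theorem ae_fst_ne_zero : ∀ᵐ z : ℂ × ℂ, z.1 ≠ 0 := by
  rw [ae_iff]
  have : {z : ℂ × ℂ | ¬z.1 ≠ 0} = {0} ×ˢ Set.univ := by
    ext z; simp
  rw [this, Measure.volume_eq_prod, Measure.prod_prod]
  simp

theorem ae_restrict_ratHartogs :
    ∀ᵐ z : ℂ × ℂ ∂volume.restrict (ratHartogs m n), z ∈ ratHartogs m n ∧ z.1 ≠ 0 := by
  filter_upwards [ae_restrict_mem measurableSet_ratHartogs, ae_restrict_of_ae ae_fst_ne_zero]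
    with z h1 h2 using ⟨h1, h2⟩

end Basic

/-! ### Laurent monomials under rotation and inversion. -/

section Monomial

theorem norm_laurentMonomial (α : ℤ × ℤ) (z : ℂ × ℂ) :
    ‖laurentMonomial α z‖ = ‖z.1‖ ^ α.1 * ‖z.2‖ ^ α.2 := by
  rw [laurentMonomial, norm_mul, norm_zpow, norm_zpow]

theorem laurentMonomial_neg (α : ℤ × ℤ) (z : ℂ × ℂ) :
    laurentMonomial (-α) z = (laurentMonomial α z)⁻¹ := by
  simp [laurentMonomial, mul_comm]

theorem laurentMonomial_ne_zero {α : ℤ × ℤ} {z : ℂ × ℂ} (h1 : z.1 ≠ 0) (h2 : z.2 ≠ 0) :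
    laurentMonomial α z ≠ 0 :=
  mul_ne_zero (zpow_ne_zero _ h1) (zpow_ne_zero _ h2)

theorem measurable_laurentMonomial (α : ℤ × ℤ) : Measurable (laurentMonomial α) := by
  unfold laurentMonomial
  fun_prop

theorem norm_laurentMonomial_torusRot (α : ℤ × ℤ) (t : UnitAddCircle × UnitAddCircle) (z : ℂ × ℂ) :
    ‖laurentMonomial α (torusRot t z)‖ = ‖laurentMonomial α z‖ := by
  simp only [norm_laurentMonomial, torusRot_fst, torusRot_snd, norm_toCircle_mul]

theorem laurentMonomial_torusRot (α : ℤ × ℤ) (t : UnitAddCircle × UnitAddCircle) (z : ℂ × ℂ) :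
    laurentMonomial α (torusRot t z)
      = laurentMonomial α (AddCircle.toCircle t.1, AddCircle.toCircle t.2)
        * laurentMonomial α z := by
  simp only [laurentMonomial, torusRot_fst, torusRot_snd, mul_zpow]
  ring

theorem differentiableAt_laurentMonomial {α : ℤ × ℤ} {z : ℂ × ℂ} (h1 : z.1 ≠ 0 ∨ 0 ≤ α.1)
    (h2 : z.2 ≠ 0) : DifferentiableAt ℂ (laurentMonomial α) z := by
  have e1 : DifferentiableAt ℂ (fun z : ℂ × ℂ => z.1 ^ α.1) z :=
    DifferentiableAt.zpow differentiableAt_fst h1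
  have e2 : DifferentiableAt ℂ (fun z : ℂ × ℂ => z.2 ^ α.2) z :=
    DifferentiableAt.zpow differentiableAt_snd (Or.inl h2)
  exact e1.mul e2

end Monomial

/-! ### Laurent coefficients as torus means, and their relation to Fourier coefficients. -/

section Coefficients

variable {m n : ℕ}

/-- The mean of `g` over the torus orbit of `z`. -/
def torusMean (g : ℂ × ℂ → ℂ) (z : ℂ × ℂ) : ℂ := ∫ t, g (torusRot t z)

theorem integrable_torusRot {g : ℂ × ℂ → ℂ} {z : ℂ × ℂ}
    (hg : ∀ t, ContinuousAt g (torusRot t z)) :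
    Integrable (fun t => g (torusRot t z)) (volume : Measure (UnitAddCircle × UnitAddCircle)) := by
  have hc : Continuous fun t => g (torusRot t z) := continuous_iff_continuousAt.2 fun t =>
    (hg t).comp (f := fun t => torusRot t z) (continuous_torusRot_left z).continuousAt
  exact hc.integrable_of_hasCompactSupport (HasCompactSupport.of_compactSpace _)

theorem torusMean_eq_integral_integral {g : ℂ × ℂ → ℂ} {z : ℂ × ℂ}
    (hg : ∀ t, ContinuousAt g (torusRot t z)) :
    torusMean g z = ∫ t₂ : UnitAddCircle, ∫ t₁ : UnitAddCircle,
      g (AddCircle.toCircle t₁ * z.1, AddCircle.toCircle t₂ * z.2) := by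
  rw [torusMean, Measure.volume_eq_prod, integral_prod_symm]
  · rfl
  · rw [← Measure.volume_eq_prod]
    exact integrable_torusRot hg

theorem torusMean_eq_integral_integral' {g : ℂ × ℂ → ℂ} {z : ℂ × ℂ}
    (hg : ∀ t, ContinuousAt g (torusRot t z)) :
    torusMean g z = ∫ t₁ : UnitAddCircle, ∫ t₂ : UnitAddCircle,
      g (AddCircle.toCircle t₁ * z.1, AddCircle.toCircle t₂ * z.2) := by
  rw [torusMean, Measure.volume_eq_prod, integral_prod]
  · rfl
  · rw [← Measure.volume_eq_prod]
    exact integrable_torusRot hg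

theorem torusRot_mem_punctured {z : ℂ × ℂ} (hz : z ∈ ratHartogs m n ∧ z.1 ≠ 0)
    (t : UnitAddCircle × UnitAddCircle) :
    torusRot t z ∈ ratHartogs m n ∧ (torusRot t z).1 ≠ 0 := by
  refine ⟨torusRot_mem_ratHartogs.2 hz.1, ?_⟩
  rw [← norm_ne_zero_iff, torusRot_fst, norm_toCircle_mul, norm_ne_zero_iff]
  exact hz.2

variable {g : ℂ × ℂ → ℂ} (hg : ∀ z, z ∈ ratHartogs m n ∧ z.1 ≠ 0 → DifferentiableAt ℂ g z)

include hg

/-- With the second coordinate fixed, shrinking the first stays in the domain, so a one-variable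
annulus is available. Membership of the outer point is enough. -/
theorem torusMean_eq_of_fst {a a' b : ℂ} (ha : a ≠ 0) (haa : ‖a‖ ≤ ‖a'‖)
    (hab : (a', b) ∈ ratHartogs m n) : torusMean g (a', b) = torusMean g (a, b) := by
  have ha' : a' ≠ 0 := norm_pos_iff.1 ((norm_pos_iff.2 ha).trans_le haa)
  have hH : ∀ ζ c : ℂ, ‖ζ‖ ≤ ‖a'‖ → ‖c‖ = ‖b‖ → (ζ, c) ∈ ratHartogs m n := fun ζ c h1 h2 => by
    refine ⟨?_, by simpa [h2] using hab.2⟩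
    have := hab.1
    simp only [h2] at this ⊢
    exact (pow_le_pow_left₀ (norm_nonneg _) h1 m).trans_lt this
  rw [torusMean_eq_integral_integral fun t =>
      (hg _ (torusRot_mem_punctured ⟨hab, ha'⟩ t)).continuousAt,
    torusMean_eq_integral_integral fun t =>
      (hg _ (torusRot_mem_punctured ⟨hH a b haa rfl, ha⟩ t)).continuousAt]
  refine integral_congr_ae (Filter.Eventually.of_forall fun t₂ => ?_)
  refine integral_toCircle_mul_eq_of_annulus
    (g := fun ζ => g (ζ, AddCircle.toCircle t₂ * b)) ha haa fun ζ h1 h2 => ?_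
  have hd := hg (ζ, AddCircle.toCircle t₂ * b) ⟨hH _ _ h2 (norm_toCircle_mul _ _),
    norm_pos_iff.1 ((norm_pos_iff.2 ha).trans_le h1)⟩
  exact DifferentiableAt.comp (f := fun ζ : ℂ => (ζ, (AddCircle.toCircle t₂ * b : ℂ))) ζ hd
    (differentiableAt_id.prodMk (differentiableAt_const _))

/-- Here both ends are needed: the inner radius guarantees `|z₁|^m < |z₂|^n`, the outer one `|z₂| <
1`. -/
theorem torusMean_eq_of_snd (hn : 0 < n) {a b b' : ℂ} (ha : a ≠ 0) (hbb : ‖b‖ ≤ ‖b'‖)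
    (hab : (a, b) ∈ ratHartogs m n) (hab' : (a, b') ∈ ratHartogs m n) :
    torusMean g (a, b') = torusMean g (a, b) := by
  have hb : b ≠ 0 := snd_ne_zero_of_mem_ratHartogs hn hab
  have hH : ∀ ζ c : ℂ, ‖ζ‖ = ‖a‖ → ‖b‖ ≤ ‖c‖ → ‖c‖ ≤ ‖b'‖ → (ζ, c) ∈ ratHartogs m n :=
    fun ζ c h1 h2 h3 => by
    refine ⟨?_, h3.trans_lt hab'.2⟩
    have := hab.1
    simp only [h1] at this ⊢
    exact this.trans_le (pow_le_pow_left₀ (norm_nonneg _) h2 n)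
  rw [torusMean_eq_integral_integral' fun t =>
      (hg _ (torusRot_mem_punctured ⟨hab', ha⟩ t)).continuousAt,
    torusMean_eq_integral_integral' fun t =>
      (hg _ (torusRot_mem_punctured ⟨hab, ha⟩ t)).continuousAt]
  refine integral_congr_ae (Filter.Eventually.of_forall fun t₁ => ?_)
  refine integral_toCircle_mul_eq_of_annulus
    (g := fun ζ => g (AddCircle.toCircle t₁ * a, ζ)) hb hbb fun ζ h1 h2 => ?_
  have hd := hg (AddCircle.toCircle t₁ * a, ζ) ⟨hH _ _ (norm_toCircle_mul _ _) h1 h2,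
    norm_ne_zero_iff.1 (by rw [norm_toCircle_mul]; exact norm_ne_zero_iff.2 ha)⟩
  exact DifferentiableAt.comp (f := fun ζ : ℂ => ((AddCircle.toCircle t₁ * a : ℂ), ζ)) ζ hd
    ((differentiableAt_const _).prodMk differentiableAt_id)

/-- The torus means of a function holomorphic off `{z₁ = 0}` are all equal. -/
theorem torusMean_eq_torusMean (hn : 0 < n) {z z' : ℂ × ℂ} (hz : z ∈ ratHartogs m n ∧ z.1 ≠ 0)
    (hz' : z' ∈ ratHartogs m n ∧ z'.1 ≠ 0) : torusMean g z = torusMean g z' := by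
  wlog h : ‖z.1‖ ≤ ‖z'.1‖ generalizing z z'
  · exact (this hz' hz (not_le.1 h).le).symm
  obtain ⟨a, b⟩ := z
  obtain ⟨a', b'⟩ := z'
  -- The two points are joined through `(a, b')`, which lies in the domain because `|a| ≤ |a'|`.
  have hab' : (a, b') ∈ ratHartogs m n :=
    ⟨(pow_le_pow_left₀ (norm_nonneg _) h m).trans_lt hz'.1.1, hz'.1.2⟩
  rw [torusMean_eq_of_fst hg hz.2 h hz'.1]
  rcases le_total ‖b‖ ‖b'‖ with hb | hb
  · exact (torusMean_eq_of_snd hg hn hz.2 hb hz.1 hab').symm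
  · exact torusMean_eq_of_snd hg hn hz.2 hb hab' hz.1

omit hg

/-- Each slice in `z₁` is a full disc, so the inner circle mean is the value at `z₁ = 0`. -/
theorem torusMean_eq_zero {g : ℂ × ℂ → ℂ} (hg : ∀ z ∈ ratHartogs m n, DifferentiableAt ℂ g z)
    (h0 : ∀ b, g (0, b) = 0) {z : ℂ × ℂ} (hz : z ∈ ratHartogs m n) : torusMean g z = 0 := by
  rw [torusMean_eq_integral_integral fun t => (hg _ (torusRot_mem_ratHartogs.2 hz)).continuousAt]
  rw [← integral_zero UnitAddCircle ℂ]
  refine integral_congr_ae (Filter.Eventually.of_forall fun t₂ => ?_)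
  refine (integral_toCircle_mul_eq_of_disc
    (g := fun ζ => g (ζ, AddCircle.toCircle t₂ * z.2)) fun ζ h1 => ?_).trans (h0 _)
  have hd := hg (ζ, AddCircle.toCircle t₂ * z.2) ⟨by
    simp only [norm_toCircle_mul]
    exact (pow_le_pow_left₀ (norm_nonneg _) h1 m).trans_lt hz.1, by
    simpa only [norm_toCircle_mul] using hz.2⟩
  exact DifferentiableAt.comp (f := fun ζ : ℂ => (ζ, (AddCircle.toCircle t₂ * z.2 : ℂ))) ζ hd
    (differentiableAt_id.prodMk (differentiableAt_const _))

/-- A point of `ratHartogs m n` off `{z₁ = 0}`. -/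
def ratHartogsBase (n : ℕ) : ℂ × ℂ := ((1 / 2 : ℂ) ^ (n + 1), 1 / 2)

theorem ratHartogsBase_mem (hm : 0 < m) :
    ratHartogsBase n ∈ ratHartogs m n ∧ (ratHartogsBase n).1 ≠ 0 := by
  refine ⟨⟨?_, by norm_num [ratHartogsBase]⟩, by simp [ratHartogsBase]⟩
  have h1 : ‖(ratHartogsBase n).1‖ = (1 / 2 : ℝ) ^ (n + 1) := by simp [ratHartogsBase]
  have h2 : ‖(ratHartogsBase n).2‖ = 1 / 2 := by simp [ratHartogsBase]
  rw [h1, h2]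
  calc ((1 / 2 : ℝ) ^ (n + 1)) ^ m ≤ ((1 / 2 : ℝ) ^ (n + 1)) ^ 1 :=
        pow_le_pow_of_le_one (by positivity) (pow_le_one₀ (by norm_num) (by norm_num)) hm
    _ < (1 / 2 : ℝ) ^ n := by
        rw [pow_one]
        exact pow_lt_pow_right_of_lt_one₀ (by norm_num) (by norm_num) (Nat.lt_succ_self n)

/-- The Laurent coefficients of a function holomorphic on `ratHartogs m n`. -/
def laurentCoeff (n : ℕ) (F : ℂ × ℂ → ℂ) (α : ℤ × ℤ) : ℂ :=
  torusMean (fun z => F z * laurentMonomial (-α) z) (ratHartogsBase n)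

variable {F : ℂ × ℂ → ℂ}

theorem differentiableAt_mul_laurentMonomial (hn : 0 < n)
    (hF : DifferentiableOn ℂ F (ratHartogs m n)) (α : ℤ × ℤ) (z : ℂ × ℂ)
    (hz : z ∈ ratHartogs m n ∧ z.1 ≠ 0) :
    DifferentiableAt ℂ (fun z => F z * laurentMonomial α z) z :=
  (hF.differentiableAt (isOpen_ratHartogs.mem_nhds hz.1)).mul
    (differentiableAt_laurentMonomial (Or.inl hz.2) (snd_ne_zero_of_mem_ratHartogs hn hz.1))

theorem torusMean_eq_laurentCoeff (hm : 0 < m) (hn : 0 < n)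
    (hF : DifferentiableOn ℂ F (ratHartogs m n)) (α : ℤ × ℤ) {z : ℂ × ℂ}
    (hz : z ∈ ratHartogs m n ∧ z.1 ≠ 0) :
    torusMean (fun z => F z * laurentMonomial (-α) z) z = laurentCoeff n F α :=
  torusMean_eq_torusMean (differentiableAt_mul_laurentMonomial hn hF _) hn hz
    (ratHartogsBase_mem hm)

/-- When `α₁ < 0` the product `F e_{-α}` is holomorphic across `z₁ = 0` and vanishes there. -/
theorem laurentCoeff_eq_zero (hm : 0 < m) (hn : 0 < n)
    (hF : DifferentiableOn ℂ F (ratHartogs m n)) {α : ℤ × ℤ} (hα : α.1 < 0) :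
    laurentCoeff n F α = 0 := by
  refine torusMean_eq_zero (m := m) (fun z hz => ?_) (fun b => ?_) (ratHartogsBase_mem hm).1
  · exact (hF.differentiableAt (isOpen_ratHartogs.mem_nhds hz)).mul
      (differentiableAt_laurentMonomial (Or.inr (by simpa using hα.le))
        (snd_ne_zero_of_mem_ratHartogs hn hz))
  · have : (0 : ℂ) ^ (-α.1) = 0 := zero_zpow _ (by omega)
    simp only [laurentMonomial, Prod.fst_neg, this, zero_mul, mul_zero]

/-- Integration of a holomorphic function against a monomial and a torus-invariant weight. -/
theorem integral_mul_weight (hm : 0 < m) (hn : 0 < n)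
    (hF : DifferentiableOn ℂ F (ratHartogs m n)) (α : ℤ × ℤ) {ω : ℂ × ℂ → ℂ}
    (hω : ∀ t z, ω (torusRot t z) = ω z)
    (hint : IntegrableOn (fun z => F z * laurentMonomial (-α) z * ω z) (ratHartogs m n)) :
    ∫ z in ratHartogs m n, F z * laurentMonomial (-α) z * ω z
      = laurentCoeff n F α * ∫ z in ratHartogs m n, ω z := by
  rw [integral_eq_integral_torus measurePreserving_torusRot_restrict hint, ← integral_const_mul]
  refine integral_congr_ae ?_
  filter_upwards [ae_restrict_ratHartogs] with z hz
  simp only [hω]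
  rw [integral_mul_const]
  congr 1
  exact torusMean_eq_laurentCoeff hm hn hF α hz

/-- Two measure structures on the circle have to be reconciled: normalised Haar measure and the
length measure of period `1`. They coincide because the period is one. -/
theorem mFourierCoeff_eq_integral_volume {d : Type*} [Fintype d] (f : UnitAddTorus d → ℂ)
    (k : d → ℤ) : UnitAddTorus.mFourierCoeff f k
      = ∫ t : d → UnitAddCircle, UnitAddTorus.mFourier (-k) t * f t := by
  have h : instMeasureSpaceUnitAddCircle = AddCircle.measureSpace 1 := by
    have h1 := AddCircle.volume_eq_smul_haarAddCircle (T := 1)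
    rw [ENNReal.ofReal_one, one_smul] at h1
    have h2 : instMeasureSpaceUnitAddCircle = ⟨AddCircle.haarAddCircle⟩ := rfl
    rw [h2, ← h1]
    rfl
  unfold UnitAddTorus.mFourierCoeff
  rw [h]
  rfl

/-- A rotation multiplies `e_α(z)` by a character of the torus. Hence the Fourier series of `F`
along the orbit of `z` is, term by term, its Laurent series at `z`. -/
theorem mFourierCoeff_torusRot (hm : 0 < m) (hn : 0 < n)
    (hF : DifferentiableOn ℂ F (ratHartogs m n)) {z : ℂ × ℂ}
    (hz : z ∈ ratHartogs m n ∧ z.1 ≠ 0) (k : Fin 2 → ℤ) :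
    UnitAddTorus.mFourierCoeff (fun t : UnitAddTorus (Fin 2) => F (torusRot (t 0, t 1) z)) k
      = laurentCoeff n F (k 0, k 1) * laurentMonomial (k 0, k 1) z := by
  have hne : laurentMonomial (k 0, k 1) z ≠ 0 :=
    laurentMonomial_ne_zero hz.2 (snd_ne_zero_of_mem_ratHartogs hn hz.1)
  have hcomp := (volume_preserving_finTwoArrow UnitAddCircle).integral_comp
    MeasurableEquiv.finTwoArrow.measurableEmbedding (fun t => F (torusRot t z)
      * laurentMonomial (-(k 0, k 1)) (torusRot t z) * laurentMonomial (k 0, k 1) z)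
  rw [← torusMean_eq_laurentCoeff hm hn hF _ hz, torusMean, ← integral_mul_const,
    mFourierCoeff_eq_integral_volume, ← hcomp]
  refine integral_congr_ae (Filter.Eventually.of_forall fun t => ?_)
  have hfin : MeasurableEquiv.finTwoArrow t = (t 0, t 1) := rfl
  simp only [hfin]
  rw [laurentMonomial_torusRot, laurentMonomial_neg _ z, mul_assoc, mul_assoc,
    inv_mul_cancel₀ hne, mul_one, mul_comm]
  congr 1
  simp [UnitAddTorus.mFourier, laurentMonomial, Fin.prod_univ_two, fourier_apply,
    AddCircle.toCircle_zsmul, AddCircle.toCircle_neg]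
  ring

theorem continuous_comp_torusRot (hF : DifferentiableOn ℂ F (ratHartogs m n)) {z : ℂ × ℂ}
    (hz : z ∈ ratHartogs m n) :
    Continuous fun t : UnitAddTorus (Fin 2) => F (torusRot (t 0, t 1) z) := by
  refine continuous_iff_continuousAt.2 fun t => ?_
  have h1 : ContinuousAt F (torusRot (t 0, t 1) z) := (hF.differentiableAt
    (isOpen_ratHartogs.mem_nhds (torusRot_mem_ratHartogs.2 hz))).continuousAt
  refine h1.comp (f := fun t : UnitAddTorus (Fin 2) => torusRot (t 0, t 1) z) ?_
  exact ((continuous_torusRot_left z).comp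
    ((continuous_apply 0).prodMk (continuous_apply 1))).continuousAt

/-- An absolutely summable Fourier series of a continuous function converges to it pointwise;
evaluate at the identity of the torus. -/
theorem hasSum_laurent_of_summable (hm : 0 < m) (hn : 0 < n)
    (hF : DifferentiableOn ℂ F (ratHartogs m n)) {z : ℂ × ℂ}
    (hz : z ∈ ratHartogs m n ∧ z.1 ≠ 0)
    (hs : Summable fun α => laurentCoeff n F α * laurentMonomial α z) :
    HasSum (fun α => laurentCoeff n F α * laurentMonomial α z) (F z) := by
  have hco := fun k => mFourierCoeff_torusRot hm hn hF hz k
  have h := UnitAddTorus.hasSum_mFourier_series_apply_of_summable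
    (f := ⟨_, continuous_comp_torusRot hF hz.1⟩) (by
      simp only [ContinuousMap.coe_mk]
      rw [funext hco]
      exact (finTwoArrowEquiv ℤ).summable_iff.2 hs) 0
  simp only [ContinuousMap.coe_mk, hco] at h
  have h0 : torusRot ((0 : UnitAddTorus (Fin 2)) 0, (0 : UnitAddTorus (Fin 2)) 1) z = z :=
    torusRot_zero z
  rw [h0] at h
  rw [← (finTwoArrowEquiv ℤ).hasSum_iff]
  convert h using 2 with k
  simp [UnitAddTorus.mFourier, finTwoArrowEquiv]

end Coefficients

/-! ### Locally normally convergent series of holomorphic functions. -/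

section NormalConvergence

variable {ι E : Type*} [NormedAddCommGroup E] [NormedSpace ℂ E]

/-- A locally normally convergent series of holomorphic functions has a holomorphic sum. -/
theorem differentiableOn_tsum_of_locally_dominated {f : ι → E → ℂ} {Ω : Set E} (hΩ : IsOpen Ω)
    (hf : ∀ i, DifferentiableOn ℂ (f i) Ω)
    (hb : ∀ x ∈ Ω, ∃ U ∈ 𝓝 x, ∃ u : ι → ℝ, Summable u ∧ ∀ i, ∀ y ∈ U, ‖f i y‖ ≤ u i) :
    DifferentiableOn ℂ (fun x => ∑' i, f i x) Ω := by
  intro x hx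
  obtain ⟨U, hU, u, hu, hfu⟩ := hb x hx
  obtain ⟨δ, hδ, hball⟩ := Metric.mem_nhds_iff.1 (Filter.inter_mem hU (hΩ.mem_nhds hx))
  have hsub : ∀ y ∈ Metric.ball x (δ / 2), Metric.ball y (δ / 2) ⊆ Metric.ball x δ := by
    intro y hy
    refine Metric.ball_subset_ball' ?_
    rw [Metric.mem_ball] at hy
    linarith
  have hxm : x ∈ Metric.ball x (δ / 2) := Metric.mem_ball_self (by positivity)
  -- The derivatives are dominated by a Cauchy estimate: on a ball of radius `δ/2` about `y`, `f i`
  -- stays within `2 u i` of `f i y`.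
  have h := hasFDerivAt_tsum_of_isPreconnected (𝕜 := ℂ) (u := fun i => 2 * u i / (δ / 2))
    (f := f) (f' := fun i y => fderiv ℂ (f i) y) (s := Metric.ball x (δ / 2)) (x₀ := x) (x := x)
    ((hu.mul_left 2).div_const _) Metric.isOpen_ball
    (convex_ball x (δ / 2) |>.isPreconnected) ?_ ?_ hxm ?_ hxm
  · exact h.differentiableAt.differentiableWithinAt
  · intro i y hy
    have hyΩ : y ∈ Ω := (hball (hsub y hy (Metric.mem_ball_self (by positivity)))).2
    exact ((hf i).differentiableAt (hΩ.mem_nhds hyΩ)).hasFDerivAt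
  · intro i y hy
    refine Complex.norm_fderiv_le_div_of_mapsTo_ball (R₁ := δ / 2) (R₂ := 2 * u i)
      ((hf i).mono fun w hw => (hball (hsub y hy hw)).2) (fun w hw => ?_) (by positivity)
    have h1 := hfu i w (hball (hsub y hy hw)).1
    have h2 := hfu i y (hball (hsub y hy (Metric.mem_ball_self (by positivity)))).1
    rw [Metric.mem_closedBall, dist_eq_norm]
    linarith [norm_sub_le (f i w) (f i y)]
  · exact Summable.of_norm_bounded hu fun i => hfu i x (mem_of_mem_nhds hU)

theorem hasSumLocallyUniformlyOn_of_locally_dominated {X : Type*} [TopologicalSpace X]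
    {f : ι → X → ℂ} {Ω : Set X}
    (hb : ∀ x ∈ Ω, ∃ U ∈ 𝓝 x, ∃ u : ι → ℝ, Summable u ∧ ∀ i, ∀ y ∈ U, ‖f i y‖ ≤ u i) :
    HasSumLocallyUniformlyOn f (fun x => ∑' i, f i x) Ω := by
  refine tendstoLocallyUniformlyOn_of_forall_exists_nhds fun x hx => ?_
  obtain ⟨U, hU, u, hu, hfu⟩ := hb x hx
  exact ⟨U, mem_nhdsWithin_of_mem_nhds hU, tendstoUniformlyOn_tsum hu hfu⟩

end NormalConvergence

/-! ### Locally uniform geometric decay of Laurent terms. -/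

section LaurentBounds

variable {m n : ℕ}

/-- The quotient `e_α(z)/e_α(w)` decays geometrically when each coordinate of `w` beats that of `z`
by the factor `θ` in the direction given by the sign of the exponent. The sign of `α₂` is not fixed,
hence the alternative in the last hypothesis. -/
theorem norm_laurentMonomial_mul_le {θ : ℝ} {α : ℤ × ℤ} {z w : ℂ × ℂ}
    (hα : 0 ≤ α.1) (hz2 : z.2 ≠ 0) (hw1 : w.1 ≠ 0) (hw2 : w.2 ≠ 0) (h1 : ‖z.1‖ ≤ θ * ‖w.1‖)
    (h2 : 0 ≤ α.2 ∧ ‖z.2‖ ≤ θ * ‖w.2‖ ∨ α.2 ≤ 0 ∧ ‖w.2‖ ≤ θ * ‖z.2‖) :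
    ‖laurentMonomial (-α) w‖ * ‖laurentMonomial α z‖ ≤ θ ^ (α.1.natAbs + α.2.natAbs) := by
  have hw1' : 0 < ‖w.1‖ := norm_pos_iff.2 hw1
  have hw2' : 0 < ‖w.2‖ := norm_pos_iff.2 hw2
  have hz2' : 0 < ‖z.2‖ := norm_pos_iff.2 hz2
  have hθ : 0 ≤ θ := by
    by_contra h
    have : θ * ‖w.1‖ < 0 := mul_neg_of_neg_of_pos (not_le.1 h) hw1'
    linarith [norm_nonneg z.1]
  rw [laurentMonomial_neg, norm_inv, norm_laurentMonomial, norm_laurentMonomial]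
  obtain ⟨a, ha⟩ := Int.eq_ofNat_of_zero_le hα
  have e1 : ‖z.1‖ ^ α.1 ≤ θ ^ α.1.natAbs * ‖w.1‖ ^ α.1 := by
    rw [ha, Int.natAbs_natCast, zpow_natCast, zpow_natCast, ← mul_pow]
    exact pow_le_pow_left₀ (norm_nonneg _) h1 _
  have e2 : ‖z.2‖ ^ α.2 ≤ θ ^ α.2.natAbs * ‖w.2‖ ^ α.2 := by
    rcases h2 with ⟨h, h'⟩ | ⟨h, h'⟩
    · obtain ⟨b, hb⟩ := Int.eq_ofNat_of_zero_le h
      rw [hb, Int.natAbs_natCast, zpow_natCast, zpow_natCast, ← mul_pow]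
      exact pow_le_pow_left₀ (norm_nonneg _) h' _
    · obtain ⟨b, hb⟩ := Int.exists_eq_neg_ofNat h
      rw [hb, Int.natAbs_neg, Int.natAbs_natCast, zpow_neg, zpow_neg, zpow_natCast, zpow_natCast]
      rw [← div_eq_mul_inv, le_div_iff₀ (by positivity), inv_mul_le_iff₀ (by positivity),
        mul_comm, ← mul_pow]
      exact pow_le_pow_left₀ hw2'.le h' _
  rw [inv_mul_le_iff₀ (by positivity), pow_add]
  calc ‖z.1‖ ^ α.1 * ‖z.2‖ ^ α.2
      ≤ (θ ^ α.1.natAbs * ‖w.1‖ ^ α.1) * (θ ^ α.2.natAbs * ‖w.2‖ ^ α.2) :=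
        mul_le_mul e1 e2 (by positivity) (by positivity)
    _ = _ := by ring

theorem summable_pow_natAbs_add_natAbs {θ : ℝ} (h0 : 0 ≤ θ) (h1 : θ < 1) :
    Summable fun α : ℤ × ℤ => θ ^ (α.1.natAbs + α.2.natAbs) := by
  have h : Summable fun k : ℤ => θ ^ k.natAbs := by
    refine Summable.of_nat_of_neg ?_ ?_
    · simpa using summable_geometric_of_lt_one h0 h1
    · simpa using summable_geometric_of_lt_one h0 h1
  simp_rw [pow_add]
  exact h.mul_of_nonneg h (fun _ => by positivity) (fun _ => by positivity)

/-- Averaging the coefficient formula over the open invariant set `R`, instead of using one orbit,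
yields `vol(R) c_α = ∫_R F e_{-α}`. The coefficient is thereby controlled by an integral norm of `F`
rather than a supremum. -/
theorem norm_laurentCoeff_mul_le (hm : 0 < m) (hn : 0 < n) {R : Set (ℂ × ℂ)} (hRo : IsOpen R)
    (hRne : R.Nonempty) (hRH : R ⊆ ratHartogs m n)
    (hRt : ∀ t z, torusRot t z ∈ R ↔ z ∈ R)
    {F : ℂ × ℂ → ℂ} (hF : DifferentiableOn ℂ F (ratHartogs m n))
    (hFi : IntegrableOn F (ratHartogs m n)) {α : ℤ × ℤ} {K D : ℝ} (hK : 0 ≤ K) (hD : 0 ≤ D)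
    (h : ∀ w ∈ R, ‖laurentMonomial (-α) w‖ * K ≤ D) :
    ‖laurentCoeff n F α‖ * K
      ≤ (volume.real R)⁻¹ * (∫ z in ratHartogs m n, ‖F z‖) * D := by
  have hI : 0 ≤ ∫ z in ratHartogs m n, ‖F z‖ := integral_nonneg fun _ => norm_nonneg _
  rcases hK.eq_or_lt with h0 | hpos
  · rw [← h0, mul_zero]
    positivity
  have hRfin : volume R ≠ ∞ := by
    refine ((measure_mono hRH).trans_lt ?_).ne
    have := measure_lt_top (volume.restrict (ratHartogs m n)) Set.univ
    rwa [Measure.restrict_apply_univ] at this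
  have hRpos : 0 < volume.real R := ENNReal.toReal_pos (hRo.measure_pos volume hRne).ne' hRfin
  let ω : ℂ × ℂ → ℂ := R.indicator 1
  have hω : ∀ t z, ω (torusRot t z) = ω z := fun t z => by
    by_cases hz : z ∈ R
    · simp only [ω, Set.indicator_of_mem hz, Set.indicator_of_mem ((hRt t z).2 hz), Pi.one_apply]
    · simp only [ω, Set.indicator_of_notMem hz, Set.indicator_of_notMem (mt (hRt t z).1 hz)]
  have hωm : Measurable ω := measurable_one.indicator hRo.measurableSet
  have hle : ∀ z, ‖F z * laurentMonomial (-α) z * ω z‖ ≤ ‖F z‖ * (D / K) := fun z => by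
    by_cases hz : z ∈ R
    · simp only [ω, Set.indicator_of_mem hz, Pi.one_apply, mul_one, norm_mul]
      exact mul_le_mul_of_nonneg_left ((le_div_iff₀ hpos).2 (h z hz)) (norm_nonneg _)
    · simp only [ω, Set.indicator_of_notMem hz, mul_zero, norm_zero]
      positivity
  have hint : IntegrableOn (fun z => F z * laurentMonomial (-α) z * ω z) (ratHartogs m n) := by
    refine Integrable.mono' (hFi.norm.mul_const (D / K))
      ((hFi.1.mul (measurable_laurentMonomial _).aestronglyMeasurable).mul
        hωm.aestronglyMeasurable) (Filter.Eventually.of_forall hle)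
  have hmain := integral_mul_weight hm hn hF α hω hint
  have hωi : ∫ z in ratHartogs m n, ω z = (volume.real R : ℂ) := by
    rw [integral_indicator hRo.measurableSet, Measure.restrict_restrict hRo.measurableSet,
      Set.inter_eq_left.2 hRH]
    simp
  have hb : ‖laurentCoeff n F α‖ * volume.real R ≤ (∫ z in ratHartogs m n, ‖F z‖) * (D / K) := by
    have h1 : ‖laurentCoeff n F α * (volume.real R : ℂ)‖ = ‖laurentCoeff n F α‖ * volume.real R := by
      rw [norm_mul, Complex.norm_real, Real.norm_of_nonneg hRpos.le]
    rw [← h1, ← hωi, ← hmain, ← integral_mul_const]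
    exact norm_integral_le_of_norm_le (hFi.norm.mul_const _) (Filter.Eventually.of_forall hle)
  rw [mul_assoc, le_inv_mul_iff₀ hRpos]
  rw [← mul_div_assoc, le_div_iff₀ hpos] at hb
  linarith

/-- An open torus-invariant box. -/
def torusBox (a b c d : ℝ) : Set (ℂ × ℂ) :=
  {z | (a < ‖z.1‖ ∧ ‖z.1‖ < b) ∧ c < ‖z.2‖ ∧ ‖z.2‖ < d}

theorem isOpen_torusBox (a b c d : ℝ) : IsOpen (torusBox a b c d) := by
  have h1 : IsOpen {z : ℂ × ℂ | a < ‖z.1‖} := isOpen_lt (by fun_prop) (by fun_prop)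
  have h2 : IsOpen {z : ℂ × ℂ | ‖z.1‖ < b} := isOpen_lt (by fun_prop) (by fun_prop)
  have h3 : IsOpen {z : ℂ × ℂ | c < ‖z.2‖} := isOpen_lt (by fun_prop) (by fun_prop)
  have h4 : IsOpen {z : ℂ × ℂ | ‖z.2‖ < d} := isOpen_lt (by fun_prop) (by fun_prop)
  exact (h1.inter h2).inter (h3.inter h4)

theorem torusBox_nonempty {a b c d : ℝ} (ha : 0 ≤ a) (hab : a < b) (hc : 0 ≤ c) (hcd : c < d) :
    (torusBox a b c d).Nonempty := by
  obtain ⟨x, h1, h2⟩ := exists_between hab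
  obtain ⟨y, h3, h4⟩ := exists_between hcd
  refine ⟨((x : ℂ), (y : ℂ)), ?_⟩
  change (_ ∧ _) ∧ _ ∧ _
  simp only [Complex.norm_real, Real.norm_of_nonneg (ha.trans h1.le),
    Real.norm_of_nonneg (hc.trans h3.le)]
  exact ⟨⟨h1, h2⟩, h3, h4⟩

theorem torusRot_mem_torusBox {a b c d : ℝ} (t : UnitAddCircle × UnitAddCircle) (z : ℂ × ℂ) :
    torusRot t z ∈ torusBox a b c d ↔ z ∈ torusBox a b c d := by
  change ((_ ∧ _) ∧ _ ∧ _) ↔ ((_ ∧ _) ∧ _ ∧ _)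
  simp only [torusRot_fst, torusRot_snd, norm_toCircle_mul]

theorem torusBox_subset_ratHartogs {a b c d : ℝ} (hc : 0 ≤ c)
    (hbc : b ^ m ≤ c ^ n) (hd : d ≤ 1) (hn : 0 < n) : torusBox a b c d ⊆ ratHartogs m n :=
  fun _ hz => ⟨(pow_le_pow_left₀ (norm_nonneg _) hz.1.2.le m).trans_lt
    (hbc.trans_lt (pow_lt_pow_left₀ hz.2.1 hc hn.ne')), hz.2.2.trans_le hd⟩

/-- The constants depend on the point only, and `F` enters through its `L¹` norm. This uniformity
later gives continuity of the coefficient functionals and closedness of the Bergman space. -/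
theorem exists_laurent_bound (hm : 0 < m) (hn : 0 < n) {z₀ : ℂ × ℂ} (hz₀ : z₀ ∈ ratHartogs m n) :
    ∃ U ∈ 𝓝 z₀, ∃ C θ : ℝ, 0 ≤ C ∧ 0 ≤ θ ∧ θ < 1 ∧
      ∀ F : ℂ × ℂ → ℂ, DifferentiableOn ℂ F (ratHartogs m n) → IntegrableOn F (ratHartogs m n) →
        ∀ α, ∀ z ∈ U, ‖laurentCoeff n F α * laurentMonomial α z‖
          ≤ C * (∫ z in ratHartogs m n, ‖F z‖) * θ ^ (α.1.natAbs + α.2.natAbs) := by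
  have hB := norm_pos_iff.2 (snd_ne_zero_of_mem_ratHartogs hn hz₀)
  obtain ⟨c, hc1, hc2⟩ := exists_between hz₀.1
  obtain ⟨ρ₃, hρ3, hρ3'⟩ : ∃ x, ‖z₀.1‖ < x ∧ x ^ m < c := by
    have hcont : ContinuousAt (fun x : ℝ => x ^ m) ‖z₀.1‖ := by fun_prop
    have h1 := (hcont.eventually_lt continuousAt_const hc1)
    have h2 : ∀ᶠ x in 𝓝[>] ‖z₀.1‖, x ^ m < c := h1.filter_mono nhdsWithin_le_nhds
    obtain ⟨x, hx, hx'⟩ := (h2.and self_mem_nhdsWithin).exists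
    exact ⟨x, hx', hx⟩
  obtain ⟨σ₀, hσ0, hσ0', hσ0''⟩ : ∃ x, x < ‖z₀.2‖ ∧ c < x ^ n ∧ 0 < x := by
    have hcont : ContinuousAt (fun x : ℝ => x ^ n) ‖z₀.2‖ := by fun_prop
    have h1 := (continuousAt_const (y := c)).eventually_lt hcont hc2
    have h2 : ∀ᶠ x in 𝓝[<] ‖z₀.2‖, c < x ^ n := h1.filter_mono nhdsWithin_le_nhds
    have h3 : ∀ᶠ x in 𝓝[<] ‖z₀.2‖, 0 < x :=
      (lt_mem_nhds hB).filter_mono nhdsWithin_le_nhds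
    obtain ⟨x, ⟨hx, hx3⟩, hx'⟩ := ((h2.and h3).and self_mem_nhdsWithin).exists
    exact ⟨x, hx', hx, hx3⟩
  -- The radii satisfy `|z₀.1| < ρ₁ < ρ₂ < ρ₃` and `σ₀ < σ₁ < σ₂ < |z₀.2| < τ₁ < τ₂ < 1`, with `ρ₃^m
  -- < c < σ₀^n`, so boxes with first radius below `ρ₃` and second radius between `σ₀` and `1` stay
  -- in the domain.
  obtain ⟨ρ₁, hρ1, hρ1'⟩ := exists_between hρ3
  obtain ⟨ρ₂, hρ2, hρ2'⟩ := exists_between hρ1'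
  obtain ⟨σ₁, hσ1, hσ1'⟩ := exists_between hσ0
  obtain ⟨σ₂, hσ2, hσ2'⟩ := exists_between hσ1'
  obtain ⟨τ₁, hτ1, hτ1'⟩ := exists_between hz₀.2
  obtain ⟨τ₂, hτ2, hτ2'⟩ := exists_between hτ1'
  have hA : 0 ≤ ‖z₀.1‖ := norm_nonneg _
  have hρ1p : 0 < ρ₁ := hA.trans_lt hρ1
  have hρ2p : 0 < ρ₂ := hρ1p.trans hρ2
  have hσ1p : 0 < σ₁ := hσ0''.trans hσ1
  have hσ2p : 0 < σ₂ := hσ1p.trans hσ2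
  have hτ1p : 0 < τ₁ := hB.trans hτ1
  have hτ2p : 0 < τ₂ := hτ1p.trans hτ2
  set θ := max (ρ₁ / ρ₂) (max (σ₁ / σ₂) (τ₁ / τ₂)) with hθ
  have hθ0 : 0 ≤ θ := le_max_of_le_left (by positivity)
  have hθ1 : θ < 1 := max_lt ((div_lt_one hρ2p).2 hρ2)
    (max_lt ((div_lt_one hσ2p).2 hσ2) ((div_lt_one hτ2p).2 hτ2))
  have hθρ : ρ₁ ≤ θ * ρ₂ := (div_le_iff₀ hρ2p).1 (le_max_left _ _)
  have hθσ : σ₁ ≤ θ * σ₂ :=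
    (div_le_iff₀ hσ2p).1 ((le_max_left _ _).trans (le_max_right _ _))
  have hθτ : τ₁ ≤ θ * τ₂ :=
    (div_le_iff₀ hτ2p).1 ((le_max_right _ _).trans (le_max_right _ _))
  -- `R₁` lies below the neighbourhood in `|z₂|` and serves `α₂ ≤ 0`; `R₂` lies above it and serves
  -- `α₂ ≥ 0`.
  set R₁ := torusBox ρ₂ ρ₃ σ₀ σ₁
  set R₂ := torusBox ρ₂ ρ₃ τ₂ 1
  have hR1 : R₁ ⊆ ratHartogs m n :=
    torusBox_subset_ratHartogs hσ0''.le (hρ3'.trans hσ0').le (by linarith [hz₀.2]) hn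
  have hR2 : R₂ ⊆ ratHartogs m n := by
    refine torusBox_subset_ratHartogs hτ2p.le ((hρ3'.trans hσ0').le.trans ?_) le_rfl hn
    exact pow_le_pow_left₀ hσ0''.le (by linarith) n
  refine ⟨{z | ‖z.1‖ < ρ₁ ∧ σ₂ < ‖z.2‖ ∧ ‖z.2‖ < τ₁}, ?_,
    (volume.real R₁)⁻¹ + (volume.real R₂)⁻¹, θ, by positivity, hθ0, hθ1, ?_⟩
  · have h1 : IsOpen {z : ℂ × ℂ | ‖z.1‖ < ρ₁} := isOpen_lt (by fun_prop) (by fun_prop)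
    have h3 : IsOpen {z : ℂ × ℂ | σ₂ < ‖z.2‖} := isOpen_lt (by fun_prop) (by fun_prop)
    have h4 : IsOpen {z : ℂ × ℂ | ‖z.2‖ < τ₁} := isOpen_lt (by fun_prop) (by fun_prop)
    exact (h1.inter (h3.inter h4)).mem_nhds ⟨hρ1, hσ2', hτ1⟩
  · intro F hF hFi α z hz
    have hI : 0 ≤ ∫ z in ratHartogs m n, ‖F z‖ := integral_nonneg fun _ => norm_nonneg _
    obtain ⟨hz1, hz2, hz3⟩ := hz
    rcases lt_or_ge α.1 0 with hα | hα
    · rw [laurentCoeff_eq_zero hm hn hF hα, zero_mul, norm_zero]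
      positivity
    have hz20 : z.2 ≠ 0 := norm_pos_iff.1 (hσ2p.trans hz2)
    rw [norm_mul]
    have hpow : 0 ≤ θ ^ (α.1.natAbs + α.2.natAbs) := by positivity
    rcases le_total 0 α.2 with h2 | h2
    · refine (norm_laurentCoeff_mul_le hm hn (isOpen_torusBox _ _ _ _)
        (torusBox_nonempty hρ2p.le hρ2' hτ2p.le hτ2') hR2 torusRot_mem_torusBox hF hFi
        (norm_nonneg _) hpow fun w hw => ?_).trans ?_
      · have hw1 : 0 < ‖w.1‖ := hρ2p.trans hw.1.1
        have hw2 : 0 < ‖w.2‖ := hτ2p.trans hw.2.1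
        refine norm_laurentMonomial_mul_le hα hz20 (norm_pos_iff.1 hw1) (norm_pos_iff.1 hw2)
          ?_ (Or.inl ⟨h2, ?_⟩)
        · exact hz1.le.trans (hθρ.trans (mul_le_mul_of_nonneg_left hw.1.1.le hθ0))
        · exact hz3.le.trans (hθτ.trans (mul_le_mul_of_nonneg_left hw.2.1.le hθ0))
      · gcongr
        exact le_add_of_nonneg_left (by positivity)
    · refine (norm_laurentCoeff_mul_le hm hn (isOpen_torusBox _ _ _ _)
        (torusBox_nonempty hρ2p.le hρ2' hσ0''.le hσ1) hR1 torusRot_mem_torusBox hF hFi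
        (norm_nonneg _) hpow fun w hw => ?_).trans ?_
      · have hw1 : 0 < ‖w.1‖ := hρ2p.trans hw.1.1
        have hw2 : 0 < ‖w.2‖ := hσ0''.trans hw.2.1
        refine norm_laurentMonomial_mul_le hα hz20 (norm_pos_iff.1 hw1) (norm_pos_iff.1 hw2)
          ?_ (Or.inr ⟨h2, ?_⟩)
        · exact hz1.le.trans (hθρ.trans (mul_le_mul_of_nonneg_left hw.1.1.le hθ0))
        · exact hw.2.2.le.trans (hθσ.trans (mul_le_mul_of_nonneg_left hz2.le hθ0))
      · gcongr
        exact le_add_of_nonneg_right (by positivity)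

end LaurentBounds

/-! ### Existence and uniqueness of Laurent expansions. -/

section LaurentExpansion

variable {m n : ℕ} {F : ℂ × ℂ → ℂ}

theorem eqOn_ratHartogs_of_ae_eq {G : ℂ × ℂ → ℂ} (hF : DifferentiableOn ℂ F (ratHartogs m n))
    (hG : DifferentiableOn ℂ G (ratHartogs m n))
    (h : F =ᵐ[volume.restrict (ratHartogs m n)] G) : Set.EqOn F G (ratHartogs m n) :=
  Measure.eqOn_open_of_ae_eq h isOpen_ratHartogs hF.continuousOn hG.continuousOn

theorem laurentCoeff_congr (hm : 0 < m) {G : ℂ × ℂ → ℂ} (h : Set.EqOn F G (ratHartogs m n)) :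
    laurentCoeff n F = laurentCoeff n G := by
  funext α
  refine integral_congr_ae (Filter.Eventually.of_forall fun t => ?_)
  simp only
  rw [h (torusRot_mem_ratHartogs.2 (ratHartogsBase_mem hm).1)]

theorem differentiableOn_laurent_term (hn : 0 < n) {c : ℂ} {α : ℤ × ℤ} (hc : α.1 < 0 → c = 0) :
    DifferentiableOn ℂ (fun z => c * laurentMonomial α z) (ratHartogs m n) := by
  rcases lt_or_ge α.1 0 with h | h
  · simp [hc h]
  · exact fun z hz => ((differentiableAt_laurentMonomial (Or.inr h)
      (snd_ne_zero_of_mem_ratHartogs hn hz)).const_mul c).differentiableWithinAt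

theorem exists_dominated_laurent (hm : 0 < m) (hn : 0 < n)
    (hF : DifferentiableOn ℂ F (ratHartogs m n)) (hFi : IntegrableOn F (ratHartogs m n)) :
    ∀ x ∈ ratHartogs m n, ∃ U ∈ 𝓝 x, ∃ u : ℤ × ℤ → ℝ, Summable u ∧
      ∀ α, ∀ y ∈ U, ‖laurentCoeff n F α * laurentMonomial α y‖ ≤ u α := fun x hx => by
  obtain ⟨U, hU, C, θ, hC, h0, h1, hb⟩ := exists_laurent_bound hm hn hx
  exact ⟨U, hU, _, (summable_pow_natAbs_add_natAbs h0 h1).mul_left _, hb F hF hFi⟩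

/-- The Laurent expansion of an integrable holomorphic function. -/
theorem hasSumLocallyUniformlyOn_laurent (hm : 0 < m) (hn : 0 < n)
    (hF : DifferentiableOn ℂ F (ratHartogs m n)) (hFi : IntegrableOn F (ratHartogs m n)) :
    HasSumLocallyUniformlyOn (fun α z => laurentCoeff n F α * laurentMonomial α z) F
      (ratHartogs m n) := by
  have hdom := exists_dominated_laurent hm hn hF hFi
  have hdiff := differentiableOn_tsum_of_locally_dominated isOpen_ratHartogs
    (fun α => differentiableOn_laurent_term (m := m) hn
      (fun hα => laurentCoeff_eq_zero hm hn hF hα)) hdom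
  -- Fourier inversion identifies the sum only off `z₁ = 0`. Both sides are holomorphic, so almost
  -- everywhere equality suffices.
  have heq : Set.EqOn (fun z => ∑' α, laurentCoeff n F α * laurentMonomial α z) F
      (ratHartogs m n) := by
    refine eqOn_ratHartogs_of_ae_eq hdiff hF ?_
    filter_upwards [ae_restrict_ratHartogs] with z hz
    obtain ⟨U, hU, u, hu, hb⟩ := hdom z hz.1
    exact (hasSum_laurent_of_summable hm hn hF hz
      (Summable.of_norm_bounded hu fun α => hb α z (mem_of_mem_nhds hU))).tsum_eq
  exact TendstoLocallyUniformlyOn.congr_right (hasSumLocallyUniformlyOn_of_locally_dominated hdom) heq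

theorem integral_toCircle_zpow {k : ℤ} (hk : k ≠ 0) :
    ∫ t : UnitAddCircle, ((AddCircle.toCircle t : Circle) : ℂ) ^ k = 0 := by
  have h := integral_eq_zero_of_add_right_eq_neg (μ := (volume : Measure UnitAddCircle))
    (fourier_add_half_inv_index (T := 1) hk one_pos)
  rw [← h]
  refine integral_congr_ae (Filter.Eventually.of_forall fun t => ?_)
  simp [fourier_apply, AddCircle.toCircle_zsmul]

theorem torusMean_laurentMonomial {α : ℤ × ℤ} (hα : α ≠ 0) (z : ℂ × ℂ) :
    torusMean (laurentMonomial α) z = 0 := by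
  simp only [torusMean, laurentMonomial_torusRot]
  rw [integral_mul_const, Measure.volume_eq_prod]
  simp only [laurentMonomial]
  rw [integral_prod_mul (f := fun t : UnitAddCircle => ((AddCircle.toCircle t : Circle) : ℂ) ^ α.1)
    (g := fun t : UnitAddCircle => ((AddCircle.toCircle t : Circle) : ℂ) ^ α.2)]
  by_cases h : α.1 = 0
  · have h2 : α.2 ≠ 0 := fun h2 => hα (Prod.ext h h2)
    rw [integral_toCircle_zpow h2]
    simp
  · rw [integral_toCircle_zpow h]
    simp

theorem laurentMonomial_mul {α β : ℤ × ℤ} {z : ℂ × ℂ} (h1 : z.1 ≠ 0) (h2 : z.2 ≠ 0) :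
    laurentMonomial α z * laurentMonomial β z = laurentMonomial (α + β) z := by
  simp only [laurentMonomial, Prod.fst_add, Prod.snd_add, zpow_add₀ h1, zpow_add₀ h2]
  ring

/-- Uniqueness of Laurent expansions. -/
theorem eq_laurentCoeff_of_hasSumLocallyUniformlyOn (hm : 0 < m) (hn : 0 < n)
    (hF : DifferentiableOn ℂ F (ratHartogs m n)) {c : ℤ × ℤ → ℂ}
    (h : HasSumLocallyUniformlyOn (fun α z => c α * laurentMonomial α z) F (ratHartogs m n)) :
    c = laurentCoeff n F := by
  funext α
  set z := ratHartogsBase n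
  have hz := ratHartogsBase_mem (n := n) hm
  -- On the compact orbit the convergence is uniform, so torus means may be compared with those of
  -- partial sums.
  set O : Set (ℂ × ℂ) := Set.range fun t => torusRot t z
  have hO : IsCompact O := isCompact_range (continuous_torusRot_left z)
  have hOH : O ⊆ ratHartogs m n := by
    rintro _ ⟨t, rfl⟩
    exact torusRot_mem_ratHartogs.2 hz.1
  have hu := (TendstoLocallyUniformlyOn.mono h hOH)
  rw [tendstoLocallyUniformlyOn_iff_tendstoUniformlyOn_of_compact hO,
    Metric.tendstoUniformlyOn_iff] at hu
  have hz2 := snd_ne_zero_of_mem_ratHartogs hn hz.1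
  have hrot2 : ∀ t, (torusRot t z).2 ≠ 0 := fun t =>
    snd_ne_zero_of_mem_ratHartogs hn (torusRot_mem_punctured hz t).1
  have hint : ∀ β, Integrable (fun t => c β * laurentMonomial β (torusRot t z)
      * laurentMonomial (-α) (torusRot t z))
      (volume : Measure (UnitAddCircle × UnitAddCircle)) := fun β =>
    integrable_torusRot (g := fun w => c β * laurentMonomial β w * laurentMonomial (-α) w) fun t =>
      (((differentiableAt_laurentMonomial (Or.inl (torusRot_mem_punctured hz t).2)
        (hrot2 t)).const_mul _).mul (differentiableAt_laurentMonomial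
          (Or.inl (torusRot_mem_punctured hz t).2) (hrot2 t))).continuousAt
  have hmean : ∀ β, torusMean (fun w => c β * laurentMonomial β w * laurentMonomial (-α) w) z
      = if β = α then c α else 0 := fun β => by
    have h1 : torusMean (fun w => c β * laurentMonomial β w * laurentMonomial (-α) w) z
        = c β * torusMean (laurentMonomial (β + -α)) z := by
      simp only [torusMean]
      rw [← integral_const_mul]
      refine integral_congr_ae (Filter.Eventually.of_forall fun t => ?_)
      simp only
      rw [mul_assoc, laurentMonomial_mul (torusRot_mem_punctured hz t).2 (hrot2 t)]
    rw [h1]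
    split_ifs with hβ
    · subst hβ
      simp [torusMean, laurentMonomial]
    · rw [torusMean_laurentMonomial, mul_zero]
      rwa [← sub_eq_add_neg, sub_ne_zero]
  refine eq_of_forall_dist_le fun ε hε => ?_
  have hK : 0 < ‖laurentMonomial (-α) z‖ := norm_pos_iff.2 (laurentMonomial_ne_zero hz.2 hz2)
  -- Any partial sum containing `α` already has `α`-th mean equal to `c α`, by orthogonality;
  -- `|e_{-α}|` is constant on the orbit, which explains the chosen tolerance.
  obtain ⟨s, hs, hαs⟩ := ((hu (ε / ‖laurentMonomial (-α) z‖) (by positivity)).and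
    (Filter.eventually_ge_atTop {α})).exists
  have hsum : c α = ∫ t, (∑ β ∈ s, c β * laurentMonomial β (torusRot t z))
      * laurentMonomial (-α) (torusRot t z) := by
    simp only [Finset.sum_mul]
    rw [integral_finsetSum _ fun β _ => hint β]
    have := fun β => hmean β
    simp only [torusMean] at this
    simp only [this]
    rw [Finset.sum_ite_eq' s α]
    simp [Finset.singleton_subset_iff.1 hαs]
  rw [hsum, laurentCoeff, torusMean, dist_eq_norm, ← integral_sub]
  · refine (norm_integral_le_of_norm_le_const (C := ε)
      (Filter.Eventually.of_forall fun t => ?_)).trans (by simp)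
    have h1 := hs (torusRot t z) ⟨t, rfl⟩
    rw [dist_comm, dist_eq_norm] at h1
    rw [← sub_mul, norm_mul, norm_laurentMonomial_torusRot]
    exact ((lt_div_iff₀ hK).1 h1).le
  · simp only [Finset.sum_mul]
    exact integrable_finsetSum _ fun β _ => hint β
  · exact integrable_torusRot (g := fun w => F w * laurentMonomial (-α) w) fun t =>
      (differentiableAt_mul_laurentMonomial hn hF _ _ (torusRot_mem_punctured hz t)).continuousAt

end LaurentExpansion

/-! ### The Bergman space: coefficient functionals, closedness, monomials that can occur. -/

section BergmanSpace

variable {m n : ℕ} {r : ℝ≥0∞} [Fact (1 ≤ r)]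

theorem exists_integral_norm_le {X : Type*} [MeasurableSpace X] (μ : Measure X) [IsFiniteMeasure μ]
    (r : ℝ≥0∞) [Fact (1 ≤ r)] :
    ∃ K : ℝ, 0 ≤ K ∧ ∀ f : Lp ℂ r μ, ∫ x, ‖f x‖ ∂μ ≤ K * ‖f‖ := by
  set K := μ Set.univ ^ (1 / (1 : ℝ≥0∞).toReal - 1 / r.toReal)
  have hexp : 0 ≤ 1 / (1 : ℝ≥0∞).toReal - 1 / r.toReal := by
    rcases eq_or_ne r ∞ with rfl | hr
    · simp
    · have h1 : 1 ≤ r.toReal := by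
        have := ENNReal.toReal_mono hr (Fact.out : 1 ≤ r)
        simpa using this
      rw [ENNReal.toReal_one, div_one, sub_nonneg]
      exact div_le_one_of_le₀ h1 (by linarith)
  have hK : K ≠ ∞ := ENNReal.rpow_ne_top_of_nonneg hexp (measure_ne_top _ _)
  refine ⟨K.toReal, ENNReal.toReal_nonneg, fun f => ?_⟩
  have hle := eLpNorm_le_eLpNorm_mul_rpow_measure_univ (p := 1) (q := r) (Fact.out : 1 ≤ r)
    (Lp.aestronglyMeasurable f)
  have h1 : ∫ x, ‖f x‖ ∂μ = (eLpNorm f 1 μ).toReal := by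
    rw [eLpNorm_one_eq_lintegral_enorm, integral_norm_eq_lintegral_enorm
      (Lp.aestronglyMeasurable f)]
  rw [h1, Lp.norm_def, mul_comm, ← ENNReal.toReal_mul]
  exact ENNReal.toReal_mono (ENNReal.mul_ne_top (Lp.eLpNorm_ne_top f) hK) hle

omit [Fact (1 ≤ r)] in
/-- A holomorphic representative of an element of the Bergman space. -/
def bergmanRep {Ω : Set (ℂ × ℂ)} (f : bergmanSpace Ω r) : ℂ × ℂ → ℂ := f.2.choose

omit [Fact (1 ≤ r)] in
theorem differentiableOn_bergmanRep {Ω : Set (ℂ × ℂ)} (f : bergmanSpace Ω r) :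
    DifferentiableOn ℂ (bergmanRep f) Ω := f.2.choose_spec.1

omit [Fact (1 ≤ r)] in
theorem coe_ae_eq_bergmanRep {Ω : Set (ℂ × ℂ)} (f : bergmanSpace Ω r) :
    (f : Lp ℂ r (volume.restrict Ω)) =ᵐ[volume.restrict Ω] bergmanRep f := f.2.choose_spec.2

theorem integrableOn_of_ae_eq_Lp (f : Lp ℂ r (volume.restrict (ratHartogs m n)))
    {F : ℂ × ℂ → ℂ} (hf : f =ᵐ[volume.restrict (ratHartogs m n)] F) :
    IntegrableOn F (ratHartogs m n) :=
  (((Lp.memLp f).integrable Fact.out).congr hf)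

theorem integrableOn_bergmanRep (f : bergmanSpace (ratHartogs m n) r) :
    IntegrableOn (bergmanRep f) (ratHartogs m n) :=
  integrableOn_of_ae_eq_Lp f.1 (coe_ae_eq_bergmanRep f)

omit [Fact (1 ≤ r)] in
theorem eqOn_bergmanRep {f : bergmanSpace (ratHartogs m n) r} {F : ℂ × ℂ → ℂ}
    (hF : DifferentiableOn ℂ F (ratHartogs m n))
    (hf : (f : Lp ℂ r (volume.restrict (ratHartogs m n)))
      =ᵐ[volume.restrict (ratHartogs m n)] F) :
    Set.EqOn (bergmanRep f) F (ratHartogs m n) :=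
  eqOn_ratHartogs_of_ae_eq (differentiableOn_bergmanRep f) hF ((coe_ae_eq_bergmanRep f).symm.trans hf)

theorem laurentCoeff_add (hm : 0 < m) (hn : 0 < n) {F G : ℂ × ℂ → ℂ}
    (hF : DifferentiableOn ℂ F (ratHartogs m n)) (hG : DifferentiableOn ℂ G (ratHartogs m n))
    (α : ℤ × ℤ) : laurentCoeff n (F + G) α = laurentCoeff n F α + laurentCoeff n G α := by
  have hb := ratHartogsBase_mem (m := m) (n := n) hm
  simp only [laurentCoeff, torusMean, Pi.add_apply, add_mul]
  exact integral_add
    (integrable_torusRot (g := fun w => F w * laurentMonomial (-α) w) fun t =>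
      (differentiableAt_mul_laurentMonomial hn hF _ _ (torusRot_mem_punctured hb t)).continuousAt)
    (integrable_torusRot (g := fun w => G w * laurentMonomial (-α) w) fun t =>
      (differentiableAt_mul_laurentMonomial hn hG _ _ (torusRot_mem_punctured hb t)).continuousAt)

theorem laurentCoeff_smul (c : ℂ) (F : ℂ × ℂ → ℂ) (α : ℤ × ℤ) :
    laurentCoeff n (c • F) α = c * laurentCoeff n F α := by
  simp only [laurentCoeff, torusMean, Pi.smul_apply, smul_eq_mul, mul_assoc]
  exact integral_const_mul _ _

/-- On a finite measure space the `L^r` norm dominates the `L¹` norm up to a constant. -/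
theorem exists_bergman_laurent_bound (hm : 0 < m) (hn : 0 < n) {z₀ : ℂ × ℂ}
    (hz₀ : z₀ ∈ ratHartogs m n) : ∃ U ∈ 𝓝 z₀, ∃ C θ : ℝ, 0 ≤ C ∧ 0 ≤ θ ∧ θ < 1 ∧
      ∀ f : bergmanSpace (ratHartogs m n) r, ∀ α, ∀ z ∈ U,
        ‖laurentCoeff n (bergmanRep f) α * laurentMonomial α z‖
          ≤ C * ‖f‖ * θ ^ (α.1.natAbs + α.2.natAbs) := by
  obtain ⟨K, hK0, hK⟩ := exists_integral_norm_le (volume.restrict (ratHartogs m n)) r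
  obtain ⟨U, hU, C, θ, hC, h0, h1, hb⟩ := exists_laurent_bound hm hn hz₀
  refine ⟨U, hU, C * K, θ, by positivity, h0, h1, fun f α z hz => ?_⟩
  refine (hb _ (differentiableOn_bergmanRep f) (integrableOn_bergmanRep f) α z hz).trans ?_
  have h2 : ∫ z in ratHartogs m n, ‖bergmanRep f z‖ ≤ K * ‖f‖ := by
    refine le_trans (le_of_eq (integral_congr_ae ?_)) (hK f.1)
    filter_upwards [coe_ae_eq_bergmanRep f] with z hz
    rw [hz]
  rw [mul_assoc C K]
  gcongr

/-- The Laurent coefficient functionals on the Bergman space as linear maps. -/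
def bergmanCoeffₗ (hm : 0 < m) (hn : 0 < n) (α : ℤ × ℤ) :
    bergmanSpace (ratHartogs m n) r →ₗ[ℂ] ℂ where
  toFun f := laurentCoeff n (bergmanRep f) α
  map_add' f g := by
    rw [← laurentCoeff_add hm hn (differentiableOn_bergmanRep f) (differentiableOn_bergmanRep g)]
    refine congrFun (laurentCoeff_congr hm (eqOn_bergmanRep
      ((differentiableOn_bergmanRep f).add (differentiableOn_bergmanRep g)) ?_)) α
    exact (Lp.coeFn_add f.1 g.1).trans ((coe_ae_eq_bergmanRep f).add (coe_ae_eq_bergmanRep g))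
  map_smul' c f := by
    rw [RingHom.id_apply, smul_eq_mul, ← laurentCoeff_smul]
    refine congrFun (laurentCoeff_congr hm (eqOn_bergmanRep
      ((differentiableOn_bergmanRep f).const_smul c) ?_)) α
    exact (Lp.coeFn_smul c f.1).trans ((coe_ae_eq_bergmanRep f).const_smul c)

theorem exists_bergmanCoeff_bound (hm : 0 < m) (hn : 0 < n) (α : ℤ × ℤ) :
    ∃ C : ℝ, ∀ f : bergmanSpace (ratHartogs m n) r, ‖bergmanCoeffₗ hm hn α f‖ ≤ C * ‖f‖ := by
  have hb := ratHartogsBase_mem (n := n) hm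
  obtain ⟨U, hU, C, θ, _, _, _, h⟩ := exists_bergman_laurent_bound (r := r) hm hn hb.1
  have hpos : 0 < ‖laurentMonomial α (ratHartogsBase n)‖ :=
    norm_pos_iff.2 (laurentMonomial_ne_zero hb.2 (snd_ne_zero_of_mem_ratHartogs hn hb.1))
  refine ⟨C * θ ^ (α.1.natAbs + α.2.natAbs) / ‖laurentMonomial α (ratHartogsBase n)‖, fun f => ?_⟩
  have h1 := h f α _ (mem_of_mem_nhds hU)
  rw [norm_mul, ← le_div_iff₀ hpos] at h1
  refine h1.trans (le_of_eq ?_)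
  ring

/-- The Laurent coefficient functionals on the Bergman space. -/
def bergmanCoeff (hm : 0 < m) (hn : 0 < n) (α : ℤ × ℤ) :
    StrongDual ℂ (bergmanSpace (ratHartogs m n) r) :=
  LinearMap.mkContinuousOfExistsBound (bergmanCoeffₗ hm hn α) (exists_bergmanCoeff_bound hm hn α)

theorem bergmanCoeff_apply (hm : 0 < m) (hn : 0 < n) (α : ℤ × ℤ)
    (f : bergmanSpace (ratHartogs m n) r) :
    bergmanCoeff hm hn α f = laurentCoeff n (bergmanRep f) α := rfl

theorem bergmanCoeff_eq_laurentCoeff (hm : 0 < m) (hn : 0 < n)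
    {f : bergmanSpace (ratHartogs m n) r} {F : ℂ × ℂ → ℂ}
    (hF : DifferentiableOn ℂ F (ratHartogs m n))
    (hf : (f : Lp ℂ r (volume.restrict (ratHartogs m n)))
      =ᵐ[volume.restrict (ratHartogs m n)] F) (α : ℤ × ℤ) :
    bergmanCoeff hm hn α f = laurentCoeff n F α := by
  rw [bergmanCoeff_apply, laurentCoeff_congr hm (eqOn_bergmanRep hF hf)]

theorem isLaurentExpansion_iff (hm : 0 < m) (hn : 0 < n)
    (f : bergmanSpace (ratHartogs m n) r) (c : ℤ × ℤ → ℂ) :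
    IsLaurentExpansion f c ↔ c = fun α => bergmanCoeff hm hn α f := by
  constructor
  · rintro ⟨F, hF, hf, hc⟩
    rw [eq_laurentCoeff_of_hasSumLocallyUniformlyOn hm hn hF hc]
    exact funext fun α => (bergmanCoeff_eq_laurentCoeff hm hn hF hf α).symm
  · rintro rfl
    exact ⟨bergmanRep f, differentiableOn_bergmanRep f, coe_ae_eq_bergmanRep f,
      hasSumLocallyUniformlyOn_laurent hm hn (differentiableOn_bergmanRep f)
        (integrableOn_bergmanRep f)⟩

theorem mem_allowableSubspace_iff (hm : 0 < m) (hn : 0 < n) {s : ℝ≥0∞}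
    (f : bergmanSpace (ratHartogs m n) r) :
    f ∈ allowableSubspace (ratHartogs m n) r s
      ↔ ∀ α ∉ allowable (ratHartogs m n) s, bergmanCoeff hm hn α f = 0 := by
  change (∃ c, IsLaurentExpansion f c ∧ _) ↔ _
  simp only [isLaurentExpansion_iff hm hn, exists_eq_left]

/-- The tool by which the projections are shown to act as the identity: such equalities are checked
coefficient by coefficient. -/
theorem eq_of_bergmanCoeff_eq (hm : 0 < m) (hn : 0 < n) {f g : bergmanSpace (ratHartogs m n) r}
    (h : ∀ α, bergmanCoeff hm hn α f = bergmanCoeff hm hn α g) : f = g := by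
  refine Subtype.ext (Lp.ext ?_)
  refine (coe_ae_eq_bergmanRep f).trans (Filter.EventuallyEq.trans ?_ (coe_ae_eq_bergmanRep g).symm)
  filter_upwards [ae_restrict_mem measurableSet_ratHartogs] with z hz
  have h1 := (hasSumLocallyUniformlyOn_laurent hm hn (differentiableOn_bergmanRep f)
    (integrableOn_bergmanRep f)).hasSum hz
  have h2 := (hasSumLocallyUniformlyOn_laurent hm hn (differentiableOn_bergmanRep g)
    (integrableOn_bergmanRep g)).hasSum hz
  simp only [bergmanCoeff_apply] at h
  simp only [h] at h1
  exact h1.unique h2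

/-- Along a convergent sequence the coefficients converge, and the Laurent terms share a geometric
majorant near each point. The limiting Laurent series is therefore holomorphic, and an almost
everywhere convergent subsequence identifies it with the `L^r` limit. -/
theorem isClosed_bergmanSpace (hm : 0 < m) (hn : 0 < n) :
    IsClosed (bergmanSpace (ratHartogs m n) r : Set (Lp ℂ r (volume.restrict (ratHartogs m n)))) := by
  refine isClosed_of_closure_subset fun f hf => ?_
  obtain ⟨x, hx, hxf⟩ := mem_closure_iff_seq_limit.1 hf
  let y : ℕ → bergmanSpace (ratHartogs m n) r := fun k => ⟨x k, hx k⟩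
  have hcauchy : CauchySeq y := by
    have h : Cauchy (Filter.map Subtype.val (Filter.map y Filter.atTop)) := by
      rw [Filter.map_map]
      exact hxf.cauchySeq
    exact isUniformEmbedding_subtype_val.isUniformInducing.cauchy_map_iff.1 h
  have hcoef : ∀ α, ∃ c, Filter.Tendsto (fun k => bergmanCoeff hm hn α (y k)) Filter.atTop (𝓝 c) :=
    fun α => cauchySeq_tendsto_of_complete
      (hcauchy.map (bergmanCoeff (r := r) hm hn α).uniformContinuous)
  choose c hc using hcoef
  obtain ⟨B, hB0, hB⟩ : ∃ B : ℝ, 0 ≤ B ∧ ∀ k, ‖y k‖ ≤ B := by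
    obtain ⟨B, hB⟩ := hcauchy.isBounded_range.exists_norm_le
    exact ⟨B, (norm_nonneg _).trans (hB (y 0) ⟨0, rfl⟩), fun k => hB _ ⟨k, rfl⟩⟩
  have hc0 : ∀ α : ℤ × ℤ, α.1 < 0 → c α = 0 := fun α hα => by
    refine tendsto_nhds_unique (hc α) (tendsto_const_nhds.congr fun k => ?_)
    exact (laurentCoeff_eq_zero hm hn (differentiableOn_bergmanRep (y k)) hα).symm
  have hbound : ∀ z₀ ∈ ratHartogs m n, ∃ U ∈ 𝓝 z₀, ∃ u : ℤ × ℤ → ℝ, Summable u ∧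
      (∀ k α, ∀ z ∈ U, ‖bergmanCoeff hm hn α (y k) * laurentMonomial α z‖ ≤ u α) ∧
      ∀ α, ∀ z ∈ U, ‖c α * laurentMonomial α z‖ ≤ u α := fun z₀ hz₀ => by
    obtain ⟨U, hU, C, θ, hC, h0, h1, hb⟩ := exists_bergman_laurent_bound (r := r) hm hn hz₀
    have hk : ∀ k α, ∀ z ∈ U, ‖bergmanCoeff hm hn α (y k) * laurentMonomial α z‖
        ≤ C * B * θ ^ (α.1.natAbs + α.2.natAbs) := fun k α z hz => by
      refine (hb (y k) α z hz).trans ?_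
      gcongr
      exact hB k
    refine ⟨U, hU, _, (summable_pow_natAbs_add_natAbs h0 h1).mul_left (C * B), hk,
      fun α z hz => ?_⟩
    exact le_of_tendsto ((hc α).mul_const _).norm (Filter.Eventually.of_forall fun k => hk k α z hz)
  have hdom : ∀ z₀ ∈ ratHartogs m n, ∃ U ∈ 𝓝 z₀, ∃ u : ℤ × ℤ → ℝ, Summable u ∧
      ∀ α, ∀ z ∈ U, ‖c α * laurentMonomial α z‖ ≤ u α := fun z₀ hz₀ => by
    obtain ⟨U, hU, u, hu, _, h⟩ := hbound z₀ hz₀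
    exact ⟨U, hU, u, hu, h⟩
  refine ⟨fun z => ∑' α, c α * laurentMonomial α z,
    differentiableOn_tsum_of_locally_dominated isOpen_ratHartogs
      (fun α => differentiableOn_laurent_term hn (hc0 α)) hdom, ?_⟩
  obtain ⟨ns, hns, hns'⟩ := (tendstoInMeasure_of_tendsto_Lp hxf).exists_seq_tendsto_ae
  have hrep : ∀ᵐ z ∂volume.restrict (ratHartogs m n), ∀ k, x k z = bergmanRep (y k) z :=
    ae_all_iff.2 fun k => coe_ae_eq_bergmanRep (y k)
  filter_upwards [hns', hrep, ae_restrict_mem measurableSet_ratHartogs] with z hz hrz hzH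
  obtain ⟨U, hU, u, hu, h1, _⟩ := hbound z hzH
  have hlim := tendsto_tsum_of_dominated_convergence (𝓕 := Filter.atTop)
    (f := fun k α => bergmanCoeff hm hn α (y k) * laurentMonomial α z)
    (g := fun α => c α * laurentMonomial α z) hu (fun α => (hc α).mul_const _)
    (Filter.Eventually.of_forall fun k α => h1 k α z (mem_of_mem_nhds hU))
  have hlim' : Filter.Tendsto (fun k => x k z) Filter.atTop
      (𝓝 (∑' α, c α * laurentMonomial α z)) := by
    refine hlim.congr fun k => ?_
    rw [hrz]
    exact ((hasSumLocallyUniformlyOn_laurent hm hn (differentiableOn_bergmanRep (y k))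
      (integrableOn_bergmanRep (y k))).hasSum hzH).tsum_eq
  exact tendsto_nhds_unique hz (hlim'.comp hns.tendsto_atTop)

/-- The term `c_α e_α(z)` is the mean of `F` over the orbit against a unimodular factor. Since the
torus has mass one, `|c_α e_α|^r` is at most the orbit mean of `|F|^r`, whose integral over the
domain is that of `|F|^r`. -/
theorem memLp_laurentMonomial_of_laurentCoeff_ne_zero (hm : 0 < m) (hn : 0 < n) (hr : r ≠ ∞)
    {F : ℂ × ℂ → ℂ} (hF : DifferentiableOn ℂ F (ratHartogs m n))
    (hFr : MemLp F r (volume.restrict (ratHartogs m n))) {α : ℤ × ℤ}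
    (hα : laurentCoeff n F α ≠ 0) :
    MemLp (laurentMonomial α) r (volume.restrict (ratHartogs m n)) := by
  have hr0 : r ≠ 0 := (zero_lt_one.trans_le (Fact.out : 1 ≤ r)).ne'
  have hR : 0 < r.toReal := ENNReal.toReal_pos hr0 hr
  refine ⟨(measurable_laurentMonomial α).aestronglyMeasurable, ?_⟩
  rw [eLpNorm_lt_top_iff_lintegral_rpow_enorm_lt_top hr0 hr]
  -- `F` is controlled only on the domain; extension by zero makes it measurable everywhere, as
  -- Tonelli requires.
  set F₀ := (ratHartogs m n).indicator F with hF₀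
  have hF₀m : Measurable F₀ := by
    classical
    rw [hF₀, ← Set.piecewise_eq_indicator]
    exact hF.continuousOn.measurable_piecewise continuousOn_const measurableSet_ratHartogs
  have hF₀eq : ∀ z ∈ ratHartogs m n, F₀ z = F z := fun z hz => Set.indicator_of_mem hz F
  have hfin : ∫⁻ z in ratHartogs m n, ‖F₀ z‖ₑ ^ r.toReal < ∞ := by
    have h := hFr.2
    rw [eLpNorm_lt_top_iff_lintegral_rpow_enorm_lt_top hr0 hr] at h
    refine lt_of_eq_of_lt (lintegral_congr_ae ?_) h
    filter_upwards [ae_restrict_mem measurableSet_ratHartogs] with z hz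
    rw [hF₀eq z hz]
  have hpt : ∀ᵐ z ∂volume.restrict (ratHartogs m n),
      ‖laurentCoeff n F α‖ₑ ^ r.toReal * ‖laurentMonomial α z‖ₑ ^ r.toReal
        ≤ ∫⁻ t, ‖F₀ (torusRot t z)‖ₑ ^ r.toReal := by
    filter_upwards [ae_restrict_ratHartogs] with z hz
    have hz2 := snd_ne_zero_of_mem_ratHartogs hn hz.1
    have hmz : Measurable fun t => F₀ (torusRot t z) :=
      hF₀m.comp (continuous_torusRot_left z).measurable
    have h1 : ‖laurentCoeff n F α‖ₑ * ‖laurentMonomial α z‖ₑ ≤ ∫⁻ t, ‖F₀ (torusRot t z)‖ₑ := by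
      rw [← torusMean_eq_laurentCoeff hm hn hF α hz, torusMean, ← enorm_mul, ← integral_mul_const]
      refine (enorm_integral_le_lintegral_enorm _).trans (le_of_eq (lintegral_congr fun t => ?_))
      rw [enorm_mul, enorm_mul, hF₀eq _ (torusRot_mem_ratHartogs.2 hz.1), mul_assoc, ← enorm_mul]
      have : ‖laurentMonomial (-α) (torusRot t z) * laurentMonomial α z‖ = 1 := by
        rw [norm_mul, norm_laurentMonomial_torusRot, ← norm_mul, laurentMonomial_neg,
          inv_mul_cancel₀ (laurentMonomial_ne_zero hz.2 hz2), norm_one]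
      rw [← ofReal_norm (laurentMonomial (-α) _ * _), this, ENNReal.ofReal_one, mul_one]
    have h2 := eLpNorm_le_eLpNorm_of_exponent_le (p := 1) (q := r) Fact.out
      (hmz.aestronglyMeasurable (μ := (volume : Measure (UnitAddCircle × UnitAddCircle))))
    rw [eLpNorm_one_eq_lintegral_enorm, eLpNorm_eq_lintegral_rpow_enorm_toReal hr0 hr] at h2
    rw [← ENNReal.mul_rpow_of_nonneg _ _ hR.le]
    refine (ENNReal.rpow_le_rpow (h1.trans h2) hR.le).trans (le_of_eq ?_)
    rw [← ENNReal.rpow_mul, one_div_mul_cancel hR.ne', ENNReal.rpow_one]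
  have hle := lintegral_mono_ae hpt
  rw [← lintegral_eq_lintegral_torus measurePreserving_torusRot_restrict
      (f := fun z => ‖F₀ z‖ₑ ^ r.toReal) (hF₀m.enorm.pow_const _),
    lintegral_const_mul _ ((measurable_laurentMonomial α).enorm.pow_const _)] at hle
  have hc0 : ‖laurentCoeff n F α‖ₑ ^ r.toReal ≠ 0 := by
    simp [ENNReal.rpow_eq_zero_iff, hα]
  by_contra htop
  rw [not_lt, top_le_iff] at htop
  rw [htop, ENNReal.mul_top hc0] at hle
  exact absurd (hle.trans_lt hfin) (lt_irrefl _)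

theorem bergmanCoeff_eq_zero_of_notMem_allowable (hm : 0 < m) (hn : 0 < n) (hr : r ≠ ∞)
    (f : bergmanSpace (ratHartogs m n) r) {α : ℤ × ℤ} (hα : α ∉ allowable (ratHartogs m n) r) :
    bergmanCoeff hm hn α f = 0 := by
  by_contra h
  have hF := differentiableOn_bergmanRep f
  have h1 : 0 ≤ α.1 := by
    by_contra h1
    exact h (laurentCoeff_eq_zero hm hn hF (not_le.1 h1))
  exact hα ⟨fun z hz => (differentiableAt_laurentMonomial (Or.inr h1)
    (snd_ne_zero_of_mem_ratHartogs hn hz)).differentiableWithinAt,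
    memLp_laurentMonomial_of_laurentCoeff_ne_zero hm hn hr hF
      ((memLp_congr_ae (coe_ae_eq_bergmanRep f)).1 (Lp.memLp f.1)) h⟩

end BergmanSpace

/-! ### Radial integrals over the unit disc. -/

section RadialIntegrals

theorem setLIntegral_ball_norm {f : ℝ → ℝ≥0∞} (hf : Measurable f) :
    ∫⁻ ζ in Metric.ball (0 : ℂ) 1, f ‖ζ‖
      = ENNReal.ofReal (2 * Real.pi) * ∫⁻ ρ in Set.Ioo (0 : ℝ) 1, ENNReal.ofReal ρ * f ρ := by
  rw [← lintegral_indicator measurableSet_ball, ← Complex.lintegral_comp_polarCoord_symm,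
    polarCoord_target, Measure.volume_eq_prod, ← Measure.prod_restrict]
  have h1 : ∀ p ∈ Set.Ioi (0 : ℝ) ×ˢ Set.Ioo (-Real.pi) Real.pi,
      ENNReal.ofReal p.1 • (Metric.ball (0 : ℂ) 1).indicator (fun ζ => f ‖ζ‖)
        (Complex.polarCoord.symm p)
      = (Set.Iio (1 : ℝ)).indicator (fun ρ => ENNReal.ofReal ρ * f ρ) p.1 := by
    intro p hp
    have hn : ‖Complex.polarCoord.symm p‖ = p.1 := by
      rw [Complex.norm_polarCoord_symm, abs_of_pos hp.1]
    by_cases h : p.1 < 1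
    · rw [Set.indicator_of_mem (by rwa [mem_ball_zero_iff, hn]),
        Set.indicator_of_mem (show p.1 ∈ Set.Iio (1 : ℝ) from h), hn, smul_eq_mul]
    · rw [Set.indicator_of_notMem (by rwa [mem_ball_zero_iff, hn]),
        Set.indicator_of_notMem (show p.1 ∉ Set.Iio (1 : ℝ) from h), smul_zero]
  rw [Measure.prod_restrict, setLIntegral_congr_fun (measurableSet_Ioi.prod measurableSet_Ioo) h1,
    ← Measure.prod_restrict]
  have hmeas : Measurable ((Set.Iio (1 : ℝ)).indicator (fun ρ => ENNReal.ofReal ρ * f ρ)) :=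
    (ENNReal.measurable_ofReal.mul hf).indicator measurableSet_Iio
  have hprod := lintegral_prod (μ := volume.restrict (Set.Ioi (0 : ℝ)))
    (ν := volume.restrict (Set.Ioo (-Real.pi) Real.pi))
    (fun x : ℝ × ℝ => (Set.Iio (1 : ℝ)).indicator (fun ρ => ENNReal.ofReal ρ * f ρ) x.1)
    (hmeas.comp measurable_fst).aemeasurable
  rw [hprod]
  simp only [lintegral_const, Measure.restrict_apply_univ, Real.volume_Ioo]
  rw [lintegral_mul_const _ hmeas, lintegral_indicator measurableSet_Iio,
    Measure.restrict_restrict measurableSet_Iio, mul_comm]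
  congr 2
  · ring
  · rw [Set.inter_comm, Set.Ioi_inter_Iio]

theorem setLIntegral_ball_rpow {c : ℝ} (hc : -2 < c) :
    ∫⁻ ζ in Metric.ball (0 : ℂ) 1, ENNReal.ofReal (‖ζ‖ ^ c)
      = ENNReal.ofReal (2 * Real.pi / (c + 2)) := by
  rw [setLIntegral_ball_norm (f := fun ρ => ENNReal.ofReal (ρ ^ c)) (by fun_prop)]
  have h1 : ∀ ρ ∈ Set.Ioo (0 : ℝ) 1, ENNReal.ofReal ρ * ENNReal.ofReal (ρ ^ c)
      = ENNReal.ofReal (ρ ^ (c + 1)) := fun ρ hρ => by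
    rw [← ENNReal.ofReal_mul hρ.1.le, Real.rpow_add_one hρ.1.ne', mul_comm]
  rw [setLIntegral_congr_fun measurableSet_Ioo h1]
  have hint : IntegrableOn (fun ρ : ℝ => ρ ^ (c + 1)) (Set.Ioo 0 1) :=
    (intervalIntegral.integrableOn_Ioo_rpow_iff one_pos).2 (by linarith)
  rw [← ofReal_integral_eq_lintegral_ofReal hint
    ((ae_restrict_mem measurableSet_Ioo).mono fun ρ hρ => Real.rpow_nonneg hρ.1.le _),
    ← integral_Ioc_eq_integral_Ioo, ← intervalIntegral.integral_of_le zero_le_one,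
    integral_rpow (Or.inl (by linarith)), ← ENNReal.ofReal_mul (by positivity)]
  congr 1
  rw [Real.one_rpow, Real.zero_rpow (by linarith)]
  have : c + 1 + 1 ≠ 0 := by linarith
  have : c + 2 ≠ 0 := by linarith
  field_simp
  ring

theorem setLIntegral_ball_rpow_eq_top {c : ℝ} (hc : c ≤ -2) :
    ∫⁻ ζ in Metric.ball (0 : ℂ) 1, ENNReal.ofReal (‖ζ‖ ^ c) = ∞ := by
  rw [setLIntegral_ball_norm (f := fun ρ => ENNReal.ofReal (ρ ^ c)) (by fun_prop)]
  have h1 : ∀ ρ ∈ Set.Ioo (0 : ℝ) 1, ENNReal.ofReal ρ * ENNReal.ofReal (ρ ^ c)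
      = ENNReal.ofReal (ρ ^ (c + 1)) := fun ρ hρ => by
    rw [← ENNReal.ofReal_mul hρ.1.le, Real.rpow_add_one hρ.1.ne', mul_comm]
  rw [setLIntegral_congr_fun measurableSet_Ioo h1]
  have hnot : ¬ IntegrableOn (fun ρ : ℝ => ρ ^ (c + 1)) (Set.Ioo 0 1) := fun h => by
    have := (intervalIntegral.integrableOn_Ioo_rpow_iff one_pos).1 h
    linarith
  have htop : ∫⁻ ρ in Set.Ioo (0 : ℝ) 1, ENNReal.ofReal (ρ ^ (c + 1)) = ∞ := by
    by_contra h
    refine hnot ((lintegral_ofReal_ne_top_iff_integrable ?_ ?_).1 h)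
    · exact (by fun_prop : Measurable fun ρ : ℝ => ρ ^ (c + 1)).aestronglyMeasurable
    · exact (ae_restrict_mem measurableSet_Ioo).mono fun ρ hρ => Real.rpow_nonneg hρ.1.le _
  rw [htop, ENNReal.mul_top]
  simp [Real.pi_pos]

/-- Split where the maximum changes, at `v = u`. Each piece is a multiple of `u^(-δ)`; the lower one
converges because `δ < 1`, the upper one because `0 < δ`. -/
theorem lintegral_Ioo_kernel_le {δ u : ℝ} (hδ : 0 < δ) (hδ1 : δ < 1) (hu : 0 < u) :
    ∫⁻ v in Set.Ioo (0 : ℝ) 1, ENNReal.ofReal (v ^ (-δ) / max u v)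
      ≤ ENNReal.ofReal ((1 / (1 - δ) + 1 / δ) * u ^ (-δ)) := by
  have hsub : Set.Ioo (0 : ℝ) 1 ⊆ Set.Ioc 0 u ∪ Set.Ioi u := fun v hv => by
    rcases le_or_gt v u with h | h
    · exact Or.inl ⟨hv.1, h⟩
    · exact Or.inr h
  refine (lintegral_mono_set hsub).trans ((lintegral_union_le _ _ _).trans ?_)
  have h1 : ∫⁻ v in Set.Ioc 0 u, ENNReal.ofReal (v ^ (-δ) / max u v)
      = ENNReal.ofReal (1 / (1 - δ) * u ^ (-δ)) := by
    have e : ∀ v ∈ Set.Ioc 0 u, ENNReal.ofReal (v ^ (-δ) / max u v)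
        = ENNReal.ofReal (v ^ (-δ) / u) := fun v hv => by rw [max_eq_left hv.2]
    have hint : IntervalIntegrable (fun v : ℝ => v ^ (-δ)) volume 0 u :=
      intervalIntegral.intervalIntegrable_rpow' (by linarith)
    rw [setLIntegral_congr_fun measurableSet_Ioc e, ← ofReal_integral_eq_lintegral_ofReal
      (((intervalIntegrable_iff_integrableOn_Ioc_of_le hu.le).1 hint).div_const u)
      ((ae_restrict_mem measurableSet_Ioc).mono fun v hv =>
        div_nonneg (Real.rpow_nonneg hv.1.le _) hu.le),
      ← intervalIntegral.integral_of_le hu.le, intervalIntegral.integral_div,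
      integral_rpow (Or.inl (by linarith))]
    congr 1
    have h3 : 1 - δ ≠ 0 := by linarith
    rw [Real.zero_rpow (by linarith), Real.rpow_add hu, Real.rpow_one, neg_add_eq_sub, sub_zero]
    field_simp
  have h2 : ∫⁻ v in Set.Ioi u, ENNReal.ofReal (v ^ (-δ) / max u v)
      = ENNReal.ofReal (1 / δ * u ^ (-δ)) := by
    have e : ∀ v ∈ Set.Ioi u, ENNReal.ofReal (v ^ (-δ) / max u v)
        = ENNReal.ofReal (v ^ (-δ - 1)) := fun v hv => by
      have hv0 : 0 < v := hu.trans hv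
      rw [max_eq_right (le_of_lt hv), Real.rpow_sub_one hv0.ne']
    rw [setLIntegral_congr_fun measurableSet_Ioi e, ← ofReal_integral_eq_lintegral_ofReal
      (integrableOn_Ioi_rpow_of_lt (by linarith) hu)
      ((ae_restrict_mem measurableSet_Ioi).mono fun v hv =>
        Real.rpow_nonneg (hu.trans hv).le _), integral_Ioi_rpow_of_lt (by linarith) hu]
    congr 1
    rw [sub_add_cancel]
    field_simp
  rw [h1, h2, ← ENNReal.ofReal_add (by have : 0 < 1 - δ := by linarith
                                       positivity) (by positivity), ← add_mul]

/-- The one-dimensional kernel estimate behind Schur's test on the disc. -/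
theorem exists_setLIntegral_ball_kernel_le {a δ : ℝ} (ha : -2 < a) (hδ : 0 < δ) (hδ1 : δ < 1) :
    ∃ C : ℝ, 0 ≤ C ∧ ∀ r : ℝ, 0 ≤ r → r < 1 →
      ∫⁻ ζ in Metric.ball (0 : ℂ) 1, ENNReal.ofReal (‖ζ‖ ^ a * (1 - ‖ζ‖) ^ (-δ) / (1 - r * ‖ζ‖))
        ≤ ENNReal.ofReal (C * (1 - r) ^ (-δ)) := by
  set B : ℝ := 2 ^ |a + 1|
  have hB : 0 ≤ B := by positivity
  have hδ1' : 0 < 1 - δ := by linarith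
  refine ⟨2 * Real.pi * (4 / (a + 2) + B * (1 / (1 - δ) + 1 / δ)),
    by have : 0 < a + 2 := by linarith
       positivity, fun r hr hr1 => ?_⟩
  have hu : 0 < 1 - r := by linarith
  rw [setLIntegral_ball_norm
    (f := fun ρ => ENNReal.ofReal (ρ ^ a * (1 - ρ) ^ (-δ) / (1 - r * ρ))) (by fun_prop)]
  -- For `ρ ≤ 1/2` only the power of `ρ` can be singular and the remaining factor is at most `4`.
  -- For `ρ ≥ 1/2` that power is at most `B`, and `1 - rρ` dominates both `1 - r` and `1 - ρ`.
  have hpt : ∀ ρ ∈ Set.Ioo (0 : ℝ) 1,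
      ENNReal.ofReal ρ * ENNReal.ofReal (ρ ^ a * (1 - ρ) ^ (-δ) / (1 - r * ρ))
      ≤ ENNReal.ofReal (4 * ρ ^ (a + 1))
        + ENNReal.ofReal (B * ((1 - ρ) ^ (-δ) / max (1 - r) (1 - ρ))) := fun ρ hρ => by
    obtain ⟨h0, h1⟩ := hρ
    have hv : 0 < 1 - ρ := by linarith
    have hden : max (1 - r) (1 - ρ) ≤ 1 - r * ρ := max_le (by nlinarith) (by nlinarith)
    have hmax : 0 < max (1 - r) (1 - ρ) := lt_max_of_lt_left hu
    have hden0 : 0 < 1 - r * ρ := hmax.trans_le hden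
    have hvδ : 0 < (1 - ρ) ^ (-δ) := Real.rpow_pos_of_pos hv _
    have hρa : 0 < ρ ^ (a + 1) := Real.rpow_pos_of_pos h0 _
    rw [← ENNReal.ofReal_mul h0.le, ← ENNReal.ofReal_add (by positivity) (by positivity)]
    refine ENNReal.ofReal_le_ofReal ?_
    have e : ρ * (ρ ^ a * (1 - ρ) ^ (-δ) / (1 - r * ρ))
        = ρ ^ (a + 1) * ((1 - ρ) ^ (-δ) / (1 - r * ρ)) := by
      rw [Real.rpow_add_one h0.ne']; ring
    rw [e]
    have hq : (1 - ρ) ^ (-δ) / (1 - r * ρ) ≤ (1 - ρ) ^ (-δ) / max (1 - r) (1 - ρ) :=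
      div_le_div_of_nonneg_left hvδ.le hmax hden
    have hq0 : 0 ≤ (1 - ρ) ^ (-δ) / max (1 - r) (1 - ρ) := by positivity
    rcases le_total ρ (1 / 2) with h2 | h2
    · have e1 : (1 - ρ) ^ (-δ) ≤ 2 := by
        calc (1 - ρ) ^ (-δ) ≤ (1 / 2 : ℝ) ^ (-δ) :=
              Real.rpow_le_rpow_of_nonpos (by norm_num) (by linarith) (by linarith)
          _ = 2 ^ δ := by rw [Real.rpow_neg (by norm_num), one_div, Real.inv_rpow (by norm_num),
              inv_inv]
          _ ≤ 2 ^ (1 : ℝ) := Real.rpow_le_rpow_of_exponent_le (by norm_num) hδ1.le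
          _ = 2 := Real.rpow_one 2
      have e2 : (1 - ρ) ^ (-δ) / (1 - r * ρ) ≤ 4 := by
        rw [div_le_iff₀ hden0]
        nlinarith
      nlinarith [mul_le_mul_of_nonneg_left e2 hρa.le, mul_nonneg hB hq0]
    · have e1 : ρ ^ (a + 1) ≤ B := by
        rcases le_total 0 (a + 1) with h3 | h3
        · exact (Real.rpow_le_one h0.le h1.le h3).trans
            (Real.one_le_rpow (by norm_num) (abs_nonneg _))
        · calc ρ ^ (a + 1) ≤ (1 / 2 : ℝ) ^ (a + 1) :=
              Real.rpow_le_rpow_of_nonpos (by norm_num) h2 h3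
            _ = B := by
              simp only [B]
              rw [abs_of_nonpos h3, Real.rpow_neg (by norm_num), one_div,
                Real.inv_rpow (by norm_num)]
      have e2 := mul_le_mul e1 hq (by positivity) hB
      linarith [hρa]
  have hint1 : ∫⁻ ρ in Set.Ioo (0 : ℝ) 1, ENNReal.ofReal (4 * ρ ^ (a + 1))
      = ENNReal.ofReal (4 / (a + 2)) := by
    have hint : IntegrableOn (fun ρ : ℝ => ρ ^ (a + 1)) (Set.Ioo 0 1) :=
      (intervalIntegral.integrableOn_Ioo_rpow_iff one_pos).2 (by linarith)
    rw [← ofReal_integral_eq_lintegral_ofReal (hint.const_mul 4)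
      ((ae_restrict_mem measurableSet_Ioo).mono fun ρ hρ =>
        mul_nonneg (by norm_num) (Real.rpow_nonneg hρ.1.le _)), integral_const_mul,
      ← integral_Ioc_eq_integral_Ioo, ← intervalIntegral.integral_of_le zero_le_one,
      integral_rpow (Or.inl (by linarith))]
    congr 1
    rw [Real.one_rpow, Real.zero_rpow (by linarith), add_assoc]
    norm_num
    ring
  have hint2 : ∫⁻ ρ in Set.Ioo (0 : ℝ) 1,
      ENNReal.ofReal (B * ((1 - ρ) ^ (-δ) / max (1 - r) (1 - ρ)))
      ≤ ENNReal.ofReal (B * ((1 / (1 - δ) + 1 / δ) * (1 - r) ^ (-δ))) := by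
    have hmp : MeasurePreserving (fun ρ : ℝ => 1 - ρ) (volume.restrict (Set.Ioo 0 1))
        (volume.restrict (Set.Ioo 0 1)) := by
      have h := (Measure.measurePreserving_sub_left (volume : Measure ℝ) 1).restrict_preimage
        (measurableSet_Ioo (a := (0 : ℝ)) (b := 1))
      have h2 : (fun ρ : ℝ => 1 - ρ) ⁻¹' Set.Ioo 0 1 = Set.Ioo 0 1 := by
        ext ρ
        simp only [Set.mem_preimage, Set.mem_Ioo]
        constructor <;> rintro ⟨h3, h4⟩ <;> constructor <;> linarith
      rwa [h2] at h
    have hm : Measurable fun v : ℝ => ENNReal.ofReal (B * (v ^ (-δ) / max (1 - r) v)) := by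
      fun_prop
    rw [hmp.lintegral_comp hm]
    simp_rw [ENNReal.ofReal_mul hB]
    rw [lintegral_const_mul _ (by fun_prop)]
    exact mul_le_mul_right (lintegral_Ioo_kernel_le hδ hδ1 hu) _
  -- This absorbs the constant coming from small `ρ` into the required bound.
  have hone : 1 ≤ (1 - r) ^ (-δ) :=
    Real.one_le_rpow_of_pos_of_le_one_of_nonpos hu (by linarith) (by linarith)
  have ha2 : 0 < a + 2 := by linarith
  calc _ ≤ ENNReal.ofReal (2 * Real.pi) * ∫⁻ ρ in Set.Ioo (0 : ℝ) 1,
        (ENNReal.ofReal (4 * ρ ^ (a + 1))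
        + ENNReal.ofReal (B * ((1 - ρ) ^ (-δ) / max (1 - r) (1 - ρ)))) :=
        mul_le_mul_right (setLIntegral_mono' measurableSet_Ioo hpt) _
    _ ≤ ENNReal.ofReal (2 * Real.pi) * (ENNReal.ofReal (4 / (a + 2))
        + ENNReal.ofReal (B * ((1 / (1 - δ) + 1 / δ) * (1 - r) ^ (-δ)))) := by
        rw [lintegral_add_left (by fun_prop), hint1]
        gcongr
    _ ≤ _ := by
        rw [← ENNReal.ofReal_add (by positivity) (by positivity),
          ← ENNReal.ofReal_mul (by positivity)]
        refine ENNReal.ofReal_le_ofReal ?_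
        rw [mul_assoc (2 * Real.pi)]
        refine mul_le_mul_of_nonneg_left ?_ (by positivity)
        have h4 : 4 / (a + 2) ≤ 4 / (a + 2) * (1 - r) ^ (-δ) :=
          le_mul_of_one_le_right (by positivity) hone
        calc _ ≤ 4 / (a + 2) * (1 - r) ^ (-δ) + B * ((1 / (1 - δ) + 1 / δ) * (1 - r) ^ (-δ)) := by
              gcongr
          _ = _ := by ring

end RadialIntegrals

/-! ### Integration in scaled coordinates, where the domain becomes a product of discs. -/

section HartogsIntegral

variable {m n : ℕ}

theorem lintegral_ball_scale {g : ℂ → ℝ≥0∞} (hg : Measurable g) {c : ℝ} (hc : 0 < c) :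
    ∫⁻ w in Metric.ball (0 : ℂ) c, g w
      = ENNReal.ofReal (c ^ 2) * ∫⁻ ζ in Metric.ball (0 : ℂ) 1, g (c * ζ) := by
  have h := Measure.map_addHaar_smul (volume : Measure ℂ) hc.ne'
  have h2 : ∀ f : ℂ → ℝ≥0∞, Measurable f →
      ∫⁻ w, f w = ENNReal.ofReal (c ^ 2) * ∫⁻ ζ, f (c * ζ) := fun f hf => by
    have e : ∫⁻ ζ, f (c * ζ) = ∫⁻ w, f w ∂(Measure.map (c • ·) (volume : Measure ℂ)) := by
      rw [lintegral_map hf (by fun_prop)]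
      simp
    rw [e, h, Complex.finrank_real_complex, lintegral_smul_measure, abs_of_pos (by positivity),
      smul_eq_mul, ← mul_assoc, ← ENNReal.ofReal_mul (by positivity),
      mul_inv_cancel₀ (by positivity), ENNReal.ofReal_one, one_mul]
  rw [← lintegral_indicator measurableSet_ball, ← lintegral_indicator measurableSet_ball,
    h2 _ (hg.indicator measurableSet_ball)]
  congr 1
  refine lintegral_congr fun ζ => ?_
  have hiff : (c : ℂ) * ζ ∈ Metric.ball (0 : ℂ) c ↔ ζ ∈ Metric.ball (0 : ℂ) 1 := by
    rw [mem_ball_zero_iff, mem_ball_zero_iff, norm_mul, Complex.norm_real,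
      Real.norm_of_nonneg hc.le, mul_lt_iff_lt_one_right hc]
  by_cases hζ : ζ ∈ Metric.ball (0 : ℂ) 1
  · rw [Set.indicator_of_mem hζ, Set.indicator_of_mem (hiff.2 hζ)]
  · rw [Set.indicator_of_notMem hζ, Set.indicator_of_notMem (mt hiff.1 hζ)]

theorem rpow_div_pow {b : ℝ} (hb : 0 ≤ b) (hm : 0 < m) : (b ^ ((n : ℝ) / m)) ^ m = b ^ n := by
  rw [← Real.rpow_natCast (b ^ ((n : ℝ) / m)), ← Real.rpow_mul hb,
    div_mul_cancel₀ _ (by positivity), Real.rpow_natCast]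

/-- Integration over `ratHartogs m n` in the coordinates `(z₁ / |z₂| ^ (n / m), z₂)`. -/
theorem lintegral_ratHartogs (hm : 0 < m) {f : ℂ × ℂ → ℝ≥0∞} (hf : Measurable f) :
    ∫⁻ z in ratHartogs m n, f z = ∫⁻ w in Metric.ball (0 : ℂ) 1,
      ENNReal.ofReal ((‖w‖ ^ ((n : ℝ) / m)) ^ 2)
        * ∫⁻ ζ in Metric.ball (0 : ℂ) 1, f ((‖w‖ ^ ((n : ℝ) / m) : ℝ) * ζ, w) := by
  rw [← lintegral_indicator measurableSet_ratHartogs, Measure.volume_eq_prod,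
    lintegral_prod_symm _ (hf.indicator measurableSet_ratHartogs).aemeasurable,
    ← lintegral_indicator measurableSet_ball]
  refine lintegral_congr_ae ?_
  have hne : ∀ᵐ w : ℂ, w ≠ 0 := by simp [ae_iff]
  filter_upwards [hne] with w hw
  have hw0 := norm_pos_iff.2 hw
  have hc : 0 < ‖w‖ ^ ((n : ℝ) / m) := Real.rpow_pos_of_pos hw0 _
  by_cases hw1 : w ∈ Metric.ball (0 : ℂ) 1
  · rw [Set.indicator_of_mem hw1,
      ← lintegral_ball_scale (g := fun a => f (a, w)) (hf.comp (by fun_prop)) hc,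
      ← lintegral_indicator measurableSet_ball]
    refine lintegral_congr fun a => ?_
    have hiff : (a, w) ∈ ratHartogs m n ↔ a ∈ Metric.ball (0 : ℂ) (‖w‖ ^ ((n : ℝ) / m)) := by
      rw [mem_ball_zero_iff]
      rw [mem_ball_zero_iff] at hw1
      change (‖a‖ ^ m < ‖w‖ ^ n ∧ _) ↔ _
      rw [← rpow_div_pow (m := m) hw0.le hm, pow_lt_pow_iff_left₀ (norm_nonneg _) hc.le hm.ne']
      exact and_iff_left hw1
    by_cases ha : (a, w) ∈ ratHartogs m n
    · rw [Set.indicator_of_mem ha, Set.indicator_of_mem (hiff.1 ha)]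
    · rw [Set.indicator_of_notMem ha, Set.indicator_of_notMem (mt hiff.2 ha)]
  · rw [Set.indicator_of_notMem hw1, ← lintegral_zero (μ := (volume : Measure ℂ))]
    refine lintegral_congr fun a => Set.indicator_of_notMem (fun h => hw1 ?_) _
    exact mem_ball_zero_iff.2 h.2

theorem lintegral_ratHartogs_rpow (hm : 0 < m) {a b : ℝ} (ha : -2 < a) :
    ∫⁻ z in ratHartogs m n, ENNReal.ofReal (‖z.1‖ ^ a * ‖z.2‖ ^ b)
      = ENNReal.ofReal (2 * Real.pi / (a + 2))
        * ∫⁻ w in Metric.ball (0 : ℂ) 1, ENNReal.ofReal (‖w‖ ^ ((n : ℝ) / m * (a + 2) + b)) := by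
  rw [lintegral_ratHartogs hm (by fun_prop), ← lintegral_const_mul _ (by fun_prop)]
  refine lintegral_congr_ae (ae_restrict_of_ae ?_)
  have hne : ∀ᵐ w : ℂ, w ≠ 0 := by simp [ae_iff]
  filter_upwards [hne] with w hw
  have hw0 := norm_pos_iff.2 hw
  have hc : 0 < ‖w‖ ^ ((n : ℝ) / m) := Real.rpow_pos_of_pos hw0 _
  have e : ∀ ζ : ℂ, ENNReal.ofReal (‖(‖w‖ ^ ((n : ℝ) / m) : ℝ) * ζ‖ ^ a * ‖w‖ ^ b)
      = ENNReal.ofReal ((‖w‖ ^ ((n : ℝ) / m)) ^ a * ‖w‖ ^ b) * ENNReal.ofReal (‖ζ‖ ^ a) := fun ζ => by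
    rw [norm_mul, Complex.norm_real, Real.norm_of_nonneg hc.le,
      Real.mul_rpow hc.le (norm_nonneg _), ← ENNReal.ofReal_mul (by positivity)]
    congr 1
    ring
  simp only [e]
  rw [lintegral_const_mul _ (by fun_prop), setLIntegral_ball_rpow ha, ← mul_assoc,
    ← ENNReal.ofReal_mul (by positivity), mul_comm]
  congr 2
  rw [← Real.rpow_mul hw0.le, ← Real.rpow_natCast, ← Real.rpow_mul hw0.le, ← Real.rpow_add hw0,
    ← Real.rpow_add hw0]
  congr 1
  push_cast
  ring

end HartogsIntegral

/-! ### Which monomials are allowable, and their `L²` norms. -/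

section Allowable

variable {m n : ℕ}

theorem ofReal_norm_rpow_laurentMonomial {α : ℤ × ℤ} (R : ℝ) (z : ℂ × ℂ) (hR : 0 ≤ R) :
    ‖laurentMonomial α z‖ₑ ^ R
      = ENNReal.ofReal (‖z.1‖ ^ (R * α.1) * ‖z.2‖ ^ (R * α.2)) := by
  rw [← ofReal_norm, ENNReal.ofReal_rpow_of_nonneg (norm_nonneg _) hR,
    norm_laurentMonomial, Real.mul_rpow (by positivity) (by positivity), mul_comm R, mul_comm R,
    Real.rpow_mul (norm_nonneg _), Real.rpow_mul (norm_nonneg _), Real.rpow_intCast,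
    Real.rpow_intCast]

/-- In scaled coordinates the integral factors. The factor in `ζ` converges because `0 ≤ α₁`, so
integrability is decided by a power of `|w|` at the origin, whose exponent must exceed `-2`. -/
theorem memLp_laurentMonomial_iff (hm : 0 < m) {r : ℝ≥0∞} (hr1 : 1 ≤ r) (hr : r ≠ ∞)
    {α : ℤ × ℤ} (hα : 0 ≤ α.1) :
    MemLp (laurentMonomial α) r (volume.restrict (ratHartogs m n))
      ↔ -(2 * (m + n)) / r.toReal < n * α.1 + m * α.2 := by
  have hr0 : r ≠ 0 := (zero_lt_one.trans_le hr1).ne'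
  have hR : 0 < r.toReal := ENNReal.toReal_pos hr0 hr
  have hα' : (0 : ℝ) ≤ α.1 := by exact_mod_cast hα
  have hm' : (0 : ℝ) < m := by exact_mod_cast hm
  have hRα : 0 ≤ r.toReal * α.1 := by positivity
  have e1 : MemLp (laurentMonomial α) r (volume.restrict (ratHartogs m n))
      ↔ ∫⁻ z in ratHartogs m n, ‖laurentMonomial α z‖ₑ ^ r.toReal < ∞ := by
    rw [← eLpNorm_lt_top_iff_lintegral_rpow_enorm_lt_top hr0 hr]
    exact and_iff_right (measurable_laurentMonomial α).aestronglyMeasurable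
  have e2 : -(2 * (m + n)) / r.toReal < n * α.1 + m * α.2
      ↔ -2 < (n : ℝ) / m * (r.toReal * α.1 + 2) + r.toReal * α.2 := by
    have e3 : (n : ℝ) / m * (r.toReal * α.1 + 2) + r.toReal * α.2
        = (r.toReal * (n * α.1 + m * α.2) + 2 * n) / m := by field_simp; ring
    rw [e3, lt_div_iff₀ hm', div_lt_iff₀ hR]
    constructor <;> intro h <;> linarith
  rw [e1, e2]
  simp_rw [ofReal_norm_rpow_laurentMonomial _ _ hR.le]
  rw [lintegral_ratHartogs_rpow hm (by linarith)]
  constructor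
  · intro h
    by_contra hc
    rw [setLIntegral_ball_rpow_eq_top (not_lt.1 hc), ENNReal.mul_top] at h
    · exact lt_irrefl _ h
    · rw [Ne, ENNReal.ofReal_eq_zero, not_le]
      positivity
  · intro h
    rw [setLIntegral_ball_rpow h]
    exact ENNReal.mul_lt_top ENNReal.ofReal_lt_top ENNReal.ofReal_lt_top

/-- If `e_α` with `α₁ < 0` were holomorphic, its own `α`-th coefficient, which is `1`, would vanish
by `laurentCoeff_eq_zero`. -/
theorem differentiableOn_laurentMonomial_iff (hm : 0 < m) (hn : 0 < n) {α : ℤ × ℤ} :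
    DifferentiableOn ℂ (laurentMonomial α) (ratHartogs m n) ↔ 0 ≤ α.1 := by
  refine ⟨fun h => ?_, fun h z hz => (differentiableAt_laurentMonomial (Or.inr h)
    (snd_ne_zero_of_mem_ratHartogs hn hz)).differentiableWithinAt⟩
  by_contra hα
  have h1 := laurentCoeff_eq_zero hm hn h (not_le.1 hα)
  have hb := ratHartogsBase_mem (n := n) hm
  have e : ∀ t, laurentMonomial α (torusRot t (ratHartogsBase n))
      * laurentMonomial (-α) (torusRot t (ratHartogsBase n)) = 1 := fun t => by
    have ht := torusRot_mem_punctured hb t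
    rw [laurentMonomial_neg, mul_inv_cancel₀
      (laurentMonomial_ne_zero ht.2 (snd_ne_zero_of_mem_ratHartogs hn ht.1))]
  simp [laurentCoeff, torusMean, e] at h1

theorem mem_allowable_iff (hm : 0 < m) (hn : 0 < n) {r : ℝ≥0∞} (hr1 : 1 ≤ r) (hr : r ≠ ∞)
    {α : ℤ × ℤ} : α ∈ allowable (ratHartogs m n) r
      ↔ 0 ≤ α.1 ∧ -(2 * (m + n)) / r.toReal < n * α.1 + m * α.2 := by
  change (_ ∧ _) ↔ _
  rw [differentiableOn_laurentMonomial_iff hm hn]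
  exact and_congr_right fun h => memLp_laurentMonomial_iff hm hr1 hr h

/-- The square of the `L²` norm of the monomial `e_α`. -/
def monomialNormSq (m n : ℕ) (α : ℤ × ℤ) : ℝ :=
  Real.pi ^ 2 * m / ((α.1 + 1) * (n * α.1 + m * α.2 + m + n))

theorem lintegral_laurentMonomial_sq (hm : 0 < m) {α : ℤ × ℤ} (hα : 0 ≤ α.1)
    (hk : (0 : ℝ) < n * α.1 + m * α.2 + m + n) :
    ∫⁻ z in ratHartogs m n, ENNReal.ofReal (‖laurentMonomial α z‖ ^ 2)
      = ENNReal.ofReal (monomialNormSq m n α) := by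
  have hα' : (0 : ℝ) ≤ α.1 := by exact_mod_cast hα
  have hm' : (0 : ℝ) < m := by exact_mod_cast hm
  have e : ∀ z, ENNReal.ofReal (‖laurentMonomial α z‖ ^ 2)
      = ENNReal.ofReal (‖z.1‖ ^ (2 * α.1 : ℝ) * ‖z.2‖ ^ (2 * α.2 : ℝ)) := fun z => by
    rw [← ofReal_norm_rpow_laurentMonomial _ _ zero_le_two, ← ofReal_norm,
      ENNReal.ofReal_rpow_of_nonneg (norm_nonneg _) zero_le_two, Real.rpow_two]
  simp_rw [e]
  have h3 : (n : ℝ) / m * (2 * α.1 + 2) + 2 * α.2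
      = 2 * (n * α.1 + m * α.2 + m + n) / m - 2 := by field_simp; ring
  have h4 : 0 < 2 * ((n : ℝ) * α.1 + m * α.2 + m + n) / m := by positivity
  rw [lintegral_ratHartogs_rpow hm (by linarith), setLIntegral_ball_rpow (by linarith), h3,
    ← ENNReal.ofReal_mul (by positivity), monomialNormSq]
  congr 1
  have h5 : (α.1 : ℝ) + 1 ≠ 0 := by positivity
  have h6 : 2 * (α.1 : ℝ) + 2 ≠ 0 := by positivity
  field_simp
  ring

theorem monomialNormSq_pos (hm : 0 < m) {α : ℤ × ℤ} (hα : 0 ≤ α.1)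
    (hk : (0 : ℝ) < n * α.1 + m * α.2 + m + n) : 0 < monomialNormSq m n α := by
  have hα' : (0 : ℝ) ≤ α.1 := by exact_mod_cast hα
  have hm' : (0 : ℝ) < m := by exact_mod_cast hm
  rw [monomialNormSq]
  positivity

theorem integral_laurentMonomial_sq (hm : 0 < m) {α : ℤ × ℤ} (hα : 0 ≤ α.1)
    (hk : (0 : ℝ) < n * α.1 + m * α.2 + m + n) :
    ∫ z in ratHartogs m n, ‖laurentMonomial α z‖ ^ 2 = monomialNormSq m n α := by
  rw [integral_eq_lintegral_of_nonneg_ae (Filter.Eventually.of_forall fun z => by positivity)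
    ((measurable_laurentMonomial α).norm.pow_const 2).aestronglyMeasurable,
    lintegral_laurentMonomial_sq hm hα hk,
    ENNReal.toReal_ofReal (monomialNormSq_pos hm hα hk).le]

end Allowable

/-! ### Circle averages of the Poisson-type kernel. -/

section AngularAverage

theorem lintegral_toCircle_inv_norm_sq {x : ℂ} (hx : ‖x‖ < 1) :
    ∫⁻ t : UnitAddCircle, ENNReal.ofReal (1 / ‖1 - AddCircle.toCircle t * x‖ ^ 2)
      = ENNReal.ofReal (1 / (1 - ‖x‖ ^ 2)) := by
  rw [← integral_toCircle_inv_norm_sq hx, ofReal_integral_eq_lintegral_ofReal]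
  · refine Continuous.integrable_of_hasCompactSupport ?_ (HasCompactSupport.of_compactSpace _)
    have h : Continuous fun t : UnitAddCircle => ((AddCircle.toCircle t : Circle) : ℂ) :=
      continuous_subtype_val.comp AddCircle.continuous_toCircle
    refine Continuous.div continuous_const (by fun_prop) fun t h0 => ?_
    rw [sq_eq_zero_iff, norm_eq_zero, sub_eq_zero] at h0
    have h1 := norm_toCircle_mul t x
    rw [← h0, norm_one] at h1
    linarith
  · exact Filter.Eventually.of_forall fun t => by positivity

/-- Multiplication by a nonzero integer preserves the measure of the circle. -/
theorem lintegral_toCircle_zpow_inv_norm_sq {k : ℤ} (hk : k ≠ 0) {x : ℂ} (hx : ‖x‖ < 1) :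
    ∫⁻ t : UnitAddCircle, ENNReal.ofReal (1 / ‖1 - (AddCircle.toCircle t : ℂ) ^ k * x‖ ^ 2)
      = ENNReal.ofReal (1 / (1 - ‖x‖ ^ 2)) := by
  have hc : Continuous fun t : UnitAddCircle => ((AddCircle.toCircle t : Circle) : ℂ) :=
    continuous_subtype_val.comp AddCircle.continuous_toCircle
  have hm : Measurable fun t : UnitAddCircle =>
      ENNReal.ofReal (1 / ‖1 - AddCircle.toCircle t * x‖ ^ 2) := by
    have := hc.measurable
    fun_prop
  have h := (Measure.measurePreserving_zsmul (volume : Measure UnitAddCircle) hk).lintegral_comp hm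
  rw [← lintegral_toCircle_inv_norm_sq hx, ← h]
  simp [AddCircle.toCircle_zsmul]

end AngularAverage

/-! ### The dominating positive kernel and its Schur estimate. -/

section Kernel

variable {m n : ℕ}

/-- The function `z₁ ^ m / z₂ ^ n`, which maps `ratHartogs m n` to the unit disc. -/
def hartogsRatio (m n : ℕ) (z : ℂ × ℂ) : ℂ := z.1 ^ m / z.2 ^ n

/-- The size of the first coordinate relative to the section of `ratHartogs m n`. -/
def hartogsRadius (m n : ℕ) (z : ℂ × ℂ) : ℝ := ‖z.1‖ / ‖z.2‖ ^ ((n : ℝ) / m)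

theorem measurable_hartogsRatio : Measurable (hartogsRatio m n) := by
  unfold hartogsRatio; fun_prop

theorem measurable_hartogsRadius : Measurable (hartogsRadius m n) := by
  unfold hartogsRadius; fun_prop

theorem hartogsRadius_nonneg (z : ℂ × ℂ) : 0 ≤ hartogsRadius m n z := by
  unfold hartogsRadius; positivity

theorem hartogsRadius_pow (hm : 0 < m) (z : ℂ × ℂ) :
    hartogsRadius m n z ^ m = ‖hartogsRatio m n z‖ := by
  rw [hartogsRadius, hartogsRatio, div_pow, rpow_div_pow (norm_nonneg _) hm, norm_div, norm_pow,
    norm_pow]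

theorem norm_hartogsRatio_lt_one {z : ℂ × ℂ} (hz : z ∈ ratHartogs m n) :
    ‖hartogsRatio m n z‖ < 1 := by
  rw [hartogsRatio, norm_div, norm_pow, norm_pow, div_lt_one]
  · exact hz.1
  · exact (pow_nonneg (norm_nonneg _) m).trans_lt hz.1

theorem hartogsRadius_lt_one (hm : 0 < m) {z : ℂ × ℂ} (hz : z ∈ ratHartogs m n) :
    hartogsRadius m n z < 1 := by
  have h := norm_hartogsRatio_lt_one hz
  rw [← hartogsRadius_pow hm] at h
  exact (pow_lt_one_iff_of_nonneg (hartogsRadius_nonneg z) hm.ne').1 h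

theorem norm_hartogsRatio_le (hm : 0 < m) {z : ℂ × ℂ} (hz : z ∈ ratHartogs m n) :
    ‖hartogsRatio m n z‖ ≤ hartogsRadius m n z := by
  rw [← hartogsRadius_pow hm]
  exact pow_le_of_le_one (hartogsRadius_nonneg z) (hartogsRadius_lt_one hm hz).le hm.ne'

/-- The positive kernel that dominates the kernel of the projection onto the span of the
`L^p`-allowable monomials. -/
def hartogsKernel (m n : ℕ) (κ : ℝ) (z w : ℂ × ℂ) : ℝ :=
  ‖z.2‖ ^ κ * ‖w.2‖ ^ κ * (1 / ‖1 - hartogsRatio m n w * conj (hartogsRatio m n z)‖ ^ 2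
    * (1 / ‖1 - w.2 * conj z.2‖ ^ 2))

theorem hartogsKernel_comm (κ : ℝ) (z w : ℂ × ℂ) :
    hartogsKernel m n κ z w = hartogsKernel m n κ w z := by
  have h : ∀ a b : ℂ, ‖1 - a * conj b‖ = ‖1 - b * conj a‖ := fun a b => by
    rw [← Complex.norm_conj (1 - a * conj b)]
    simp [mul_comm]
  rw [hartogsKernel, hartogsKernel, h, h w.2, mul_comm (‖z.2‖ ^ κ)]

theorem measurable_hartogsKernel (κ : ℝ) :
    Measurable (Function.uncurry fun z w => hartogsKernel m n κ z w) := by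
  have h := measurable_hartogsRatio (m := m) (n := n)
  have h1 : Measurable fun x : (ℂ × ℂ) × (ℂ × ℂ) => hartogsRatio m n x.1 := h.comp measurable_fst
  have h2 : Measurable fun x : (ℂ × ℂ) × (ℂ × ℂ) => hartogsRatio m n x.2 := h.comp measurable_snd
  have h3 : Measurable (conj : ℂ → ℂ) := Complex.continuous_conj.measurable
  unfold hartogsKernel Function.uncurry
  fun_prop

theorem hartogsRatio_torusRot (t : UnitAddCircle × UnitAddCircle) (z : ℂ × ℂ) :
    hartogsRatio m n (torusRot t z) = (AddCircle.toCircle t.1 : ℂ) ^ (m : ℤ)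
      * ((AddCircle.toCircle t.2 : ℂ) ^ (-n : ℤ) * hartogsRatio m n z) := by
  simp only [hartogsRatio, torusRot_fst, torusRot_snd, mul_pow, zpow_natCast, zpow_neg]
  rw [mul_div_mul_comm]
  ring

/-- Integrate over `t₁` first: as `k ≠ 0`, the first factor averages to a value that no longer
depends on `t₂`, and the factors decouple. -/
theorem lintegral_torus_inv_norm_sq {k l : ℤ} (hk : k ≠ 0) {x y : ℂ} (hx : ‖x‖ < 1)
    (hy : ‖y‖ < 1) :
    ∫⁻ t : UnitAddCircle × UnitAddCircle, ENNReal.ofReal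
        (1 / ‖1 - (AddCircle.toCircle t.1 : ℂ) ^ k * ((AddCircle.toCircle t.2 : ℂ) ^ l * x)‖ ^ 2
          * (1 / ‖1 - AddCircle.toCircle t.2 * y‖ ^ 2))
      = ENNReal.ofReal (1 / (1 - ‖x‖ ^ 2) * (1 / (1 - ‖y‖ ^ 2))) := by
  have hc : Continuous fun t : UnitAddCircle => ((AddCircle.toCircle t : Circle) : ℂ) :=
    continuous_subtype_val.comp AddCircle.continuous_toCircle
  have hc1 : Measurable fun t : UnitAddCircle × UnitAddCircle => (AddCircle.toCircle t.1 : ℂ) :=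
    hc.measurable.comp measurable_fst
  have hc2 : Measurable fun t : UnitAddCircle × UnitAddCircle => (AddCircle.toCircle t.2 : ℂ) :=
    hc.measurable.comp measurable_snd
  have hx2 : 0 < 1 - ‖x‖ ^ 2 := by nlinarith [norm_nonneg x]
  rw [Measure.volume_eq_prod, lintegral_prod_symm _ (by fun_prop)]
  have e : ∀ t₂ : UnitAddCircle, ∫⁻ t₁ : UnitAddCircle, ENNReal.ofReal
        (1 / ‖1 - (AddCircle.toCircle t₁ : ℂ) ^ k * ((AddCircle.toCircle t₂ : ℂ) ^ l * x)‖ ^ 2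
          * (1 / ‖1 - AddCircle.toCircle t₂ * y‖ ^ 2))
      = ENNReal.ofReal (1 / (1 - ‖x‖ ^ 2))
        * ENNReal.ofReal (1 / ‖1 - AddCircle.toCircle t₂ * y‖ ^ 2) := fun t₂ => by
    have hn : ‖(AddCircle.toCircle t₂ : ℂ) ^ l * x‖ = ‖x‖ := by
      rw [norm_mul, norm_zpow, Circle.norm_coe, one_zpow, one_mul]
    have h1 := lintegral_toCircle_zpow_inv_norm_sq hk (x := (AddCircle.toCircle t₂ : ℂ) ^ l * x)
      (by rwa [hn])
    rw [hn] at h1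
    have hm := hc.measurable
    rw [← h1, ← lintegral_mul_const _ (by fun_prop)]
    exact lintegral_congr fun t₁ => ENNReal.ofReal_mul (by positivity)
  have hm := hc.measurable
  simp only [e]
  rw [lintegral_const_mul _ (by fun_prop), lintegral_toCircle_inv_norm_sq hy,
    ENNReal.ofReal_mul (by positivity)]

/-- Averaging over the angles lowers the quadratic singularities to first order. `hartogsRatio` is
then replaced by the larger `hartogsRadius`, which is the modulus of the scaled first coordinate. -/
theorem lintegral_torus_hartogsKernel (hm : 0 < m) (κ : ℝ) {z w : ℂ × ℂ}
    (hz : z ∈ ratHartogs m n) (hw : w ∈ ratHartogs m n) :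
    ∫⁻ t, ENNReal.ofReal (hartogsKernel m n κ z (torusRot t w))
      ≤ ENNReal.ofReal (‖z.2‖ ^ κ * ‖w.2‖ ^ κ
        * (1 / (1 - hartogsRadius m n z * hartogsRadius m n w) * (1 / (1 - ‖z.2‖ * ‖w.2‖)))) := by
  have hz1 := norm_hartogsRatio_lt_one hz
  have hw1 := norm_hartogsRatio_lt_one hw
  have hx : ‖hartogsRatio m n w * conj (hartogsRatio m n z)‖ < 1 := by
    rw [norm_mul, Complex.norm_conj]
    nlinarith [norm_nonneg (hartogsRatio m n w), norm_nonneg (hartogsRatio m n z)]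
  have hy : ‖w.2 * conj z.2‖ < 1 := by
    rw [norm_mul, Complex.norm_conj]
    nlinarith [norm_nonneg w.2, norm_nonneg z.2, hz.2, hw.2]
  have e : ∀ t, ENNReal.ofReal (hartogsKernel m n κ z (torusRot t w))
      = ENNReal.ofReal (‖z.2‖ ^ κ * ‖w.2‖ ^ κ) * ENNReal.ofReal
        (1 / ‖1 - (AddCircle.toCircle t.1 : ℂ) ^ (m : ℤ) * ((AddCircle.toCircle t.2 : ℂ) ^ (-n : ℤ)
          * (hartogsRatio m n w * conj (hartogsRatio m n z)))‖ ^ 2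
          * (1 / ‖1 - AddCircle.toCircle t.2 * (w.2 * conj z.2)‖ ^ 2)) := fun t => by
    rw [← ENNReal.ofReal_mul (by positivity), hartogsKernel, hartogsRatio_torusRot, torusRot_snd,
      norm_toCircle_mul]
    congr 7
    · ring
    · ring
  have hc : Continuous fun t : UnitAddCircle => ((AddCircle.toCircle t : Circle) : ℂ) :=
    continuous_subtype_val.comp AddCircle.continuous_toCircle
  have hc1 : Measurable fun t : UnitAddCircle × UnitAddCircle => (AddCircle.toCircle t.1 : ℂ) :=
    hc.measurable.comp measurable_fst
  have hc2 : Measurable fun t : UnitAddCircle × UnitAddCircle => (AddCircle.toCircle t.2 : ℂ) :=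
    hc.measurable.comp measurable_snd
  simp only [e]
  rw [lintegral_const_mul _ (by fun_prop),
    lintegral_torus_inv_norm_sq (by exact_mod_cast hm.ne') hx hy,
    ← ENNReal.ofReal_mul (by positivity)]
  refine ENNReal.ofReal_le_ofReal (mul_le_mul_of_nonneg_left ?_ (by positivity))
  have hz2 := hartogsRadius_lt_one hm hz
  have hw2 := hartogsRadius_lt_one hm hw
  have hz3 := norm_hartogsRatio_le hm hz
  have hw3 := norm_hartogsRatio_le hm hw
  have a0 := hartogsRadius_nonneg (m := m) (n := n) z
  have b0 := hartogsRadius_nonneg (m := m) (n := n) w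
  have h1 : hartogsRadius m n z * hartogsRadius m n w < 1 := by nlinarith
  have h2 : ‖z.2‖ * ‖w.2‖ < 1 := by nlinarith [norm_nonneg w.2, norm_nonneg z.2, hz.2, hw.2]
  have h3 : ‖hartogsRatio m n w * conj (hartogsRatio m n z)‖ ^ 2
      ≤ hartogsRadius m n z * hartogsRadius m n w := by
    refine (pow_le_of_le_one (norm_nonneg _) hx.le two_ne_zero).trans ?_
    rw [norm_mul, Complex.norm_conj, mul_comm]
    exact mul_le_mul hz3 hw3 (norm_nonneg _) a0
  have h4 : ‖w.2 * conj z.2‖ ^ 2 ≤ ‖z.2‖ * ‖w.2‖ := by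
    refine (pow_le_of_le_one (norm_nonneg _) hy.le two_ne_zero).trans ?_
    rw [norm_mul, Complex.norm_conj, mul_comm]
  have h5 : 0 < 1 - hartogsRadius m n z * hartogsRadius m n w := by linarith
  have h6 : 0 < 1 - ‖z.2‖ * ‖w.2‖ := by linarith
  have h7 : 0 < 1 - ‖w.2 * conj z.2‖ ^ 2 := by linarith
  gcongr

/-- The test function for Schur's test. -/
def schurWeight (m n : ℕ) (a b : ℝ) (z : ℂ × ℂ) : ℝ :=
  (1 - hartogsRadius m n z) ^ (-a) * (‖z.2‖ ^ (-b) * (1 - ‖z.2‖) ^ (-a))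

theorem measurable_schurWeight (a b : ℝ) : Measurable (schurWeight m n a b) := by
  have := measurable_hartogsRadius (m := m) (n := n)
  unfold schurWeight
  fun_prop

theorem schurWeight_rpow (hm : 0 < m) (a b σ : ℝ) {z : ℂ × ℂ} (hz : z ∈ ratHartogs m n) :
    schurWeight m n a b z ^ σ = schurWeight m n (a * σ) (b * σ) z := by
  have h1 : 0 ≤ 1 - hartogsRadius m n z := by linarith [hartogsRadius_lt_one hm hz]
  have h2 : 0 ≤ 1 - ‖z.2‖ := by linarith [hz.2]
  rw [schurWeight, Real.mul_rpow (by positivity) (by positivity),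
    Real.mul_rpow (by positivity) (by positivity), ← Real.rpow_mul h1, ← Real.rpow_mul h2,
    ← Real.rpow_mul (norm_nonneg _), neg_mul, neg_mul, schurWeight]

theorem schurWeight_pos (hm : 0 < m) (hn : 0 < n) (a b : ℝ) {z : ℂ × ℂ} (hz : z ∈ ratHartogs m n) :
    0 < schurWeight m n a b z := by
  have h1 : 0 < 1 - hartogsRadius m n z := by linarith [hartogsRadius_lt_one hm hz]
  have h2 : 0 < 1 - ‖z.2‖ := by linarith [hz.2]
  have h3 := norm_pos_iff.2 (snd_ne_zero_of_mem_ratHartogs hn hz)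
  unfold schurWeight
  positivity

theorem hartogsRadius_torusRot (t : UnitAddCircle × UnitAddCircle) (z : ℂ × ℂ) :
    hartogsRadius m n (torusRot t z) = hartogsRadius m n z := by
  simp only [hartogsRadius, torusRot_fst, torusRot_snd, norm_toCircle_mul]

theorem schurWeight_torusRot (a b : ℝ) (t : UnitAddCircle × UnitAddCircle) (z : ℂ × ℂ) :
    schurWeight m n a b (torusRot t z) = schurWeight m n a b z := by
  simp only [schurWeight, hartogsRadius_torusRot, torusRot_snd, norm_toCircle_mul]

/-- After the angular average the integral is bounded by a product of two disc integrals, each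
estimated by `exists_setLIntegral_ball_kernel_le`. The hypothesis `hb` is integrability at `w₂ = 0`,
and `hbκ` lets `|z₂|^κ` be absorbed into `|z₂|^(-b)`. -/
theorem exists_lintegral_kernel_schurWeight_le (hm : 0 < m) (hn : 0 < n) {κ a b : ℝ} (ha : 0 < a)
    (ha1 : a < 1) (hb : b - κ < 2 * n / m + 2) (hbκ : -b ≤ κ) :
    ∃ C : ℝ, ∀ z ∈ ratHartogs m n,
      ∫⁻ w in ratHartogs m n, ENNReal.ofReal (hartogsKernel m n κ z w)
          * ENNReal.ofReal (schurWeight m n a b w)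
        ≤ ENNReal.ofReal C * ENNReal.ofReal (schurWeight m n a b z) := by
  obtain ⟨C₁, hC₁, h₁⟩ := exists_setLIntegral_ball_kernel_le (a := 0) (δ := a) (by norm_num) ha ha1
  obtain ⟨C₂, hC₂, h₂⟩ := exists_setLIntegral_ball_kernel_le (a := 2 * n / m + κ - b) (δ := a)
    (by linarith) ha ha1
  refine ⟨C₁ * C₂, fun z hz => ?_⟩
  have hz0 := norm_pos_iff.2 (snd_ne_zero_of_mem_ratHartogs hn hz)
  set v := hartogsRadius m n z
  have hv0 : 0 ≤ v := hartogsRadius_nonneg z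
  have hv1 : v < 1 := hartogsRadius_lt_one hm hz
  have hmk : Measurable fun w => hartogsKernel m n κ z w :=
    (measurable_hartogsKernel κ).of_uncurry_left
  have hms := measurable_schurWeight (m := m) (n := n) a b
  have hmr := measurable_hartogsRadius (m := m) (n := n)
  rw [lintegral_eq_lintegral_torus measurePreserving_torusRot_restrict (by fun_prop)]
  simp only [schurWeight_torusRot]
  have hmt : ∀ w, Measurable fun t => ENNReal.ofReal (hartogsKernel m n κ z (torusRot t w)) :=
    fun w => (hmk.comp (continuous_torusRot_left w).measurable).ennreal_ofReal
  have e1 : ∀ w ∈ ratHartogs m n,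
      ∫⁻ t, ENNReal.ofReal (hartogsKernel m n κ z (torusRot t w))
        * ENNReal.ofReal (schurWeight m n a b w)
      ≤ ENNReal.ofReal (‖z.2‖ ^ κ) * (ENNReal.ofReal (‖w.2‖ ^ (κ - b) * (1 - ‖w.2‖) ^ (-a)
          / (1 - ‖z.2‖ * ‖w.2‖))
        * ENNReal.ofReal ((1 - hartogsRadius m n w) ^ (-a) / (1 - v * hartogsRadius m n w))) :=
    fun w hw => by
    have hw0 := norm_pos_iff.2 (snd_ne_zero_of_mem_ratHartogs hn hw)
    have hw1 : 0 < 1 - hartogsRadius m n w := by linarith [hartogsRadius_lt_one hm hw]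
    have hw2 : 0 < 1 - ‖w.2‖ := by linarith [hw.2]
    have h2 : 0 < 1 - ‖z.2‖ * ‖w.2‖ := by nlinarith [hz.2, hw.2]
    rw [lintegral_mul_const _ (hmt w)]
    refine (mul_le_mul_left (lintegral_torus_hartogsKernel hm κ hz hw) _).trans ?_
    have h3 : 0 < 1 - v * hartogsRadius m n w := by
      nlinarith [hartogsRadius_nonneg (m := m) (n := n) w]
    rw [← ENNReal.ofReal_mul (by positivity), ← ENNReal.ofReal_mul (by positivity),
      ← ENNReal.ofReal_mul (by positivity)]
    refine ENNReal.ofReal_le_ofReal (le_of_eq ?_)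
    rw [schurWeight, sub_eq_add_neg κ b, Real.rpow_add hw0]
    ring
  refine (setLIntegral_mono' measurableSet_ratHartogs e1).trans ?_
  rw [lintegral_const_mul _ (by fun_prop), lintegral_ratHartogs hm (by fun_prop)]
  have e2 : ∀ᵐ w : ℂ ∂volume.restrict (Metric.ball 0 1),
      ENNReal.ofReal ((‖w‖ ^ ((n : ℝ) / m)) ^ 2) * ∫⁻ ζ in Metric.ball (0 : ℂ) 1,
        (ENNReal.ofReal (‖w‖ ^ (κ - b) * (1 - ‖w‖) ^ (-a) / (1 - ‖z.2‖ * ‖w‖))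
        * ENNReal.ofReal
          ((1 - hartogsRadius m n ((‖w‖ ^ ((n : ℝ) / m) : ℝ) * ζ, w)) ^ (-a)
            / (1 - v * hartogsRadius m n ((‖w‖ ^ ((n : ℝ) / m) : ℝ) * ζ, w))))
      ≤ ENNReal.ofReal (‖w‖ ^ (2 * n / m + κ - b) * (1 - ‖w‖) ^ (-a) / (1 - ‖z.2‖ * ‖w‖))
        * ENNReal.ofReal (C₁ * (1 - v) ^ (-a)) := by
    have hne : ∀ᵐ w : ℂ, w ≠ 0 := by simp [ae_iff]
    filter_upwards [ae_restrict_of_ae hne, ae_restrict_mem measurableSet_ball] with w hw hw1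
    have hw0 := norm_pos_iff.2 hw
    rw [mem_ball_zero_iff] at hw1
    have hc : 0 < ‖w‖ ^ ((n : ℝ) / m) := Real.rpow_pos_of_pos hw0 _
    have hw2 : 0 < 1 - ‖w‖ := by linarith
    have hzw : 0 < 1 - ‖z.2‖ * ‖w‖ := by nlinarith [hz.2]
    have e3 : ∀ ζ : ℂ, hartogsRadius m n ((‖w‖ ^ ((n : ℝ) / m) : ℝ) * ζ, w) = ‖ζ‖ := fun ζ => by
      rw [hartogsRadius, norm_mul, Complex.norm_real, Real.norm_of_nonneg hc.le,
        mul_div_cancel_left₀ _ hc.ne']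
    simp only [e3]
    rw [lintegral_const_mul _ (by fun_prop), ← mul_assoc, ← ENNReal.ofReal_mul (by positivity)]
    have h4 := h₁ v hv0 hv1
    simp only [Real.rpow_zero, one_mul] at h4
    refine mul_le_mul' (le_of_eq ?_) h4
    congr 1
    rw [← Real.rpow_natCast, ← Real.rpow_mul hw0.le,
      show 2 * (n : ℝ) / m + κ - b = (n : ℝ) / m * (2 : ℕ) + (κ - b) by push_cast; ring,
      Real.rpow_add hw0]
    ring
  refine (mul_le_mul_right (lintegral_mono_ae e2) _).trans ?_
  rw [lintegral_mul_const _ (by fun_prop)]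
  refine (mul_le_mul_right (mul_le_mul_left (h₂ ‖z.2‖ hz0.le hz.2) _) _).trans ?_
  have hv2 : 0 < 1 - v := by linarith
  have hz2 : 0 < 1 - ‖z.2‖ := by linarith [hz.2]
  rw [← ENNReal.ofReal_mul (by positivity), ← ENNReal.ofReal_mul (by positivity),
    ← ENNReal.ofReal_mul (by positivity)]
  refine ENNReal.ofReal_le_ofReal ?_
  have h5 : ‖z.2‖ ^ κ ≤ ‖z.2‖ ^ (-b) := Real.rpow_le_rpow_of_exponent_ge hz0 hz.2.le hbκ
  have h6 : 0 ≤ C₁ * C₂ * (1 - v) ^ (-a) * (1 - ‖z.2‖) ^ (-a) := by positivity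
  calc _ = ‖z.2‖ ^ κ * (C₁ * C₂ * (1 - v) ^ (-a) * (1 - ‖z.2‖) ^ (-a)) := by ring
    _ ≤ ‖z.2‖ ^ (-b) * (C₁ * C₂ * (1 - v) ^ (-a) * (1 - ‖z.2‖) ^ (-a)) := by gcongr
    _ = _ := by rw [schurWeight]; ring

/-- The integral operator with kernel `hartogsKernel` is bounded on `L^p` and on `L^q`. -/
theorem exists_lintegral_hartogsKernel_rpow_le (hm : 0 < m) (hn : 0 < n) {P Q κ : ℝ}
    (hPQ : P.HolderConjugate Q) (hP : 2 ≤ P) (hκ0 : κ ≤ 0) (hκ : -(2 * n / m + 2) < κ * P) :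
    ∃ C : ℝ≥0∞, C ≠ ∞ ∧ ∀ R : ℝ, R = P ∨ R = Q → ∀ f : ℂ × ℂ → ℝ≥0∞, Measurable f →
      ∫⁻ z in ratHartogs m n, (∫⁻ w in ratHartogs m n,
          ENNReal.ofReal (hartogsKernel m n κ z w) * f w) ^ R
        ≤ C * ∫⁻ z in ratHartogs m n, f z ^ R := by
  have hP0 : 0 < P := hPQ.pos
  have hQ0 : 0 < Q := hPQ.symm.pos
  have hQP : Q ≤ P := by
    have := hPQ.mul_eq_add
    nlinarith
  -- `ε` makes both `εP` and `εQ` less than one. The choice of `b` gives equality in `-bQ ≤ κ`, and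
  -- turns `bP - κ < 2n/m + 2` into the hypothesis `hκ`.
  set ε := 1 / (2 * P)
  set b := -κ / Q
  have hε : 0 < ε := by positivity
  have hεP : ε * P = 1 / 2 := by simp only [ε]; field_simp
  have hεQ : ε * Q < 1 := by nlinarith
  have hbQ : b * Q = -κ := by simp only [b]; field_simp
  have hbP : b * P = -κ * (P - 1) := by
    have h1 : P = Q * (P - 1) := by linarith [hPQ.mul_eq_add]
    calc b * P = b * Q * (P - 1) := by rw [mul_assoc, ← h1]
      _ = _ := by rw [hbQ]
  have hκP : κ * P ≤ κ * 2 := mul_le_mul_of_nonpos_left hP hκ0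
  obtain ⟨C₁, h₁⟩ := exists_lintegral_kernel_schurWeight_le hm hn (κ := κ) (a := ε * P)
    (b := b * P) (by positivity) (by rw [hεP]; norm_num) (by rw [hbP]; nlinarith)
    (by rw [hbP]; nlinarith)
  obtain ⟨C₂, h₂⟩ := exists_lintegral_kernel_schurWeight_le hm hn (κ := κ) (a := ε * Q)
    (b := b * Q) (by positivity) hεQ (by rw [hbQ]; nlinarith) (by rw [hbQ]; linarith)
  set C := max (ENNReal.ofReal C₁) (ENNReal.ofReal C₂)
  have hC : C ≠ ∞ := (max_lt ENNReal.ofReal_lt_top ENNReal.ofReal_lt_top).ne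
  have hk : Measurable (Function.uncurry fun z w => ENNReal.ofReal (hartogsKernel m n κ z w)) :=
    (measurable_hartogsKernel κ).ennreal_ofReal
  have hh : Measurable fun z => ENNReal.ofReal (schurWeight m n ε b z) :=
    (measurable_schurWeight ε b).ennreal_ofReal
  have hpos : ∀ᵐ z ∂volume.restrict (ratHartogs m n), ENNReal.ofReal (schurWeight m n ε b z) ≠ 0
      ∧ ENNReal.ofReal (schurWeight m n ε b z) ≠ ∞ := by
    filter_upwards [ae_restrict_mem measurableSet_ratHartogs] with z hz
    exact ⟨(ENNReal.ofReal_pos.2 (schurWeight_pos hm hn ε b hz)).ne', ENNReal.ofReal_ne_top⟩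
  have hw : ∀ σ, ∀ z ∈ ratHartogs m n, ENNReal.ofReal (schurWeight m n ε b z) ^ σ
      = ENNReal.ofReal (schurWeight m n (ε * σ) (b * σ) z) := fun σ z hz => by
    rw [ENNReal.ofReal_rpow_of_pos (schurWeight_pos hm hn ε b hz), schurWeight_rpow hm _ _ _ hz]
  have key : ∀ σ, σ = P ∨ σ = Q → ∀ z ∈ ratHartogs m n,
      ∫⁻ w in ratHartogs m n, ENNReal.ofReal (hartogsKernel m n κ z w)
          * ENNReal.ofReal (schurWeight m n ε b w) ^ σ
        ≤ C * ENNReal.ofReal (schurWeight m n ε b z) ^ σ := fun σ hσ z hz => by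
    have e : ∀ w ∈ ratHartogs m n, ENNReal.ofReal (hartogsKernel m n κ z w)
          * ENNReal.ofReal (schurWeight m n ε b w) ^ σ
        = ENNReal.ofReal (hartogsKernel m n κ z w)
          * ENNReal.ofReal (schurWeight m n (ε * σ) (b * σ) w) := fun w hw' => by rw [hw σ w hw']
    rw [hw σ z hz, setLIntegral_congr_fun measurableSet_ratHartogs e]
    rcases hσ with rfl | rfl
    · exact (h₁ z hz).trans (mul_le_mul_left (le_max_left _ _) _)
    · exact (h₂ z hz).trans (mul_le_mul_left (le_max_right _ _) _)
  have hP' : ∀ σ, σ = P ∨ σ = Q → ∀ᵐ z ∂volume.restrict (ratHartogs m n),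
      ∫⁻ w in ratHartogs m n, ENNReal.ofReal (hartogsKernel m n κ z w)
          * ENNReal.ofReal (schurWeight m n ε b w) ^ σ
        ≤ C * ENNReal.ofReal (schurWeight m n ε b z) ^ σ := fun σ hσ => by
    filter_upwards [ae_restrict_mem measurableSet_ratHartogs] with z hz using key σ hσ z hz
  -- The kernel is symmetric, so one family of estimates supplies both Schur conditions, for either
  -- ordering of the exponents.
  have hP'' : ∀ σ, σ = P ∨ σ = Q → ∀ᵐ w ∂volume.restrict (ratHartogs m n),
      ∫⁻ z in ratHartogs m n, ENNReal.ofReal (hartogsKernel m n κ z w)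
          * ENNReal.ofReal (schurWeight m n ε b z) ^ σ
        ≤ C * ENNReal.ofReal (schurWeight m n ε b w) ^ σ := fun σ hσ => by
    simp only [fun z w => hartogsKernel_comm (m := m) (n := n) κ z w]
    exact hP' σ hσ
  refine ⟨max (C ^ (P / Q) * C) (C ^ (Q / P) * C), (max_lt ?_ ?_).ne, ?_⟩
  · exact ENNReal.mul_lt_top (ENNReal.rpow_lt_top_of_nonneg (by positivity) hC) hC.lt_top
  · exact ENNReal.mul_lt_top (ENNReal.rpow_lt_top_of_nonneg (by positivity) hC) hC.lt_top
  · rintro R (rfl | rfl) f hf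
    · exact (lintegral_kernel_rpow_le hPQ hk hh hpos (hP' _ (Or.inr rfl)) (hP'' _ (Or.inl rfl))
        hf).trans (mul_le_mul_left (le_max_left _ _) _)
    · exact (lintegral_kernel_rpow_le hPQ.symm hk hh hpos (hP' _ (Or.inl rfl)) (hP'' _ (Or.inr rfl))
        hf).trans (mul_le_mul_left (le_max_right _ _) _)

end Kernel

/-! ### Arithmetico-geometric series. -/

section ArithGeo

/-- The sum of the arithmetico-geometric series `∑ (a + b i) X ^ i`. -/
def arithGeo (a b : ℝ) (X : ℂ) : ℂ := a / (1 - X) + b * (X / (1 - X) ^ 2)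

theorem summable_norm_arithGeo (a b : ℝ) {X : ℂ} (hX : ‖X‖ < 1) :
    Summable fun i : ℕ => ‖((a + b * i : ℝ) : ℂ) * X ^ i‖ := by
  have h1 : Summable fun i : ℕ => |a| * ‖X‖ ^ i :=
    (summable_geometric_of_lt_one (norm_nonneg _) hX).mul_left _
  have h0 : Summable fun i : ℕ => (i : ℝ) * ‖X‖ ^ i :=
    (hasSum_coe_mul_geometric_of_norm_lt_one (r := ‖X‖) (by rwa [norm_norm])).summable
  have h2 : Summable fun i : ℕ => |b| * ((i : ℝ) * ‖X‖ ^ i) := h0.mul_left _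
  have h3 : ∀ i : ℕ, ‖((a + b * i : ℝ) : ℂ) * X ^ i‖
      ≤ |a| * ‖X‖ ^ i + |b| * ((i : ℝ) * ‖X‖ ^ i) := fun i => by
    rw [norm_mul, norm_pow, Complex.norm_real, Real.norm_eq_abs, ← mul_assoc, ← add_mul]
    refine mul_le_mul_of_nonneg_right ((abs_add_le _ _).trans_eq ?_) (by positivity)
    rw [abs_mul, Nat.abs_cast]
  exact (h1.add h2).of_nonneg_of_le (fun i => norm_nonneg _) h3

theorem hasSum_arithGeo (a b : ℝ) {X : ℂ} (hX : ‖X‖ < 1) :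
    HasSum (fun i : ℕ => ((a + b * i : ℝ) : ℂ) * X ^ i) (arithGeo a b X) := by
  have h1 := (hasSum_geometric_of_norm_lt_one hX).mul_left (a : ℂ)
  have h2 := (hasSum_coe_mul_geometric_of_norm_lt_one hX).mul_left (b : ℂ)
  have h := h1.add h2
  rw [← div_eq_mul_inv] at h
  refine h.congr_fun fun i => ?_
  push_cast
  ring

theorem hasSum_mul_of_summable_norm {f g : ℕ → ℂ} {s t : ℂ} (hf : HasSum f s) (hg : HasSum g t)
    (hf' : Summable fun i => ‖f i‖) (hg' : Summable fun i => ‖g i‖) :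
    HasSum (fun y : ℕ × ℕ => f y.1 * g y.2) (s * t) :=
  hf.mul hg (summable_mul_of_summable_norm hf' hg')

theorem hasSum_arithGeo_mul (a b a' b' : ℝ) {X T : ℂ} (hX : ‖X‖ < 1) (hT : ‖T‖ < 1) :
    HasSum (fun y : ℕ × ℕ => (((a + b * y.1 : ℝ) : ℂ) * X ^ y.1)
      * (((a' + b' * y.2 : ℝ) : ℂ) * T ^ y.2)) (arithGeo a b X * arithGeo a' b' T) :=
  hasSum_mul_of_summable_norm (f := fun i : ℕ => ((a + b * i : ℝ) : ℂ) * X ^ i)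
    (g := fun i : ℕ => ((a' + b' * i : ℝ) : ℂ) * T ^ i) (hasSum_arithGeo a b hX)
    (hasSum_arithGeo a' b' hT) (summable_norm_arithGeo a b hX) (summable_norm_arithGeo a' b' hT)

/-- Over a common denominator the sum is `(a (1 - X) + b X) / (1 - X)²`, and `|1 - X| ≤ 2`. -/
theorem norm_arithGeo_le {a b : ℝ} (ha : 0 ≤ a) (hb : 0 ≤ b) {X : ℂ} (hX : ‖X‖ < 1) :
    ‖arithGeo a b X‖ ≤ (2 * a + b) * (1 / ‖1 - X‖ ^ 2) := by
  have hne : 1 - X ≠ 0 := fun h => by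
    rw [sub_eq_zero] at h
    rw [← h, norm_one] at hX
    exact lt_irrefl _ hX
  have e : arithGeo a b X = (a * (1 - X) + b * X) / (1 - X) ^ 2 := by
    rw [arithGeo]; field_simp
  rw [e, norm_div, norm_pow, mul_one_div]
  refine div_le_div_of_nonneg_right ((norm_add_le _ _).trans ?_) (by positivity)
  rw [norm_mul, norm_mul, Complex.norm_real, Complex.norm_real, Real.norm_of_nonneg ha,
    Real.norm_of_nonneg hb]
  have h1 : ‖1 - X‖ ≤ 2 := (norm_sub_le _ _).trans (by rw [norm_one]; linarith)
  nlinarith [mul_le_mul_of_nonneg_left h1 ha, mul_le_mul_of_nonneg_left hX.le hb]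

theorem conj_arithGeo (a b : ℝ) (X : ℂ) : conj (arithGeo a b X) = arithGeo a b (conj X) := by
  simp [arithGeo]

end ArithGeo

/-! ### Allowable multi-indices sorted by the residue of `α₁` mod `m`. -/

section Index

variable {m n : ℕ}

/-- The least `b` for which `n j + m b` exceeds `c`. -/
def leastExponent (m n : ℕ) (c : ℝ) (j : Fin m) : ℤ := ⌊(c - n * (j : ℕ)) / m⌋ + 1

theorem leastExponent_le_iff {c : ℝ} {j : Fin m} {b : ℤ} :
    leastExponent m n c j ≤ b ↔ c < n * (j : ℕ) + m * b := by
  have hm : (0 : ℝ) < m := by exact_mod_cast j.pos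
  rw [leastExponent, Int.add_one_le_iff, Int.floor_lt, div_lt_iff₀ hm]
  constructor <;> intro h <;> linarith

/-- A parametrization of the multi-indices `α` with `0 ≤ α₁` and `c < n α₁ + m α₂`. -/
def residueIndex (m n : ℕ) (c : ℝ) (x : Fin m × ℕ × ℕ) : ℤ × ℤ :=
  ((x.1 : ℕ) + m * x.2.1, leastExponent m n c x.1 + x.2.2 - n * x.2.1)

theorem residueIndex_injective (c : ℝ) : Function.Injective (residueIndex m n c) := by
  rintro ⟨j, i, l⟩ ⟨j', i', l'⟩ h
  simp only [residueIndex, Prod.mk.injEq] at h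
  obtain ⟨h1, h2⟩ := h
  have h3 : (j : ℕ) + m * i = j' + m * i' := by exact_mod_cast h1
  have h4 : (j : ℕ) = j' := by
    have := congrArg (· % m) h3
    simpa [Nat.mod_eq_of_lt j.2, Nat.mod_eq_of_lt j'.2] using this
  have h5 : j = j' := Fin.ext h4
  subst h5
  have h6 : i = i' := by
    have := Nat.add_left_cancel h3
    exact Nat.eq_of_mul_eq_mul_left j.pos this
  subst h6
  simp at h2
  simp [h2]

theorem weight_residueIndex (c : ℝ) (x : Fin m × ℕ × ℕ) :
    (n : ℝ) * (residueIndex m n c x).1 + m * (residueIndex m n c x).2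
      = n * (x.1 : ℕ) + m * leastExponent m n c x.1 + m * x.2.2 := by
  simp only [residueIndex]
  push_cast
  ring

theorem lt_leastExponent (c : ℝ) (j : Fin m) : c < n * (j : ℕ) + m * leastExponent m n c j :=
  leastExponent_le_iff.1 le_rfl

/-- Write `α₁ = j + m i`. Then `n α₁ + m α₂ = n j + m (α₂ + n i)`, so the inequality says that `α₂ +
n i` is at least the least exponent of the class `j`. -/
theorem mem_range_residueIndex (hm : 0 < m) {c : ℝ} {α : ℤ × ℤ} :
    α ∈ Set.range (residueIndex m n c) ↔ 0 ≤ α.1 ∧ c < n * α.1 + m * α.2 := by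
  constructor
  · rintro ⟨x, rfl⟩
    refine ⟨by simp only [residueIndex]; positivity, ?_⟩
    rw [weight_residueIndex]
    have h1 := lt_leastExponent (n := n) c x.1
    have h2 : (0 : ℝ) ≤ m * x.2.2 := by positivity
    linarith
  · rintro ⟨h1, h2⟩
    obtain ⟨a, ha⟩ := Int.eq_ofNat_of_zero_le h1
    set j : Fin m := ⟨a % m, Nat.mod_lt _ hm⟩
    have hj : (j : ℕ) + m * (a / m) = a := Nat.mod_add_div a m
    have hj' : ((j : ℕ) : ℤ) + m * ((a / m : ℕ) : ℤ) = a := by exact_mod_cast hj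
    have hj'' : ((j : ℕ) : ℝ) + m * ((a / m : ℕ) : ℝ) = a := by exact_mod_cast hj
    have h3 : leastExponent m n c j ≤ α.2 + n * (a / m : ℕ) := by
      rw [leastExponent_le_iff]
      refine h2.trans_eq ?_
      rw [ha]
      simp only [Int.cast_add, Int.cast_mul, Int.cast_natCast]
      rw [← hj'']
      ring
    obtain ⟨l, hl⟩ := Int.eq_ofNat_of_zero_le (sub_nonneg.2 h3)
    refine ⟨(j, a / m, l), Prod.ext ?_ ?_⟩
    · simp only [residueIndex]
      rw [hj', ha]
    · simp only [residueIndex]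
      have : (l : ℤ) = α.2 + n * (a / m : ℕ) - leastExponent m n c j := hl.symm
      rw [this]
      ring

/-- Within one residue class every monomial is a fixed leading monomial times a power of `z₁^m /
z₂^n` times a power of `z₂`. The kernel thus becomes a finite sum of double power series. -/
theorem laurentMonomial_residueIndex (c : ℝ) (x : Fin m × ℕ × ℕ) {z : ℂ × ℂ} (hz : z.2 ≠ 0) :
    laurentMonomial (residueIndex m n c x) z
      = laurentMonomial ((x.1 : ℕ), leastExponent m n c x.1) z
        * (hartogsRatio m n z ^ x.2.1 * z.2 ^ x.2.2) := by
  simp only [laurentMonomial, residueIndex, hartogsRatio]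
  rw [zpow_sub₀ hz, zpow_add₀ hz, div_pow, ← pow_mul, ← pow_mul]
  have h1 : z.1 ^ (((x.1 : ℕ) : ℤ) + m * x.2.1) = z.1 ^ (x.1 : ℕ) * z.1 ^ (m * x.2.1) := by
    rw [← pow_add, ← zpow_natCast]
    push_cast
    rfl
  have h2 : z.2 ^ ((n : ℤ) * x.2.1) = z.2 ^ (n * x.2.1) := by
    rw [← zpow_natCast]
    push_cast
    rfl
  rw [h1, h2, zpow_natCast, zpow_natCast]
  ring

/-- The exponent occurring in the norm of the monomials of a residue class. -/
def residueWeight (m n : ℕ) (c : ℝ) (j : Fin m) : ℝ :=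
  n * (j : ℕ) + m * leastExponent m n c j + m + n

theorem residueWeight_pos {c : ℝ} (hc : -(m + n) ≤ c) (j : Fin m) : 0 < residueWeight m n c j := by
  have := lt_leastExponent (n := n) c j
  rw [residueWeight]
  linarith

/-- The reciprocal norm separates into a factor affine in one index and a factor affine in the
other. The kernel series are therefore products of arithmetico-geometric ones. -/
theorem inv_monomialNormSq_residueIndex (c : ℝ) (x : Fin m × ℕ × ℕ) :
    (monomialNormSq m n (residueIndex m n c x))⁻¹
      = ((x.1 : ℕ) + 1 + m * x.2.1) * (residueWeight m n c x.1 + m * x.2.2) / (Real.pi ^ 2 * m) := by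
  rw [monomialNormSq, inv_div, weight_residueIndex, residueWeight]
  simp only [residueIndex]
  push_cast
  congr 1
  ring

end Index

/-! ### The reproducing kernel in closed form. -/

section ProjKernel

variable {m n : ℕ}

theorem summable_residue_bound {c : ℝ} (hc : -(m + n) ≤ c) {θ : ℝ} (h0 : 0 ≤ θ) (h1 : θ < 1) :
    Summable fun x : Fin m × ℕ × ℕ =>
      (monomialNormSq m n (residueIndex m n c x))⁻¹ * (θ ^ x.2.1 * θ ^ x.2.2) := by
  have hX : ‖(θ : ℂ)‖ < 1 := by rwa [Complex.norm_real, Real.norm_of_nonneg h0]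
  have hS : ∀ a b : ℝ, 0 ≤ a → 0 ≤ b → Summable fun i : ℕ => (a + b * i) * θ ^ i :=
    fun a b ha hb => (summable_norm_arithGeo a b hX).congr fun i => by
      rw [norm_mul, norm_pow, Complex.norm_real, Complex.norm_real, Real.norm_of_nonneg h0,
        Real.norm_of_nonneg (by positivity)]
  have hj : ∀ j : Fin m, Summable fun y : ℕ × ℕ =>
      (monomialNormSq m n (residueIndex m n c (j, y)))⁻¹ * (θ ^ y.1 * θ ^ y.2) := fun j => by
    have hq := residueWeight_pos hc j
    have h2 := ((hS ((j : ℕ) + 1) m (by positivity) (by positivity)).mul_of_nonneg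
      (hS (residueWeight m n c j) m hq.le (by positivity)) (fun i => by positivity)
      (fun i => by positivity)).div_const (Real.pi ^ 2 * m)
    refine h2.congr fun y => ?_
    rw [inv_monomialNormSq_residueIndex]
    ring
  refine (summable_prod_of_nonneg fun x => ?_).2 ⟨hj, (hasSum_fintype _).summable⟩
  have hq := residueWeight_pos hc x.1
  simp only [Pi.zero_apply]
  rw [inv_monomialNormSq_residueIndex]
  positivity

/-- The reproducing kernel of the span of the monomials `e_α` with `0 ≤ α₁`, `c < n α₁ + m α₂`. -/
def projKernel (m n : ℕ) (c : ℝ) (z w : ℂ × ℂ) : ℂ :=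
  ∑ j : Fin m, laurentMonomial ((j : ℕ), leastExponent m n c j) z
    * conj (laurentMonomial ((j : ℕ), leastExponent m n c j) w)
    * (arithGeo ((j : ℕ) + 1) m (hartogsRatio m n z * conj (hartogsRatio m n w))
      * arithGeo (residueWeight m n c j) m (z.2 * conj w.2) / (Real.pi ^ 2 * m : ℝ))

/-- Hermitian symmetry, from which the two projections are adjoint. -/
theorem conj_projKernel (c : ℝ) (z w : ℂ × ℂ) :
    conj (projKernel m n c z w) = projKernel m n c w z := by
  simp only [projKernel, map_sum, map_mul, map_div₀, conj_arithGeo, Complex.conj_conj,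
    Complex.conj_ofReal]
  refine Finset.sum_congr rfl fun j _ => ?_
  rw [mul_comm (conj (hartogsRatio m n z)), mul_comm (conj z.2),
    mul_comm (conj (laurentMonomial _ z))]

theorem measurable_projKernel (c : ℝ) :
    Measurable (Function.uncurry fun z w => projKernel m n c z w) := by
  have h1 : Measurable fun x : (ℂ × ℂ) × (ℂ × ℂ) => hartogsRatio m n x.1 :=
    measurable_hartogsRatio.comp measurable_fst
  have h2 : Measurable fun x : (ℂ × ℂ) × (ℂ × ℂ) => hartogsRatio m n x.2 :=
    measurable_hartogsRatio.comp measurable_snd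
  have h3 : Measurable (conj : ℂ → ℂ) := Complex.continuous_conj.measurable
  have h4 : ∀ α, Measurable fun x : (ℂ × ℂ) × (ℂ × ℂ) => laurentMonomial α x.1 := fun α =>
    (measurable_laurentMonomial α).comp measurable_fst
  have h5 : ∀ α, Measurable fun x : (ℂ × ℂ) × (ℂ × ℂ) => laurentMonomial α x.2 := fun α =>
    (measurable_laurentMonomial α).comp measurable_snd
  unfold projKernel Function.uncurry arithGeo
  fun_prop

theorem norm_mul_conj_lt_one {a b : ℂ} (ha : ‖a‖ < 1) (hb : ‖b‖ < 1) : ‖a * conj b‖ < 1 := by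
  rw [norm_mul, Complex.norm_conj]
  nlinarith [norm_nonneg a, norm_nonneg b]

/-- On the domain `|z₁| ≤ |z₂|^(n/m)`, so the monomial is at most a power of `|z₂|`. As `|z₂| < 1`,
lowering the exponent only increases it. -/
theorem norm_laurentMonomial_le_rpow (hm : 0 < m) (hn : 0 < n) {κ : ℝ} {j : ℕ} {b : ℤ}
    (h : m * κ ≤ n * j + m * b) {z : ℂ × ℂ} (hz : z ∈ ratHartogs m n) :
    ‖laurentMonomial (j, b) z‖ ≤ ‖z.2‖ ^ κ := by
  have hz0 := norm_pos_iff.2 (snd_ne_zero_of_mem_ratHartogs hn hz)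
  have hm' : (0 : ℝ) < m := by exact_mod_cast hm
  have h1 : ‖z.1‖ ≤ ‖z.2‖ ^ ((n : ℝ) / m) := by
    have := (hartogsRadius_lt_one hm hz).le
    rwa [hartogsRadius, div_le_one (by positivity)] at this
  rw [norm_laurentMonomial]
  calc ‖z.1‖ ^ (j : ℤ) * ‖z.2‖ ^ b ≤ (‖z.2‖ ^ ((n : ℝ) / m)) ^ j * ‖z.2‖ ^ b := by
        rw [zpow_natCast]; gcongr
    _ = ‖z.2‖ ^ ((n : ℝ) / m * j + b) := by
        rw [Real.rpow_add hz0, Real.rpow_mul hz0.le, Real.rpow_natCast, Real.rpow_intCast]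
    _ ≤ ‖z.2‖ ^ κ := by
        refine Real.rpow_le_rpow_of_exponent_ge hz0 hz.2.le ?_
        have e : (n : ℝ) / m * j + b = (n * j + m * b) / m := by field_simp
        rw [e, le_div_iff₀ hm']
        linarith

/-- In each residue class the leading monomials contribute at most `|z₂|^κ |w₂|^κ`, and each
arithmetico-geometric factor contributes one inverse square. -/
theorem exists_norm_projKernel_le (hm : 0 < m) (hn : 0 < n) {c κ : ℝ} (hc : -(m + n) ≤ c)
    (hκ : ∀ j : Fin m, m * κ ≤ n * (j : ℕ) + m * leastExponent m n c j) :
    ∃ C : ℝ, 0 ≤ C ∧ ∀ z ∈ ratHartogs m n, ∀ w ∈ ratHartogs m n,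
      ‖projKernel m n c z w‖ ≤ C * hartogsKernel m n κ z w := by
  refine ⟨∑ j : Fin m, (2 * ((j : ℕ) + 1) + m) * (2 * residueWeight m n c j + m)
    / (Real.pi ^ 2 * m), Finset.sum_nonneg fun j _ => ?_, fun z hz w hw => ?_⟩
  · have := residueWeight_pos hc j
    positivity
  rw [hartogsKernel_comm, projKernel, Finset.sum_mul]
  refine (norm_sum_le _ _).trans (Finset.sum_le_sum fun j _ => ?_)
  have hq := residueWeight_pos hc j
  have hj : (0 : ℝ) ≤ (j : ℕ) + 1 := by positivity
  rw [norm_mul, norm_mul, norm_div, norm_mul, Complex.norm_conj, Complex.norm_real,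
    Real.norm_of_nonneg (by positivity)]
  have h1 := norm_laurentMonomial_le_rpow hm hn (hκ j) hz
  have h2 := norm_laurentMonomial_le_rpow hm hn (hκ j) hw
  have h3 := norm_arithGeo_le hj (by positivity : (0 : ℝ) ≤ m)
    (norm_mul_conj_lt_one (norm_hartogsRatio_lt_one hz) (norm_hartogsRatio_lt_one hw))
  have h4 := norm_arithGeo_le hq.le (by positivity : (0 : ℝ) ≤ m) (norm_mul_conj_lt_one hz.2 hw.2)
  calc _ ≤ ‖z.2‖ ^ κ * ‖w.2‖ ^ κ * (((2 * ((j : ℕ) + 1) + m)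
          * (1 / ‖1 - hartogsRatio m n z * conj (hartogsRatio m n w)‖ ^ 2))
          * ((2 * residueWeight m n c j + m) * (1 / ‖1 - z.2 * conj w.2‖ ^ 2))
          / (Real.pi ^ 2 * m)) := by gcongr
    _ = _ := by rw [hartogsKernel]; ring

/-- Each residue class sums to a product of two arithmetico-geometric series. A geometric majorant
with ratio `θ` justifies summing over the whole index set. -/
theorem hasSum_projKernel (hn : 0 < n) {c : ℝ} (hc : -(m + n) ≤ c) {z w : ℂ × ℂ}
    (hz : z ∈ ratHartogs m n) (hw : w ∈ ratHartogs m n) :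
    HasSum (fun x : Fin m × ℕ × ℕ => laurentMonomial (residueIndex m n c x) z
        * conj (laurentMonomial (residueIndex m n c x) w)
        * ((monomialNormSq m n (residueIndex m n c x))⁻¹ : ℝ)) (projKernel m n c z w) := by
  have hz2 := snd_ne_zero_of_mem_ratHartogs hn hz
  have hw2 := snd_ne_zero_of_mem_ratHartogs hn hw
  set X := hartogsRatio m n z * conj (hartogsRatio m n w)
  set T := z.2 * conj w.2
  have hX : ‖X‖ < 1 :=
    norm_mul_conj_lt_one (norm_hartogsRatio_lt_one hz) (norm_hartogsRatio_lt_one hw)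
  have hT : ‖T‖ < 1 := norm_mul_conj_lt_one hz.2 hw.2
  have hfib : ∀ j : Fin m, HasSum (fun y : ℕ × ℕ => laurentMonomial (residueIndex m n c (j, y)) z
        * conj (laurentMonomial (residueIndex m n c (j, y)) w)
        * ((monomialNormSq m n (residueIndex m n c (j, y)))⁻¹ : ℝ))
      (laurentMonomial ((j : ℕ), leastExponent m n c j) z
        * conj (laurentMonomial ((j : ℕ), leastExponent m n c j) w)
        * (arithGeo ((j : ℕ) + 1) m X * arithGeo (residueWeight m n c j) m T
          / (Real.pi ^ 2 * m : ℝ))) := fun j => by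
    have h1 := hasSum_arithGeo_mul ((j : ℕ) + 1) m (residueWeight m n c j) m hX hT
    have h2 := (h1.div_const ((Real.pi ^ 2 * m : ℝ) : ℂ)).mul_left
      (laurentMonomial ((j : ℕ), leastExponent m n c j) z
        * conj (laurentMonomial ((j : ℕ), leastExponent m n c j) w))
    refine h2.congr_fun fun y => ?_
    rw [laurentMonomial_residueIndex c _ hz2, laurentMonomial_residueIndex c _ hw2,
      inv_monomialNormSq_residueIndex]
    simp only [X, T, map_mul, map_pow, mul_pow]
    push_cast
    ring
  have hsum : Summable fun x : Fin m × ℕ × ℕ => laurentMonomial (residueIndex m n c x) z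
        * conj (laurentMonomial (residueIndex m n c x) w)
        * ((monomialNormSq m n (residueIndex m n c x))⁻¹ : ℝ) := by
    set θ := max ‖X‖ ‖T‖
    have hθ0 : 0 ≤ θ := le_max_of_le_left (norm_nonneg _)
    have hb : ∀ j : Fin m, ‖laurentMonomial ((j : ℕ), leastExponent m n c j) z
        * conj (laurentMonomial ((j : ℕ), leastExponent m n c j) w)‖
        ≤ ∑ j : Fin m, ‖laurentMonomial ((j : ℕ), leastExponent m n c j) z
        * conj (laurentMonomial ((j : ℕ), leastExponent m n c j) w)‖ := fun j =>
      Finset.single_le_sum (f := fun j : Fin m =>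
        ‖laurentMonomial ((j : ℕ), leastExponent m n c j) z
        * conj (laurentMonomial ((j : ℕ), leastExponent m n c j) w)‖)
        (fun j _ => norm_nonneg _) (Finset.mem_univ j)
    refine Summable.of_norm_bounded ((summable_residue_bound hc hθ0 (max_lt hX hT)).mul_left
      (∑ j : Fin m, ‖laurentMonomial ((j : ℕ), leastExponent m n c j) z
        * conj (laurentMonomial ((j : ℕ), leastExponent m n c j) w)‖)) fun x => ?_
    have hN : 0 ≤ (monomialNormSq m n (residueIndex m n c x))⁻¹ := by
      have := residueWeight_pos hc x.1
      rw [inv_monomialNormSq_residueIndex]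
      positivity
    have e : laurentMonomial (residueIndex m n c x) z
        * conj (laurentMonomial (residueIndex m n c x) w)
        * ((monomialNormSq m n (residueIndex m n c x))⁻¹ : ℝ)
        = (laurentMonomial ((x.1 : ℕ), leastExponent m n c x.1) z
        * conj (laurentMonomial ((x.1 : ℕ), leastExponent m n c x.1) w))
        * (((monomialNormSq m n (residueIndex m n c x))⁻¹ : ℝ) * (X ^ x.2.1 * T ^ x.2.2)) := by
      rw [laurentMonomial_residueIndex c _ hz2, laurentMonomial_residueIndex c _ hw2]
      simp only [X, T, map_mul, map_pow, mul_pow]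
      ring
    rw [e, norm_mul, norm_mul (Complex.ofReal _), norm_mul (X ^ _), norm_pow, norm_pow,
      Complex.norm_real,
      Real.norm_of_nonneg hN]
    refine mul_le_mul (hb x.1) (mul_le_mul_of_nonneg_left (mul_le_mul ?_ ?_ (by positivity)
      (by positivity)) hN) (by positivity) (Finset.sum_nonneg fun _ _ => norm_nonneg _)
    · exact pow_le_pow_left₀ (norm_nonneg _) (le_max_left _ _) _
    · exact pow_le_pow_left₀ (norm_nonneg _) (le_max_right _ _) _
  have h := hsum.hasSum
  rw [hsum.tsum_prod, tsum_fintype] at h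
  simp only [(hfib _).tsum_eq] at h
  exact h

end ProjKernel

/-! ### The projection defined by its Laurent coefficients, and its integral formula. -/

section ProjFun

variable {m n : ℕ} {c : ℝ} {y : ℂ × ℂ → ℂ}

open Classical in
/-- The Laurent coefficients of the projection of `y` onto the closed span of the monomials `e_α`
with `0 ≤ α₁` and `c < n α₁ + m α₂`. -/
def projCoeff (m n : ℕ) (c : ℝ) (y : ℂ × ℂ → ℂ) (α : ℤ × ℤ) : ℂ :=
  if α ∈ Set.range (residueIndex m n c) then
    (∫ w in ratHartogs m n, y w * conj (laurentMonomial α w)) * ((monomialNormSq m n α)⁻¹ : ℝ)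
  else 0

/-- The projection of `y` onto the closed span of the monomials `e_α` with `0 ≤ α₁` and
`c < n α₁ + m α₂`. -/
def projFun (m n : ℕ) (c : ℝ) (y : ℂ × ℂ → ℂ) (z : ℂ × ℂ) : ℂ :=
  ∑' α, projCoeff m n c y α * laurentMonomial α z

theorem projCoeff_residueIndex (y : ℂ × ℂ → ℂ) (x : Fin m × ℕ × ℕ) :
    projCoeff m n c y (residueIndex m n c x)
      = (∫ w in ratHartogs m n, y w * conj (laurentMonomial (residueIndex m n c x) w))
        * ((monomialNormSq m n (residueIndex m n c x))⁻¹ : ℝ) :=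
  if_pos ⟨x, rfl⟩

theorem projCoeff_of_notMem {α : ℤ × ℤ} (y : ℂ × ℂ → ℂ)
    (hα : α ∉ Set.range (residueIndex m n c)) : projCoeff m n c y α = 0 :=
  if_neg hα

theorem inv_monomialNormSq_residueIndex_nonneg (hc : -(m + n) ≤ c) (x : Fin m × ℕ × ℕ) :
    0 ≤ (monomialNormSq m n (residueIndex m n c x))⁻¹ := by
  have := residueWeight_pos hc x.1
  rw [inv_monomialNormSq_residueIndex]
  positivity

theorem exists_summable_residue (hn : 0 < n) (hc : -(m + n) ≤ c) {z₀ : ℂ × ℂ}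
    (hz₀ : z₀ ∈ ratHartogs m n) : ∃ U ∈ 𝓝 z₀, ∃ u : Fin m × ℕ × ℕ → ℝ, Summable u ∧
      ∀ x, ∀ z ∈ U, (monomialNormSq m n (residueIndex m n c x))⁻¹
        * ‖laurentMonomial (residueIndex m n c x) z‖ ≤ u x := by
  have h20 := snd_ne_zero_of_mem_ratHartogs hn hz₀
  obtain ⟨θ, hθ, hθ1⟩ := exists_between (max_lt (norm_hartogsRatio_lt_one hz₀) hz₀.2)
  obtain ⟨hθa, hθb⟩ := max_lt_iff.1 hθ
  have hθ0 : 0 ≤ θ := (norm_nonneg _).trans hθb.le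
  -- The summand `1` makes the bounds at `z₀` strict, so that they persist in a neighbourhood.
  set M : ℝ := 1 + ∑ j : Fin m, ‖laurentMonomial ((j : ℕ), leastExponent m n c j) z₀‖
  have hM : ∀ j : Fin m, ‖laurentMonomial ((j : ℕ), leastExponent m n c j) z₀‖ < M := fun j => by
    have := Finset.single_le_sum
      (f := fun j : Fin m => ‖laurentMonomial ((j : ℕ), leastExponent m n c j) z₀‖)
      (fun j _ => norm_nonneg _) (Finset.mem_univ j)
    linarith
  have c1 : ContinuousAt (hartogsRatio m n) z₀ := by
    have : z₀.2 ^ n ≠ 0 := pow_ne_zero _ h20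
    unfold hartogsRatio
    fun_prop (disch := assumption)
  have e1 : ∀ᶠ z in 𝓝 z₀, ‖hartogsRatio m n z‖ < θ := c1.norm.eventually_lt_const hθa
  have e2 : ∀ᶠ z : ℂ × ℂ in 𝓝 z₀, ‖z.2‖ < θ :=
    (continuous_snd.norm.continuousAt (x := z₀)).eventually_lt_const hθb
  have e3 : ∀ᶠ z in 𝓝 z₀, ∀ j : Fin m,
      ‖laurentMonomial ((j : ℕ), leastExponent m n c j) z‖ < M :=
    Filter.eventually_all.2 fun j => (differentiableAt_laurentMonomial (Or.inr (by positivity))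
      h20).continuousAt.norm.eventually_lt_const (hM j)
  have e4 : ∀ᶠ z in 𝓝 z₀, z ∈ ratHartogs m n := isOpen_ratHartogs.mem_nhds hz₀
  refine ⟨_, (e1.and (e2.and (e3.and e4))), _,
    (summable_residue_bound hc hθ0 hθ1).mul_left M, ?_⟩
  rintro x z ⟨h1, h2, h3, h4⟩
  have hN := inv_monomialNormSq_residueIndex_nonneg hc x
  rw [laurentMonomial_residueIndex c x (snd_ne_zero_of_mem_ratHartogs hn h4), norm_mul, norm_mul,
    norm_pow, norm_pow]
  calc _ ≤ (monomialNormSq m n (residueIndex m n c x))⁻¹ * (M * (θ ^ x.2.1 * θ ^ x.2.2)) := by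
        have h5 := (h3 x.1).le
        have h6 : 0 ≤ M := (norm_nonneg _).trans h5
        gcongr
    _ = _ := by ring

/-- `y` is integrable against the leading monomials of the residue classes. -/
def ResidueIntegrable (m n : ℕ) (c : ℝ) (y : ℂ × ℂ → ℂ) : Prop :=
  AEStronglyMeasurable y (volume.restrict (ratHartogs m n)) ∧ ∀ j : Fin m, IntegrableOn
    (fun w => y w * conj (laurentMonomial ((j : ℕ), leastExponent m n c j) w)) (ratHartogs m n)

theorem norm_laurentMonomial_residueIndex_le (hn : 0 < n) (x : Fin m × ℕ × ℕ) {z : ℂ × ℂ}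
    (hz : z ∈ ratHartogs m n) : ‖laurentMonomial (residueIndex m n c x) z‖
      ≤ ‖laurentMonomial ((x.1 : ℕ), leastExponent m n c x.1) z‖ := by
  rw [laurentMonomial_residueIndex c x (snd_ne_zero_of_mem_ratHartogs hn hz), norm_mul, norm_mul,
    norm_pow, norm_pow]
  exact mul_le_of_le_one_right (norm_nonneg _) (mul_le_one₀
    (pow_le_one₀ (norm_nonneg _) (norm_hartogsRatio_lt_one hz).le) (by positivity)
    (pow_le_one₀ (norm_nonneg _) hz.2.le))

/-- On the domain `|z₁^m / z₂^n|` and `|z₂|` are below one, so the leading monomial dominates its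
whole class and finitely many integrals bound all the coefficient integrals. -/
theorem ResidueIntegrable.integrable_and_le (hn : 0 < n) (hy : ResidueIntegrable m n c y)
    (x : Fin m × ℕ × ℕ) :
    IntegrableOn (fun w => y w * conj (laurentMonomial (residueIndex m n c x) w)) (ratHartogs m n)
    ∧ ∫ w in ratHartogs m n, ‖y w * conj (laurentMonomial (residueIndex m n c x) w)‖
      ≤ ∑ j : Fin m, ∫ w in ratHartogs m n,
        ‖y w * conj (laurentMonomial ((j : ℕ), leastExponent m n c j) w)‖ := by
  have hb : ∀ w ∈ ratHartogs m n, ‖y w * conj (laurentMonomial (residueIndex m n c x) w)‖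
      ≤ ‖y w * conj (laurentMonomial ((x.1 : ℕ), leastExponent m n c x.1) w)‖ := fun w hw => by
    rw [norm_mul, norm_mul, Complex.norm_conj, Complex.norm_conj]
    exact mul_le_mul_of_nonneg_left (norm_laurentMonomial_residueIndex_le hn x hw) (norm_nonneg _)
  have hb' := (ae_restrict_mem (μ := volume) (measurableSet_ratHartogs (m := m) (n := n))).mono hb
  have hmeas : AEStronglyMeasurable (fun w => y w * conj (laurentMonomial (residueIndex m n c x) w))
      (volume.restrict (ratHartogs m n)) :=
    hy.1.mul (Complex.continuous_conj.measurable.comp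
      (measurable_laurentMonomial _)).aestronglyMeasurable
  have hi := Integrable.mono (hy.2 x.1) hmeas hb'
  refine ⟨hi, (integral_mono_ae hi.norm (hy.2 x.1).norm hb').trans ?_⟩
  exact Finset.single_le_sum (f := fun j : Fin m => ∫ w in ratHartogs m n,
    ‖y w * conj (laurentMonomial ((j : ℕ), leastExponent m n c j) w)‖)
    (fun j _ => integral_nonneg fun _ => norm_nonneg _) (Finset.mem_univ x.1)

theorem projFun_locally_dominated (hn : 0 < n) (hc : -(m + n) ≤ c)
    (hy : ResidueIntegrable m n c y) : ∀ z₀ ∈ ratHartogs m n, ∃ U ∈ 𝓝 z₀, ∃ u : ℤ × ℤ → ℝ,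
      Summable u ∧ ∀ α, ∀ z ∈ U, ‖projCoeff m n c y α * laurentMonomial α z‖ ≤ u α := by
  intro z₀ hz₀
  obtain ⟨U, hU, u, hu, hb⟩ := exists_summable_residue hn hc hz₀
  set B := ∑ j : Fin m, ∫ w in ratHartogs m n,
        ‖y w * conj (laurentMonomial ((j : ℕ), leastExponent m n c j) w)‖
  refine ⟨U, hU, Function.extend (residueIndex m n c) (fun x => B * u x) 0,
    (summable_extend_zero (residueIndex_injective c)).2 (hu.mul_left B), fun α z hz => ?_⟩
  by_cases hα : α ∈ Set.range (residueIndex m n c)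
  · obtain ⟨x, rfl⟩ := hα
    rw [(residueIndex_injective c).extend_apply, projCoeff_residueIndex, norm_mul, norm_mul,
      Complex.norm_real, Real.norm_of_nonneg (inv_monomialNormSq_residueIndex_nonneg hc x),
      mul_assoc]
    have h1 := (norm_integral_le_integral_norm _).trans (hy.integrable_and_le hn x).2
    have hN := inv_monomialNormSq_residueIndex_nonneg (n := n) hc x
    exact mul_le_mul h1 (hb x z hz) (by positivity) ((norm_nonneg _).trans h1)
  · rw [projCoeff_of_notMem y hα, Function.extend_apply' _ _ _ hα]
    simp

theorem summable_projFun (hn : 0 < n) (hc : -(m + n) ≤ c) (hy : ResidueIntegrable m n c y)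
    {z : ℂ × ℂ} (hz : z ∈ ratHartogs m n) :
    Summable fun α => projCoeff m n c y α * laurentMonomial α z := by
  obtain ⟨U, hU, u, hu, hb⟩ := projFun_locally_dominated hn hc hy z hz
  exact Summable.of_norm_bounded hu fun α => hb α z (mem_of_mem_nhds hU)

theorem differentiableOn_projFun (hm : 0 < m) (hn : 0 < n) (hc : -(m + n) ≤ c)
    (hy : ResidueIntegrable m n c y) :
    DifferentiableOn ℂ (projFun m n c y) (ratHartogs m n) := by
  refine differentiableOn_tsum_of_locally_dominated isOpen_ratHartogs (fun α => ?_)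
    (projFun_locally_dominated hn hc hy)
  refine differentiableOn_laurent_term hn fun hα => projCoeff_of_notMem y fun h => ?_
  exact absurd ((mem_range_residueIndex hm).1 h).1 (not_le.2 hα)

theorem laurentCoeff_projFun (hm : 0 < m) (hn : 0 < n) (hc : -(m + n) ≤ c)
    (hy : ResidueIntegrable m n c y) :
    laurentCoeff n (projFun m n c y) = projCoeff m n c y :=
  (eq_laurentCoeff_of_hasSumLocallyUniformlyOn hm hn (differentiableOn_projFun hm hn hc hy)
    (hasSumLocallyUniformlyOn_of_locally_dominated (projFun_locally_dominated hn hc hy))).symm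

/-- Sum and integral are exchanged because the `L¹` norms of the terms are summable. This links the
series, from which holomorphy and coefficients are read off, to the kernel, for which norm bounds
are available. -/
theorem projFun_eq_integral (hn : 0 < n) (hc : -(m + n) ≤ c) (hy : ResidueIntegrable m n c y)
    {z : ℂ × ℂ} (hz : z ∈ ratHartogs m n) :
    projFun m n c y z = ∫ w in ratHartogs m n, projKernel m n c z w * y w := by
  set F : Fin m × ℕ × ℕ → ℂ × ℂ → ℂ := fun x w => laurentMonomial (residueIndex m n c x) z
    * conj (laurentMonomial (residueIndex m n c x) w)
    * ((monomialNormSq m n (residueIndex m n c x))⁻¹ : ℝ) * y w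
  have hF : ∀ x w, F x w = (laurentMonomial (residueIndex m n c x) z
      * ((monomialNormSq m n (residueIndex m n c x))⁻¹ : ℝ))
      * (y w * conj (laurentMonomial (residueIndex m n c x) w)) := fun x w => by
    simp only [F]; ring
  have hint : ∀ x, Integrable (F x) (volume.restrict (ratHartogs m n)) := fun x => by
    simp only [funext (hF x)]
    exact (hy.integrable_and_le hn x).1.const_mul _
  obtain ⟨U, hU, u, hu, hb⟩ := exists_summable_residue hn hc hz
  have hsum : Summable fun x => ∫ w in ratHartogs m n, ‖F x w‖ := by
    refine (hu.mul_right (∑ j : Fin m, ∫ w in ratHartogs m n,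
        ‖y w * conj (laurentMonomial ((j : ℕ), leastExponent m n c j) w)‖)).of_nonneg_of_le
        (fun x => integral_nonneg fun _ => norm_nonneg _) fun x => ?_
    have hN := inv_monomialNormSq_residueIndex_nonneg (n := n) hc x
    have h1 := hb x z (mem_of_mem_nhds hU)
    simp only [hF x, norm_mul (laurentMonomial (residueIndex m n c x) z * _)]
    rw [integral_const_mul, norm_mul, Complex.norm_real, Real.norm_of_nonneg hN, mul_comm ‖_‖]
    exact mul_le_mul h1 (hy.integrable_and_le hn x).2 (integral_nonneg fun _ => norm_nonneg _)
      ((by positivity : (0 : ℝ) ≤ _).trans h1)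
  have h := hasSum_integral_of_summable_integral_norm hint hsum
  have e1 : ∫ w in ratHartogs m n, ∑' x, F x w
      = ∫ w in ratHartogs m n, projKernel m n c z w * y w :=
    setIntegral_congr_fun measurableSet_ratHartogs fun w hw =>
      ((hasSum_projKernel hn hc hz hw).mul_right (y w)).tsum_eq
  rw [← e1, ← h.tsum_eq, projFun, ← (residueIndex_injective c).tsum_eq]
  · refine tsum_congr fun x => ?_
    rw [projCoeff_residueIndex]
    simp only [hF x]
    rw [integral_const_mul]
    ring
  · intro α hα
    by_contra h0
    exact hα (by simp only [projCoeff_of_notMem y h0, zero_mul])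

theorem projCoeff_congr {y' : ℂ × ℂ → ℂ} (h : y =ᵐ[volume.restrict (ratHartogs m n)] y') :
    projCoeff m n c y = projCoeff m n c y' := by
  funext α
  rw [projCoeff, projCoeff]
  have : ∫ w in ratHartogs m n, y w * conj (laurentMonomial α w)
      = ∫ w in ratHartogs m n, y' w * conj (laurentMonomial α w) :=
    integral_congr_ae (h.mono fun w hw => by simp only [hw])
  rw [this]

theorem projCoeff_add (hn : 0 < n) {y' : ℂ × ℂ → ℂ} (hy : ResidueIntegrable m n c y)
    (hy' : ResidueIntegrable m n c y') (α : ℤ × ℤ) :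
    projCoeff m n c (fun w => y w + y' w) α = projCoeff m n c y α + projCoeff m n c y' α := by
  by_cases hα : α ∈ Set.range (residueIndex m n c)
  · obtain ⟨x, rfl⟩ := hα
    simp only [projCoeff_residueIndex, add_mul]
    rw [integral_add (hy.integrable_and_le hn x).1 (hy'.integrable_and_le hn x).1, add_mul]
  · simp only [projCoeff_of_notMem _ hα, add_zero]

theorem projCoeff_smul (k : ℂ) (α : ℤ × ℤ) :
    projCoeff m n c (fun w => k * y w) α = k * projCoeff m n c y α := by
  by_cases hα : α ∈ Set.range (residueIndex m n c)
  · obtain ⟨x, rfl⟩ := hα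
    simp only [projCoeff_residueIndex, mul_assoc]
    rw [integral_const_mul, mul_assoc]
  · simp only [projCoeff_of_notMem _ hα, mul_zero]

theorem projFun_add (hn : 0 < n) (hc : -(m + n) ≤ c) {y' : ℂ × ℂ → ℂ}
    (hy : ResidueIntegrable m n c y) (hy' : ResidueIntegrable m n c y') {z : ℂ × ℂ}
    (hz : z ∈ ratHartogs m n) :
    projFun m n c (fun w => y w + y' w) z = projFun m n c y z + projFun m n c y' z := by
  rw [projFun, projFun, projFun, ← (summable_projFun hn hc hy hz).tsum_add
    (summable_projFun hn hc hy' hz)]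
  simp only [projCoeff_add hn hy hy', add_mul]

theorem projFun_smul (k : ℂ) (z : ℂ × ℂ) :
    projFun m n c (fun w => k * y w) z = k * projFun m n c y z := by
  simp only [projFun, projCoeff_smul, mul_assoc, tsum_mul_left]

theorem projFun_congr {y' : ℂ × ℂ → ℂ} (h : y =ᵐ[volume.restrict (ratHartogs m n)] y') :
    projFun m n c y = projFun m n c y' := by
  funext z
  rw [projFun, projFun, projCoeff_congr h]

theorem enorm_projFun_le (hn : 0 < n) {κ C : ℝ} (hc : -(m + n) ≤ c) (hC : 0 ≤ C)
    (hK : ∀ z ∈ ratHartogs m n, ∀ w ∈ ratHartogs m n,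
      ‖projKernel m n c z w‖ ≤ C * hartogsKernel m n κ z w) (hy : ResidueIntegrable m n c y)
    {z : ℂ × ℂ} (hz : z ∈ ratHartogs m n) :
    ‖projFun m n c y z‖ₑ ≤ ENNReal.ofReal C
      * ∫⁻ w in ratHartogs m n, ENNReal.ofReal (hartogsKernel m n κ z w) * ‖y w‖ₑ := by
  rw [projFun_eq_integral hn hc hy hz, ← lintegral_const_mul' _ _ ENNReal.ofReal_ne_top]
  refine (enorm_integral_le_lintegral_enorm _).trans
    (setLIntegral_mono' measurableSet_ratHartogs fun w hw => ?_)
  rw [enorm_mul, ← mul_assoc, ← ENNReal.ofReal_mul hC]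
  refine mul_le_mul_left ?_ _
  rw [← ofReal_norm]
  exact ENNReal.ofReal_le_ofReal (hK z hz w hw)

end ProjFun

/-! ### Arithmetic of the conjugate exponents. -/

section Exponents

variable {p q : ℝ≥0∞} [ENNReal.HolderConjugate p q]

theorem two_lt_toReal (hp : 2 < p) (hp' : p ≠ ∞) : 2 < p.toReal := by
  have := (ENNReal.toReal_lt_toReal (by norm_num) hp').2 hp
  simpa using this

theorem conjExponent_ne_top (hp : 2 < p) : q ≠ ∞ := by
  rintro rfl
  have h := ENNReal.HolderConjugate.inv_add_inv_eq_one p ∞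
  rw [ENNReal.inv_top, add_zero, ENNReal.inv_eq_one] at h
  rw [h] at hp
  exact absurd hp (by norm_num)

theorem toReal_holderConjugate (hp : 2 < p) (hp' : p ≠ ∞) :
    p.toReal.HolderConjugate q.toReal :=
  ENNReal.HolderConjugate.toReal_of_ne_top hp' (conjExponent_ne_top hp)

theorem toReal_conjExponent_le (hp : 2 < p) (hp' : p ≠ ∞) : q.toReal ≤ p.toReal := by
  have hPQ := toReal_holderConjugate (q := q) hp hp'
  have h1 := hPQ.mul_eq_add
  have h2 := two_lt_toReal hp hp'
  nlinarith [hPQ.symm.pos]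

theorem conjExponent_le (hp : 2 < p) (hp' : p ≠ ∞) : q ≤ p :=
  (ENNReal.toReal_le_toReal (conjExponent_ne_top hp) hp').1 (toReal_conjExponent_le hp hp')

end Exponents

/-! ### Boundedness, adjointness and range of the projections. -/

section Projection

variable {m n : ℕ} {p q : ℝ≥0∞} [Fact (1 ≤ p)] [Fact (1 ≤ q)] [ENNReal.HolderConjugate p q]

/-- The bound on `n α₁ + m α₂` that characterizes the `L^p`-allowable multi-indices. -/
def critExponent (m n : ℕ) (p : ℝ≥0∞) : ℝ := -(2 * (m + n)) / p.toReal

omit [Fact (1 ≤ p)] in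
-- Because `p > 2`, the threshold is no lower than the one for `L²`: `L^p`-allowable monomials are
-- square integrable, so their `L²` norms may be used as normalisation.
theorem le_critExponent (hp : 2 < p) (hp' : p ≠ ∞) : -(m + n) ≤ critExponent m n p := by
  have h := two_lt_toReal hp hp'
  rw [critExponent, le_div_iff₀ (by linarith)]
  have : (0 : ℝ) ≤ m + n := by positivity
  nlinarith

theorem allowable_eq_range (hm : 0 < m) (hn : 0 < n) (hp' : p ≠ ∞) :
    allowable (ratHartogs m n) p = Set.range (residueIndex m n (critExponent m n p)) := by
  ext α
  rw [mem_allowable_iff hm hn Fact.out hp', mem_range_residueIndex hm, critExponent]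

omit [Fact (1 ≤ q)] in
-- The leading monomials are themselves `L^p`-allowable, so Hölder pairs them with `L^q`.
theorem residueIntegrable_of_memLp (hm : 0 < m) (hn : 0 < n) (hp' : p ≠ ∞) {y : ℂ × ℂ → ℂ}
    (hy : MemLp y q (volume.restrict (ratHartogs m n))) :
    ResidueIntegrable m n (critExponent m n p) y := by
  refine ⟨hy.1, fun j => ?_⟩
  have h : residueIndex m n (critExponent m n p) (j, 0, 0)
      ∈ allowable (ratHartogs m n) p := by
    rw [allowable_eq_range hm hn hp']
    exact ⟨_, rfl⟩
  have e : residueIndex m n (critExponent m n p) (j, 0, 0)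
      = (((j : ℕ) : ℤ), leastExponent m n (critExponent m n p) j) := by simp [residueIndex]
  rw [e] at h
  have : ENNReal.HolderConjugate q p := ENNReal.HolderConjugate.symm
  exact hy.integrable_mul h.2.star

omit [Fact (1 ≤ p)] in
-- At `κ = critExponent / m` the second condition would be an equality, so `κ` must be larger. Room
-- exists because each of the finitely many leading exponents exceeds the threshold strictly.
theorem exists_kernel_exponent (hm : 0 < m) (hp : 2 < p) (hp' : p ≠ ∞) :
    ∃ κ : ℝ, κ ≤ 0 ∧ -(2 * n / m + 2) < κ * p.toReal ∧
      ∀ j : Fin m, m * κ ≤ n * (j : ℕ) + m * leastExponent m n (critExponent m n p) j := by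
  have hP : 0 < p.toReal := by linarith [two_lt_toReal hp hp']
  have hm' : (0 : ℝ) < m := by exact_mod_cast hm
  have hneg : critExponent m n p / m < 0 := by
    rw [critExponent]
    refine div_neg_of_neg_of_pos (div_neg_of_neg_of_pos ?_ hP) hm'
    have : (0 : ℝ) ≤ n := by positivity
    linarith
  have e1 : ∀ᶠ κ : ℝ in 𝓝[>] (critExponent m n p / m), κ < 0 :=
    (eventually_lt_nhds hneg).filter_mono nhdsWithin_le_nhds
  have e2 : ∀ᶠ κ : ℝ in 𝓝[>] (critExponent m n p / m), ∀ j : Fin m,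
      κ < (n * (j : ℕ) + m * leastExponent m n (critExponent m n p) j) / m :=
    Filter.eventually_all.2 fun j => (eventually_lt_nhds
      (div_lt_div_of_pos_right (lt_leastExponent _ j) hm')).filter_mono nhdsWithin_le_nhds
  have e3 : ∀ᶠ κ : ℝ in 𝓝[>] (critExponent m n p / m), critExponent m n p / m < κ :=
    self_mem_nhdsWithin
  obtain ⟨κ, h1, h2, h3⟩ := (e1.and (e2.and e3)).exists
  refine ⟨κ, h1.le, ?_, fun j => ?_⟩
  · have e : critExponent m n p / m * p.toReal = -(2 * n / m + 2) := by
      rw [critExponent]; field_simp; ring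
    rw [← e]
    exact mul_lt_mul_of_pos_right h3 hP
  · have := (lt_div_iff₀ hm').1 (h2 j)
    linarith

omit [Fact (1 ≤ q)] in
omit [Fact (1 ≤ p)] in
theorem exists_kernel_bound (hm : 0 < m) (hn : 0 < n) (hp : 2 < p) (hp' : p ≠ ∞) :
    ∃ (κ C₁ : ℝ) (C₂ : ℝ≥0∞), 0 ≤ C₁ ∧ C₂ ≠ ∞ ∧
      (∀ z ∈ ratHartogs m n, ∀ w ∈ ratHartogs m n,
        ‖projKernel m n (critExponent m n p) z w‖ ≤ C₁ * hartogsKernel m n κ z w) ∧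
      ∀ R : ℝ, R = p.toReal ∨ R = q.toReal → ∀ f : ℂ × ℂ → ℝ≥0∞, Measurable f →
        ∫⁻ z in ratHartogs m n, (∫⁻ w in ratHartogs m n,
            ENNReal.ofReal (hartogsKernel m n κ z w) * f w) ^ R
          ≤ C₂ * ∫⁻ z in ratHartogs m n, f z ^ R := by
  obtain ⟨κ, h1, h2, h3⟩ := exists_kernel_exponent (n := n) hm hp hp'
  obtain ⟨C₁, hC₁, h4⟩ := exists_norm_projKernel_le hm hn (le_critExponent hp hp') h3
  obtain ⟨C₂, hC₂, h5⟩ := exists_lintegral_hartogsKernel_rpow_le hm hn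
    (toReal_holderConjugate (q := q) hp hp') (two_lt_toReal hp hp').le h1 h2
  exact ⟨κ, C₁, C₂, hC₁, hC₂, h4, h5⟩

theorem residueIntegrable_Lp (hm : 0 < m) (hn : 0 < n) (hp : 2 < p) (hp' : p ≠ ∞)
    {r : ℝ≥0∞} (hr : r = p ∨ r = q) (y : Lp ℂ r (volume.restrict (ratHartogs m n))) :
    ResidueIntegrable m n (critExponent m n p) y := by
  refine residueIntegrable_of_memLp (q := q) hm hn hp' ((Lp.memLp y).mono_exponent ?_)
  rcases hr with rfl | rfl
  · exact conjExponent_le hp hp'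
  · exact le_rfl

theorem exists_eLpNorm_projFun_le (hm : 0 < m) (hn : 0 < n) (hp : 2 < p) (hp' : p ≠ ∞)
    {r : ℝ≥0∞} (hr : r = p ∨ r = q) :
    ∃ C : ℝ≥0∞, C ≠ ∞ ∧ ∀ y : Lp ℂ r (volume.restrict (ratHartogs m n)),
      eLpNorm (projFun m n (critExponent m n p) y) r (volume.restrict (ratHartogs m n))
        ≤ C * eLpNorm y r (volume.restrict (ratHartogs m n)) := by
  obtain ⟨κ, C₁, C₂, hC₁, hC₂, hK, hS⟩ := exists_kernel_bound (q := q) hm hn hp hp'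
  have hr' : r ≠ ∞ := by
    rcases hr with rfl | rfl
    exacts [hp', conjExponent_ne_top hp]
  have hr0 : r ≠ 0 := by
    rcases hr with rfl | rfl
    · exact ENNReal.HolderConjugate.ne_zero r q
    · exact ENNReal.HolderConjugate.ne_zero r p
  have hR : 0 < r.toReal := ENNReal.toReal_pos hr0 hr'
  have hrR : r.toReal = p.toReal ∨ r.toReal = q.toReal := by
    rcases hr with rfl | rfl <;> simp
  refine ⟨(ENNReal.ofReal C₁ ^ r.toReal * C₂) ^ (1 / r.toReal),
    (ENNReal.rpow_lt_top_of_nonneg (by positivity) (ENNReal.mul_lt_top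
      (ENNReal.rpow_lt_top_of_nonneg hR.le ENNReal.ofReal_ne_top) hC₂.lt_top).ne).ne, fun y => ?_⟩
  rw [eLpNorm_eq_lintegral_rpow_enorm_toReal hr0 hr', eLpNorm_eq_lintegral_rpow_enorm_toReal hr0 hr',
    ← ENNReal.mul_rpow_of_nonneg _ _ (by positivity)]
  refine ENNReal.rpow_le_rpow ?_ (by positivity)
  calc _ ≤ ∫⁻ z in ratHartogs m n, (ENNReal.ofReal C₁ * ∫⁻ w in ratHartogs m n,
          ENNReal.ofReal (hartogsKernel m n κ z w) * ‖y w‖ₑ) ^ r.toReal :=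
        setLIntegral_mono' measurableSet_ratHartogs fun z hz => ENNReal.rpow_le_rpow
          (enorm_projFun_le hn (le_critExponent hp hp') hC₁ hK
            (residueIntegrable_Lp hm hn hp hp' hr y) hz) hR.le
    _ = ENNReal.ofReal C₁ ^ r.toReal * ∫⁻ z in ratHartogs m n, (∫⁻ w in ratHartogs m n,
          ENNReal.ofReal (hartogsKernel m n κ z w) * ‖y w‖ₑ) ^ r.toReal := by
        simp_rw [ENNReal.mul_rpow_of_nonneg _ _ hR.le]
        exact lintegral_const_mul' _ _ (ENNReal.rpow_lt_top_of_nonneg hR.le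
          ENNReal.ofReal_ne_top).ne
    _ ≤ _ := by
        rw [mul_assoc]
        exact mul_le_mul_right (hS _ hrR _ (Lp.stronglyMeasurable y).enorm) _

omit [Fact (1 ≤ q)] in
-- Joint integrability for Fubini: the positive operator sends `|x|` into `L^p`, and Hölder pairs
-- the result with `|y| ∈ L^q`.
theorem integrable_projKernel_mul (hm : 0 < m) (hn : 0 < n) (hp : 2 < p) (hp' : p ≠ ∞)
    (x : Lp ℂ p (volume.restrict (ratHartogs m n))) (y : Lp ℂ q (volume.restrict (ratHartogs m n))) :
    Integrable (Function.uncurry fun z w => projKernel m n (critExponent m n p) z w * x w * conj (y z))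
      ((volume.restrict (ratHartogs m n)).prod (volume.restrict (ratHartogs m n))) := by
  obtain ⟨κ, C₁, C₂, hC₁, hC₂, hK, hS⟩ := exists_kernel_bound (q := q) hm hn hp hp'
  have hx := (Lp.stronglyMeasurable x).measurable
  have hy := (Lp.stronglyMeasurable y).measurable
  have hmeas : Measurable (Function.uncurry fun z w =>
      projKernel m n (critExponent m n p) z w * x w * conj (y z)) := by
    have h1 := measurable_projKernel (m := m) (n := n) (critExponent m n p)
    have h2 : Measurable fun u : (ℂ × ℂ) × (ℂ × ℂ) => x u.2 := hx.comp measurable_snd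
    have h3 : Measurable fun u : (ℂ × ℂ) × (ℂ × ℂ) => conj (y u.1) :=
      Complex.continuous_conj.measurable.comp (hy.comp measurable_fst)
    exact (h1.mul h2).mul h3
  refine ⟨hmeas.aestronglyMeasurable, ?_⟩
  rw [HasFiniteIntegral, lintegral_prod _ hmeas.enorm.aemeasurable]
  set T : ℂ × ℂ → ℝ≥0∞ := fun z => ∫⁻ w in ratHartogs m n,
    ENNReal.ofReal (hartogsKernel m n κ z w) * ‖x w‖ₑ
  have hT : Measurable T := by
    have h1 := (measurable_hartogsKernel (m := m) (n := n) κ).ennreal_ofReal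
    have h2 : Measurable fun u : (ℂ × ℂ) × (ℂ × ℂ) => ‖x u.2‖ₑ := (hx.comp measurable_snd).enorm
    exact (h1.mul h2).lintegral_prod_right'
  have hb : ∀ z ∈ ratHartogs m n, ∫⁻ w in ratHartogs m n,
      ‖Function.uncurry (fun z w => projKernel m n (critExponent m n p) z w * x w * conj (y z))
        (z, w)‖ₑ ≤ ENNReal.ofReal C₁ * (T z * ‖y z‖ₑ) := fun z hz => by
    rw [← mul_assoc, ← lintegral_const_mul' _ _ ENNReal.ofReal_ne_top,
      ← lintegral_mul_const' _ _ enorm_ne_top]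
    refine setLIntegral_mono' measurableSet_ratHartogs fun w hw => ?_
    simp only [Function.uncurry_apply_pair, enorm_mul]
    rw [RCLike.enorm_conj, ← mul_assoc (ENNReal.ofReal C₁), ← ENNReal.ofReal_mul hC₁]
    gcongr
    rw [← ofReal_norm]
    exact ENNReal.ofReal_le_ofReal (hK z hz w hw)
  refine (setLIntegral_mono' measurableSet_ratHartogs hb).trans_lt ?_
  rw [lintegral_const_mul' _ _ ENNReal.ofReal_ne_top]
  refine ENNReal.mul_lt_top ENNReal.ofReal_lt_top ?_
  have hPQ := toReal_holderConjugate (q := q) hp hp'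
  refine (ENNReal.lintegral_mul_le_Lp_mul_Lq _ hPQ hT.aemeasurable hy.enorm.aemeasurable).trans_lt ?_
  have hxp := (eLpNorm_lt_top_iff_lintegral_rpow_enorm_lt_top
    (ENNReal.HolderConjugate.ne_zero p q) hp').1 (Lp.memLp x).2
  have hyq := (eLpNorm_lt_top_iff_lintegral_rpow_enorm_lt_top
    (ENNReal.HolderConjugate.ne_zero q p) (conjExponent_ne_top hp)).1 (Lp.memLp y).2
  refine ENNReal.mul_lt_top (ENNReal.rpow_lt_top_of_nonneg (by have := hPQ.pos; positivity) ?_)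
    (ENNReal.rpow_lt_top_of_nonneg (by have := hPQ.symm.pos; positivity) hyq.ne)
  exact ((hS _ (Or.inl rfl) _ hx.enorm).trans_lt (ENNReal.mul_lt_top hC₂.lt_top hxp)).ne

/-- Fubini together with the Hermitian symmetry of the kernel. -/
theorem integral_projFun_mul_conj (hm : 0 < m) (hn : 0 < n) (hp : 2 < p) (hp' : p ≠ ∞)
    (x : Lp ℂ p (volume.restrict (ratHartogs m n))) (y : Lp ℂ q (volume.restrict (ratHartogs m n))) :
    ∫ z in ratHartogs m n, projFun m n (critExponent m n p) x z * conj (y z)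
      = ∫ z in ratHartogs m n, x z * conj (projFun m n (critExponent m n p) y z) := by
  have hc := le_critExponent (m := m) (n := n) hp hp'
  have hx := residueIntegrable_Lp (q := q) hm hn hp hp' (Or.inl rfl) x
  have hy := residueIntegrable_Lp (p := p) hm hn hp hp' (Or.inr rfl) y
  have e1 : ∀ z ∈ ratHartogs m n, projFun m n (critExponent m n p) x z * conj (y z)
      = ∫ w in ratHartogs m n, projKernel m n (critExponent m n p) z w * x w * conj (y z) :=
    fun z hz => by rw [projFun_eq_integral hn hc hx hz, integral_mul_const]
  have e2 : ∀ w ∈ ratHartogs m n, x w * conj (projFun m n (critExponent m n p) y w)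
      = ∫ z in ratHartogs m n, projKernel m n (critExponent m n p) z w * x w * conj (y z) :=
    fun w hw => by
    rw [projFun_eq_integral hn hc hy hw, ← integral_conj, ← integral_const_mul]
    refine integral_congr_ae (Filter.Eventually.of_forall fun z => ?_)
    simp only [map_mul, conj_projKernel]
    ring
  rw [setIntegral_congr_fun measurableSet_ratHartogs e1,
    setIntegral_congr_fun measurableSet_ratHartogs e2]
  exact integral_integral_swap (integrable_projKernel_mul hm hn hp hp' x y)

theorem exists_bergmanProj (hm : 0 < m) (hn : 0 < n) (hp : 2 < p) (hp' : p ≠ ∞)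
    {r : ℝ≥0∞} [Fact (1 ≤ r)] (hr : r = p ∨ r = q) :
    ∃ T : Lp ℂ r (volume.restrict (ratHartogs m n)) →L[ℂ] bergmanSpace (ratHartogs m n) r,
      ∀ y, (T y : Lp ℂ r (volume.restrict (ratHartogs m n)))
        =ᵐ[volume.restrict (ratHartogs m n)] projFun m n (critExponent m n p) y := by
  obtain ⟨C, hC, hb⟩ := exists_eLpNorm_projFun_le (q := q) hm hn hp hp' hr
  have hc := le_critExponent (m := m) (n := n) hp hp'
  have hy := residueIntegrable_Lp (q := q) hm hn hp hp' hr
  have hd := fun y => differentiableOn_projFun hm hn hc (hy y)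
  have hmem : ∀ y : Lp ℂ r (volume.restrict (ratHartogs m n)),
      MemLp (projFun m n (critExponent m n p) y) r (volume.restrict (ratHartogs m n)) := fun y =>
    ⟨(hd y).continuousOn.aestronglyMeasurable measurableSet_ratHartogs,
      (hb y).trans_lt (ENNReal.mul_lt_top hC.lt_top (Lp.memLp y).2)⟩
  have hH := ae_restrict_mem (μ := volume) (measurableSet_ratHartogs (m := m) (n := n))
  let L : Lp ℂ r (volume.restrict (ratHartogs m n)) →ₗ[ℂ] bergmanSpace (ratHartogs m n) r :=
    { toFun := fun y => ⟨(hmem y).toLp _, _, hd y, (hmem y).coeFn_toLp⟩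
      map_add' := fun y y' => by
        refine Subtype.ext (Lp.ext ?_)
        refine (hmem (y + y')).coeFn_toLp.trans (Filter.EventuallyEq.trans ?_
          (Lp.coeFn_add ((hmem y).toLp _) ((hmem y').toLp _)).symm)
        filter_upwards [(hmem y).coeFn_toLp, (hmem y').coeFn_toLp, hH] with z h1 h2 hz
        rw [Pi.add_apply, h1, h2, ← projFun_add hn hc (hy y) (hy y') hz]
        exact congrFun (projFun_congr (Lp.coeFn_add y y')) z
      map_smul' := fun k y => by
        refine Subtype.ext (Lp.ext ?_)
        refine (hmem (k • y)).coeFn_toLp.trans (Filter.EventuallyEq.trans ?_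
          (Lp.coeFn_smul k ((hmem y).toLp _)).symm)
        filter_upwards [(hmem y).coeFn_toLp] with z h1
        rw [Pi.smul_apply, h1, smul_eq_mul, ← projFun_smul]
        exact congrFun (projFun_congr (Lp.coeFn_smul k y)) z }
  refine ⟨L.mkContinuous C.toReal fun y => ?_, fun y => (hmem y).coeFn_toLp⟩
  change ‖(hmem y).toLp _‖ ≤ _
  rw [Lp.norm_toLp, Lp.norm_def, ← ENNReal.toReal_mul]
  exact ENNReal.toReal_mono (ENNReal.mul_ne_top hC (Lp.memLp y).2.ne) (hb y)

/-- Off `z₁ = 0`, `f conj(e_α) = f e_{-α} |e_α|²` with a torus-invariant weight. By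
`integral_mul_weight` the integral is the coefficient times `‖e_α‖₂²`, so no density of monomials is
needed. -/
theorem projCoeff_bergman (hm : 0 < m) (hn : 0 < n) (hp : 2 < p) (hp' : p ≠ ∞)
    {r : ℝ≥0∞} [Fact (1 ≤ r)] (hr : r = p ∨ r = q) (f : bergmanSpace (ratHartogs m n) r)
    {α : ℤ × ℤ} (hα : α ∈ allowable (ratHartogs m n) p) :
    projCoeff m n (critExponent m n p) f.1 α = bergmanCoeff hm hn α f := by
  rw [allowable_eq_range hm hn hp'] at hα
  obtain ⟨x, rfl⟩ := hα
  have hc := le_critExponent (m := m) (n := n) hp hp'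
  have hy := residueIntegrable_Lp (q := q) hm hn hp hp' hr f.1
  set α := residueIndex m n (critExponent m n p) x
  obtain ⟨hα1, hα2⟩ := (mem_range_residueIndex (n := n) hm).1
    (⟨x, rfl⟩ : α ∈ Set.range (residueIndex m n (critExponent m n p)))
  have hk : (0 : ℝ) < n * α.1 + m * α.2 + m + n := by linarith
  have hpos := monomialNormSq_pos hm hα1 hk
  have e : (fun w => f.1 w * conj (laurentMonomial α w)) =ᵐ[volume.restrict (ratHartogs m n)]
      fun w => bergmanRep f w * laurentMonomial (-α) w * ((‖laurentMonomial α w‖ ^ 2 : ℝ) : ℂ) := by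
    filter_upwards [coe_ae_eq_bergmanRep f, ae_restrict_ratHartogs] with w hw hw2
    have hne := laurentMonomial_ne_zero (α := α) hw2.2 (snd_ne_zero_of_mem_ratHartogs hn hw2.1)
    rw [hw, laurentMonomial_neg, Complex.ofReal_pow, ← Complex.mul_conj']
    field_simp
  have hint := (hy.integrable_and_le hn x).1.congr e
  have h := integral_mul_weight hm hn (differentiableOn_bergmanRep f) α
    (ω := fun w => ((‖laurentMonomial α w‖ ^ 2 : ℝ) : ℂ))
    (fun t z => by rw [norm_laurentMonomial_torusRot]) hint
  rw [projCoeff_residueIndex, integral_congr_ae e, h, integral_complex_ofReal,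
    integral_laurentMonomial_sq hm hα1 hk, bergmanCoeff_apply, mul_assoc, ← Complex.ofReal_mul,
    mul_inv_cancel₀ hpos.ne', Complex.ofReal_one, mul_one]

/-- The projections of `L^p` and `L^q` onto the functions with `L^p`-allowable Laurent series. -/
theorem exists_bergman_projections (hm : 0 < m) (hn : 0 < n) (hp : 2 < p) (hp' : p ≠ ∞) :
    ∃ (S : Lp ℂ p (volume.restrict (ratHartogs m n)) →L[ℂ] bergmanSpace (ratHartogs m n) p)
      (T : Lp ℂ q (volume.restrict (ratHartogs m n)) →L[ℂ] bergmanSpace (ratHartogs m n) q),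
      (∀ x y, ∫ z in ratHartogs m n, (S x).1 z * conj (y z)
        = ∫ z in ratHartogs m n, x z * conj ((T y).1 z)) ∧
      (∀ y, T y ∈ allowableSubspace (ratHartogs m n) q p) ∧
      (∀ f : bergmanSpace (ratHartogs m n) p, S f = f) ∧
      ∀ f ∈ allowableSubspace (ratHartogs m n) q p, T f = f := by
  obtain ⟨S, hS⟩ := exists_bergmanProj (q := q) hm hn hp hp' (r := p) (Or.inl rfl)
  obtain ⟨T, hT⟩ := exists_bergmanProj (q := q) hm hn hp hp' (r := q) (Or.inr rfl)
  have hc := le_critExponent (m := m) (n := n) hp hp'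
  have hSc : ∀ y α, bergmanCoeff hm hn α (S y) = projCoeff m n (critExponent m n p) y α :=
    fun y α => by
    have hy := residueIntegrable_Lp (q := q) hm hn hp hp' (Or.inl rfl) y
    rw [bergmanCoeff_eq_laurentCoeff hm hn (differentiableOn_projFun hm hn hc hy) (hS y),
      laurentCoeff_projFun hm hn hc hy]
  have hTc : ∀ y α, bergmanCoeff hm hn α (T y) = projCoeff m n (critExponent m n p) y α :=
    fun y α => by
    have hy := residueIntegrable_Lp (p := p) hm hn hp hp' (Or.inr rfl) y
    rw [bergmanCoeff_eq_laurentCoeff hm hn (differentiableOn_projFun hm hn hc hy) (hT y),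
      laurentCoeff_projFun hm hn hc hy]
  have h0 : ∀ (y : ℂ × ℂ → ℂ), ∀ α ∉ allowable (ratHartogs m n) p,
      projCoeff m n (critExponent m n p) y α = 0 := fun y α hα =>
    projCoeff_of_notMem y (by rwa [← allowable_eq_range hm hn hp'])
  refine ⟨S, T, fun x y => ?_, fun y => ?_, fun f => ?_, fun f hf => ?_⟩
  · have e1 : ∫ z in ratHartogs m n, (S x).1 z * conj (y z)
        = ∫ z in ratHartogs m n, projFun m n (critExponent m n p) x z * conj (y z) :=
      integral_congr_ae ((hS x).mono fun z hz => by simp only [hz])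
    have e2 : ∫ z in ratHartogs m n, x z * conj ((T y).1 z)
        = ∫ z in ratHartogs m n, x z * conj (projFun m n (critExponent m n p) y z) :=
      integral_congr_ae ((hT y).mono fun z hz => by simp only [hz])
    rw [e1, e2, integral_projFun_mul_conj hm hn hp hp' x y]
  · rw [mem_allowableSubspace_iff hm hn]
    exact fun α hα => by rw [hTc, h0 _ α hα]
  · refine eq_of_bergmanCoeff_eq hm hn fun α => ?_
    rw [hSc]
    by_cases hα : α ∈ allowable (ratHartogs m n) p
    · exact projCoeff_bergman (q := q) hm hn hp hp' (Or.inl rfl) f hα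
    · rw [h0 _ α hα, bergmanCoeff_eq_zero_of_notMem_allowable hm hn hp' f hα]
  · refine eq_of_bergmanCoeff_eq hm hn fun α => ?_
    rw [hTc]
    by_cases hα : α ∈ allowable (ratHartogs m n) p
    · exact projCoeff_bergman (q := q) hm hn hp hp' (Or.inr rfl) f hα
    · rw [h0 _ α hα, (mem_allowableSubspace_iff hm hn f).1 hf α hα]

end Projection

/-! ### Complex conjugation on `L^r`. -/

section Star

variable {X : Type*} [MeasurableSpace X] {μ : Measure X} {r : ℝ≥0∞}

theorem star_add_Lp (f g : Lp ℂ r μ) : star (f + g) = star f + star g := by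
  refine Lp.ext ((Lp.coeFn_star _).trans ?_)
  filter_upwards [Lp.coeFn_add f g, Lp.coeFn_add (star f) (star g), Lp.coeFn_star f,
    Lp.coeFn_star g] with x h1 h2 h3 h4
  rw [Pi.star_apply, h1, h2, Pi.add_apply, Pi.add_apply, h3, h4, star_add]
  rfl

theorem star_smul_Lp (k : ℂ) (f : Lp ℂ r μ) : star (k • f) = conj k • star f := by
  refine Lp.ext ((Lp.coeFn_star _).trans ?_)
  filter_upwards [Lp.coeFn_smul k f, Lp.coeFn_smul (conj k) (star f), Lp.coeFn_star f]
    with x h1 h2 h3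
  rw [Pi.star_apply, h1, h2, Pi.smul_apply, Pi.smul_apply, h3, star_smul]
  rfl

theorem norm_star_Lp (f : Lp ℂ r μ) : ‖star f‖ = ‖f‖ := by
  rw [Lp.norm_def, Lp.norm_def, eLpNorm_congr_ae (Lp.coeFn_star f)]
  congr 1
  exact eLpNorm_congr_norm_ae (Filter.Eventually.of_forall fun z => by simp)

end Star

/-! ### Hahn–Banach separation and reflexivity. -/

section Reflexive

/-- The functional is pulled back from the quotient by the closed subspace, whose dual separates
points. -/
theorem exists_dual_ne_zero_of_notMem {V : Type*} [NormedAddCommGroup V] [NormedSpace ℂ V]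
    {N : Submodule ℂ V} (hN : IsClosed (N : Set V)) {v : V} (hv : v ∉ N) :
    ∃ φ : StrongDual ℂ V, (∀ w ∈ N, φ w = 0) ∧ φ v ≠ 0 := by
  have := hN
  have h : N.mkQL v ≠ 0 := fun h => hv ((Submodule.Quotient.mk_eq_zero N).1 h)
  obtain ⟨φ, hφ⟩ := SeparatingDual.exists_ne_zero (R := ℂ) h
  refine ⟨φ.comp N.mkQL, fun w hw => ?_, hφ⟩
  have : N.mkQL w = 0 := (Submodule.Quotient.mk_eq_zero N).2 hw
  rw [ContinuousLinearMap.comp_apply, this, map_zero]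

variable {X : Type*} [MeasurableSpace X] {μ : Measure X} [IsFiniteMeasure μ]
  {r s : ℝ≥0∞} [Fact (1 ≤ r)] [Fact (1 ≤ s)] [ENNReal.HolderConjugate r s]

/-- Closed subspaces of `L^s` are reflexive. -/
theorem exists_eq_eval_of_isClosed (hr : r ≠ ∞) (hs : s ≠ ∞) {V : Submodule ℂ (Lp ℂ s μ)}
    (hV : IsClosed (V : Set (Lp ℂ s μ))) (φ : StrongDual ℂ (StrongDual ℂ V)) :
    ∃ g : V, ∀ l : StrongDual ℂ V, φ l = l g := by
  have : ENNReal.HolderConjugate s r := ENNReal.HolderConjugate.symm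
  let ψ : StrongDual ℂ (StrongDual ℂ (Lp ℂ s μ)) :=
    φ.comp (ContinuousLinearMap.precomp ℂ V.subtypeL)
  -- `lpDual` is conjugate-linear, so the outer conjugation is what makes `L` linear.
  let L : Lp ℂ r μ →ₗ[ℂ] ℂ :=
    { toFun := fun x => conj (ψ (lpDual x))
      map_add' := fun x y => by
        have : lpDual (r := s) (x + y) = lpDual x + lpDual y := by
          simp only [lpDual, star_add_Lp, map_add]
        rw [this, map_add, map_add]
      map_smul' := fun k x => by
        have : lpDual (r := s) (k • x) = conj k • lpDual x := by
          simp only [lpDual, star_smul_Lp, map_smul]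
        rw [this, map_smul, smul_eq_mul, map_mul, Complex.conj_conj]
        rfl }
  have hL : ∀ x, ‖L x‖ ≤ (‖ψ‖ * ‖(ContinuousLinearMap.mul ℂ ℂ).lpPairing μ r s‖) * ‖x‖ :=
    fun x => by
    change ‖conj (ψ (lpDual x))‖ ≤ _
    rw [RCLike.norm_conj, mul_assoc]
    refine (ψ.le_opNorm _).trans (mul_le_mul_of_nonneg_left ?_ (norm_nonneg _))
    refine (ContinuousLinearMap.le_opNorm _ _).trans_eq ?_
    rw [norm_star_Lp]
  obtain ⟨g, hg⟩ := exists_eq_lpDual hr hs (L.mkContinuous _ hL)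
  have hψ : ∀ Λ : StrongDual ℂ (Lp ℂ s μ), ψ Λ = Λ g := fun Λ => by
    obtain ⟨x, rfl⟩ := exists_eq_lpDual hs hr Λ
    have h1 : conj (ψ (lpDual x)) = lpDual g x := congrArg (fun F => F x) hg
    rw [← Complex.conj_conj (ψ (lpDual x)), h1, lpDual_apply, lpDual_apply, ← integral_conj]
    refine integral_congr_ae (Filter.Eventually.of_forall fun z => ?_)
    simp only [map_mul, Complex.conj_conj]
    ring
  -- A functional vanishing on `V` restricts to zero there, hence is killed by `ψ`, hence vanishes
  -- at `g`; by separation `g` lies in `V`.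
  have hgV : g ∈ V := by
    by_contra h
    obtain ⟨Λ, h0, h1⟩ := exists_dual_ne_zero_of_notMem hV h
    refine h1 ?_
    rw [← hψ]
    have : Λ.comp V.subtypeL = 0 := ContinuousLinearMap.ext fun v => h0 v v.2
    change φ (Λ.comp V.subtypeL) = 0
    rw [this, map_zero]
  refine ⟨⟨g, hgV⟩, fun l => ?_⟩
  obtain ⟨Λ, hΛ, -⟩ := exists_extension_norm_eq V l
  have e : Λ.comp V.subtypeL = l := ContinuousLinearMap.ext hΛ
  have h1 := hψ Λ
  change φ (Λ.comp V.subtypeL) = _ at h1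
  rw [e] at h1
  rw [h1]
  exact hΛ ⟨g, hgV⟩

end Reflexive

/-! ### The conjugate-linear isometry `f ↦ conj (f (conj z))`. -/

section Conjugation

variable {m n : ℕ} {r : ℝ≥0∞} [Fact (1 ≤ r)]

theorem star_mem_ratHartogs {z : ℂ × ℂ} : star z ∈ ratHartogs m n ↔ z ∈ ratHartogs m n := by
  change (‖star z.1‖ ^ m < ‖star z.2‖ ^ n ∧ ‖star z.2‖ < 1) ↔ (_ ∧ _)
  rw [norm_star, norm_star]

theorem measurePreserving_star_restrict :
    MeasurePreserving (star : ℂ × ℂ → ℂ × ℂ) (volume.restrict (ratHartogs m n))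
      (volume.restrict (ratHartogs m n)) := by
  have h : MeasurePreserving (star : ℂ × ℂ → ℂ × ℂ) volume volume :=
    (Complex.conjLIE.measurePreserving).prod (Complex.conjLIE.measurePreserving)
  have h1 := h.restrict_preimage (measurableSet_ratHartogs (m := m) (n := n))
  have h2 : star ⁻¹' ratHartogs m n = ratHartogs m n := by
    ext z
    exact star_mem_ratHartogs
  rwa [h2] at h1

/-- The conjugate-linear isometry `f ↦ conj (f (conj z))` of `L^r`. -/
def lpConj (f : Lp ℂ r (volume.restrict (ratHartogs m n))) :
    Lp ℂ r (volume.restrict (ratHartogs m n)) :=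
  star (Lp.compMeasurePreserving star measurePreserving_star_restrict f)

omit [Fact (1 ≤ r)] in
theorem coeFn_lpConj (f : Lp ℂ r (volume.restrict (ratHartogs m n))) :
    lpConj f =ᵐ[volume.restrict (ratHartogs m n)] fun z => star (f (star z)) := by
  refine (Lp.coeFn_star _).trans ?_
  filter_upwards [Lp.coeFn_compMeasurePreserving f measurePreserving_star_restrict] with z hz
  rw [Pi.star_apply, hz]
  rfl

omit [Fact (1 ≤ r)] in
theorem lpConj_lpConj (f : Lp ℂ r (volume.restrict (ratHartogs m n))) :
    lpConj (lpConj f) = f := by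
  refine Lp.ext ((coeFn_lpConj _).trans ?_)
  filter_upwards [measurePreserving_star_restrict.quasiMeasurePreserving.ae (coeFn_lpConj f)]
    with z hz
  rw [hz, star_star, star_star]

omit [Fact (1 ≤ r)] in
theorem norm_lpConj (f : Lp ℂ r (volume.restrict (ratHartogs m n))) : ‖lpConj f‖ = ‖f‖ := by
  rw [lpConj, norm_star_Lp, Lp.norm_compMeasurePreserving]

omit [Fact (1 ≤ r)] in
theorem lpConj_add (f g : Lp ℂ r (volume.restrict (ratHartogs m n))) :
    lpConj (f + g) = lpConj f + lpConj g := by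
  rw [lpConj, map_add, star_add_Lp]
  rfl

omit [Fact (1 ≤ r)] in
theorem lpConj_smul (k : ℂ) (f : Lp ℂ r (volume.restrict (ratHartogs m n))) :
    lpConj (k • f) = conj k • lpConj f := by
  refine Lp.ext ((coeFn_lpConj _).trans ?_)
  filter_upwards [measurePreserving_star_restrict.quasiMeasurePreserving.ae (Lp.coeFn_smul k f),
    Lp.coeFn_smul (conj k) (lpConj f), coeFn_lpConj f] with z h1 h2 h3
  rw [h1, h2, Pi.smul_apply, Pi.smul_apply, h3, star_smul]
  rfl

theorem differentiableOn_star_star {F : ℂ × ℂ → ℂ} (hF : DifferentiableOn ℂ F (ratHartogs m n)) :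
    DifferentiableOn ℂ (star ∘ F ∘ star) (ratHartogs m n) := fun z hz => by
  have h := (hF.differentiableAt (isOpen_ratHartogs.mem_nhds (star_mem_ratHartogs.2 hz))).star_star
  rw [star_star] at h
  exact h.differentiableWithinAt

omit [Fact (1 ≤ r)] in
theorem lpConj_ae_eq {f : Lp ℂ r (volume.restrict (ratHartogs m n))} {F : ℂ × ℂ → ℂ}
    (h : f =ᵐ[volume.restrict (ratHartogs m n)] F) :
    lpConj f =ᵐ[volume.restrict (ratHartogs m n)] star ∘ F ∘ star := by
  refine (coeFn_lpConj f).trans ?_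
  filter_upwards [measurePreserving_star_restrict.quasiMeasurePreserving.ae h] with z hz
  rw [hz]
  rfl

omit [Fact (1 ≤ r)] in
theorem lpConj_mem {f : Lp ℂ r (volume.restrict (ratHartogs m n))}
    (hf : f ∈ bergmanSpace (ratHartogs m n) r) : lpConj f ∈ bergmanSpace (ratHartogs m n) r := by
  obtain ⟨F, hF, h⟩ := hf
  exact ⟨_, differentiableOn_star_star hF, lpConj_ae_eq h⟩

/-- The conjugate-linear isometry `f ↦ conj (f (conj z))` of the Bergman space. -/
def bergmanConj (m n : ℕ) (r : ℝ≥0∞) [Fact (1 ≤ r)] :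
    bergmanSpace (ratHartogs m n) r →L⋆[ℂ] bergmanSpace (ratHartogs m n) r :=
  LinearMap.mkContinuous
    { toFun := fun f => ⟨lpConj f.1, lpConj_mem f.2⟩
      map_add' := fun f g => Subtype.ext (lpConj_add f.1 g.1)
      map_smul' := fun k f => Subtype.ext (lpConj_smul k f.1) } 1
    fun f => by
      rw [one_mul]
      exact (norm_lpConj f.1).le

theorem bergmanConj_bergmanConj (f : bergmanSpace (ratHartogs m n) r) :
    bergmanConj m n r (bergmanConj m n r f) = f :=
  Subtype.ext (lpConj_lpConj f.1)

/-- Since `conj (e_α (conj z)) = e_α z`, the Laurent coefficients are merely conjugated and the same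
ones vanish. -/
theorem bergmanConj_mem_allowableSubspace {s : ℝ≥0∞} {f : bergmanSpace (ratHartogs m n) r}
    (hf : f ∈ allowableSubspace (ratHartogs m n) r s) :
    bergmanConj m n r f ∈ allowableSubspace (ratHartogs m n) r s := by
  obtain ⟨c, ⟨F, hF, h, hc⟩, h0⟩ := hf
  refine ⟨fun α => star (c α), ⟨_, differentiableOn_star_star hF, lpConj_ae_eq h, ?_⟩,
    fun α hα => by simp only [h0 α hα, star_zero]⟩
  have h1 := TendstoLocallyUniformlyOn.comp hc star (t := ratHartogs m n)
    (fun z hz => star_mem_ratHartogs.2 hz) continuous_star.continuousOn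
  have h2 : UniformContinuous (star : ℂ → ℂ) := Complex.conjLIE.isometry.uniformContinuous
  refine (h2.comp_tendstoLocallyUniformlyOn h1).congr fun S z _ => ?_
  simp [laurentMonomial]

/-- `bergmanConj` as an equivalence. -/
def bergmanConjEquiv (m n : ℕ) (r : ℝ≥0∞) [Fact (1 ≤ r)] :
    bergmanSpace (ratHartogs m n) r ≃L⋆[ℂ] bergmanSpace (ratHartogs m n) r :=
  ContinuousLinearEquiv.equivOfInverse (bergmanConj m n r) (bergmanConj m n r)
    bergmanConj_bergmanConj bergmanConj_bergmanConj

/-- The restriction of `bergmanConj` to `allowableSubspace`. -/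
def allowableConj (m n : ℕ) (r s : ℝ≥0∞) [Fact (1 ≤ r)] :
    allowableSubspace (ratHartogs m n) r s →L⋆[ℂ] allowableSubspace (ratHartogs m n) r s :=
  ((bergmanConj m n r).comp (allowableSubspace (ratHartogs m n) r s).subtypeL).codRestrict _
    fun f => bergmanConj_mem_allowableSubspace f.2

theorem allowableConj_allowableConj {s : ℝ≥0∞} (f : allowableSubspace (ratHartogs m n) r s) :
    allowableConj m n r s (allowableConj m n r s f) = f :=
  Subtype.ext (bergmanConj_bergmanConj f.1)

/-- `allowableConj` as an equivalence. -/
def allowableConjEquiv (m n : ℕ) (r s : ℝ≥0∞) [Fact (1 ≤ r)] :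
    allowableSubspace (ratHartogs m n) r s ≃L⋆[ℂ] allowableSubspace (ratHartogs m n) r s :=
  ContinuousLinearEquiv.equivOfInverse (allowableConj m n r s) (allowableConj m n r s)
    allowableConj_allowableConj allowableConj_allowableConj

end Conjugation

/-! ### Abstract conjugate-linear functional analysis. -/

section Semilinear

variable {E F : Type*} [NormedAddCommGroup E] [NormedSpace ℂ E]
  [NormedAddCommGroup F] [NormedSpace ℂ F]

theorem injective_of_forall_eq_zero {D : E →L⋆[ℂ] F} (h : ∀ g, D g = 0 → g = 0) :
    Function.Injective D :=
  (injective_iff_map_eq_zero D).2 h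

theorem exists_conjLinear_equiv [CompleteSpace E] [CompleteSpace F] (D : E →L⋆[ℂ] F)
    (h : ∀ g, D g = 0 → g = 0) (hs : ∀ l, ∃ g, D g = l) : ∃ e : E ≃L⋆[ℂ] F, ∀ g, e g = D g :=
  ⟨ContinuousLinearEquiv.ofBijective D (LinearMap.ker_eq_bot.2 (injective_of_forall_eq_zero h))
    (LinearMap.range_eq_top.2 hs), fun _ => rfl⟩

theorem exists_conjLinear_equiv_range [CompleteSpace E] [CompleteSpace F] (D : E →L⋆[ℂ] F)
    (h : ∀ g, D g = 0 → g = 0) (hclo : IsClosed (D.range : Set F)) :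
    ∃ e : E ≃L⋆[ℂ] D.range, ∀ g, (e g : F) = D g :=
  ⟨D.equivRange (injective_of_forall_eq_zero h) hclo, fun _ => rfl⟩

/-- Two conjugate-linear equivalences compose to a linear one. -/
theorem nonempty_linear_equiv_of_conjLinear (e : E ≃L⋆[ℂ] F) (c : E ≃L⋆[ℂ] E) :
    Nonempty (F ≃L[ℂ] E) :=
  ⟨e.symm.trans c⟩

theorem nonempty_linear_equiv_prod {R M : Submodule ℂ F} (e : E ≃L⋆[ℂ] R) (c : E ≃L⋆[ℂ] E)
    (h : Submodule.IsTopCompl R M) : Nonempty (F ≃L[ℂ] E × M) :=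
  ⟨(Submodule.prodEquivOfIsTopCompl _ _ h).symm.trans
    ((e.symm.trans c).prodCongr (ContinuousLinearEquiv.refl ℂ M))⟩

theorem isTopCompl_of_isIdempotentElem {D : E →L⋆[ℂ] F} {Λ : F →L[ℂ] F} {M : Submodule ℂ F}
    (h : IsIdempotentElem Λ) (hr : ∀ l, (∃ g, D g = l) ↔ ∃ k, Λ k = l) (hk : Λ.ker = M) :
    IsClosed (D.range : Set F) ∧ Submodule.IsTopCompl D.range M := by
  have hrange : D.range = Λ.range := Submodule.ext hr
  have htop := ContinuousLinearMap.IsIdempotentElem.isTopCompl h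
  rw [hrange, ← hk]
  exact ⟨htop.isClosed, htop⟩

theorem exists_equiv_range_and_isTopCompl [CompleteSpace E] [CompleteSpace F] {D : E →L⋆[ℂ] F}
    {Λ : F →L[ℂ] F} {M : Submodule ℂ F} (hD : ∀ g, D g = 0 → g = 0)
    (h : IsIdempotentElem Λ) (hr : ∀ l, (∃ g, D g = l) ↔ ∃ k, Λ k = l) (hk : Λ.ker = M) :
    (∃ e : E ≃L⋆[ℂ] D.range, ∀ g, (e g : F) = D g) ∧ Submodule.IsTopCompl D.range M := by
  obtain ⟨hclo, htop⟩ := isTopCompl_of_isIdempotentElem h hr hk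
  exact ⟨exists_conjLinear_equiv_range D hD hclo, htop⟩

/-- Hahn–Banach: outside the closed span some functional would vanish on the span but not at `v`. -/
theorem mem_topologicalClosure_span {S : Set F} {v : F}
    (h : ∀ φ : StrongDual ℂ F, (∀ w ∈ S, φ w = 0) → φ v = 0) :
    v ∈ (Submodule.span ℂ S).topologicalClosure := by
  by_contra hv
  obtain ⟨φ, hφ, hφv⟩ :=
    exists_dual_ne_zero_of_notMem (Submodule.span ℂ S).isClosed_topologicalClosure hv
  exact hφv (h φ fun w hw => hφ w (Submodule.le_topologicalClosure _ (Submodule.subset_span hw)))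

end Semilinear

/-! ### The two duality statements. -/

section Duality

variable {m n : ℕ} {p q : ℝ≥0∞} [Fact (1 ≤ p)] [Fact (1 ≤ q)] [ENNReal.HolderConjugate p q]

theorem completeSpace_bergmanSpace {r : ℝ≥0∞} [Fact (1 ≤ r)] (hm : 0 < m) (hn : 0 < n) :
    CompleteSpace (bergmanSpace (ratHartogs m n) r) :=
  (isClosed_bergmanSpace hm hn).completeSpace_coe

omit [Fact (1 ≤ p)] [ENNReal.HolderConjugate p q] in
theorem isClosed_allowableSubspace (hm : 0 < m) (hn : 0 < n) :
    IsClosed (allowableSubspace (ratHartogs m n) q p : Set (bergmanSpace (ratHartogs m n) q)) := by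
  have e : (allowableSubspace (ratHartogs m n) q p : Set (bergmanSpace (ratHartogs m n) q))
      = ⋂ α ∈ (allowable (ratHartogs m n) p)ᶜ, {f | bergmanCoeff hm hn α f = 0} := by
    ext f
    simp only [SetLike.mem_coe, mem_allowableSubspace_iff hm hn, Set.mem_iInter, Set.mem_ofPred_eq,
      Set.mem_compl_iff]
  rw [e]
  exact isClosed_biInter fun α _ => isClosed_eq (bergmanCoeff hm hn α).continuous continuous_const

theorem allowableSubspace_ne_top (hm : 0 < m) (hn : 0 < n) (hp : 2 < p) (hp' : p ≠ ∞) :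
    allowableSubspace (ratHartogs m n) q p ≠ ⊤ := by
  have hP := two_lt_toReal hp hp'
  have hPQ := toReal_holderConjugate (q := q) hp hp'
  have hQ0 := hPQ.symm.pos
  have hQ2 : q.toReal < 2 := by nlinarith [hPQ.mul_eq_add]
  have hm' : (0 : ℝ) < m := by exact_mod_cast hm
  have hn' : (0 : ℝ) < n := by exact_mod_cast hn
  -- This index has `n α₁ + m α₂ = -(m+n)`, exactly the `L²` threshold; it is above the threshold
  -- for `q < 2` and below the one for `p > 2`.
  set α : ℤ × ℤ := (m - 1, -n - 1)
  have hα : (n : ℝ) * α.1 + m * α.2 = -(m + n) := by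
    simp only [α]; push_cast; ring
  have hα1 : 0 ≤ α.1 := by simp only [α]; omega
  have hq : α ∈ allowable (ratHartogs m n) q := by
    rw [mem_allowable_iff hm hn Fact.out (conjExponent_ne_top hp), hα, div_lt_iff₀ hQ0]
    exact ⟨hα1, by nlinarith⟩
  have hnp : α ∉ allowable (ratHartogs m n) p := by
    rw [mem_allowable_iff hm hn Fact.out hp', hα, div_lt_iff₀ (by linarith)]
    rintro ⟨-, h⟩
    nlinarith
  intro htop
  let f : bergmanSpace (ratHartogs m n) q := ⟨hq.2.toLp _, _, hq.1, hq.2.coeFn_toLp⟩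
  have hf : f ∈ allowableSubspace (ratHartogs m n) q p := htop ▸ Submodule.mem_top
  have h0 := (mem_allowableSubspace_iff hm hn f).1 hf α hnp
  rw [bergmanCoeff_eq_laurentCoeff hm hn hq.1 hq.2.coeFn_toLp] at h0
  have hb := ratHartogsBase_mem (n := n) hm
  have e : ∀ t, laurentMonomial α (torusRot t (ratHartogsBase n))
      * laurentMonomial (-α) (torusRot t (ratHartogsBase n)) = 1 := fun t => by
    have ht := torusRot_mem_punctured hb t
    rw [laurentMonomial_neg, mul_inv_cancel₀
      (laurentMonomial_ne_zero ht.2 (snd_ne_zero_of_mem_ratHartogs hn ht.1))]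
  simp [laurentCoeff, torusMean, e] at h0

/-- If `g ∈ G` annihilates `A^p`, adjointness and `T g = g` make it annihilate all of `L^p`, so `g =
0`. A functional `l` extends to `l ∘ S`, is given by some `y ∈ L^q`, and `T y ∈ G` represents it on
`A^p`, where `S` is the identity. -/
theorem exists_allowableSubspace_equiv_dual (hm : 0 < m) (hn : 0 < n) (hp : 2 < p) (hp' : p ≠ ∞) :
    ∃ e : allowableSubspace (ratHartogs m n) q p
        ≃L⋆[ℂ] StrongDual ℂ (bergmanSpace (ratHartogs m n) p),
      ∀ g : allowableSubspace (ratHartogs m n) q p,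
        e g = dualityMap (ratHartogs m n) p q (g : bergmanSpace (ratHartogs m n) q) := by
  obtain ⟨S, T, hST, hT, hS1, hT1⟩ := exists_bergman_projections (q := q) hm hn hp hp'
  have := completeSpace_bergmanSpace (r := q) hm hn
  have : CompleteSpace (allowableSubspace (ratHartogs m n) q p) :=
    (isClosed_allowableSubspace hm hn).completeSpace_coe
  let D := (dualityMap (ratHartogs m n) p q).comp
    (allowableSubspace (ratHartogs m n) q p).subtypeL
  have hD : ∀ g f, D g f = ∫ z in ratHartogs m n, f.1 z * conj (g.1.1 z) := fun g f => rfl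
  have hinj : ∀ g, D g = 0 → g = 0 := fun g hg => by
    refine Subtype.ext (Subtype.ext (lpDual_injective (r := p) fun x => ?_))
    have h1 : D g (S x) = 0 := by
      rw [hg]
      rfl
    rw [hD, hST, hT1 g.1 g.2] at h1
    rwa [lpDual_apply]
  have hsurj : ∀ l, ∃ g, D g = l := fun l => by
    obtain ⟨y, hy⟩ := exists_eq_lpDual hp' (conjExponent_ne_top (q := q) hp) (l.comp S)
    refine ⟨⟨T y, hT y⟩, ContinuousLinearMap.ext fun f => ?_⟩
    have h1 : (l.comp S) f.1 = lpDual y f.1 := by rw [hy]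
    rw [ContinuousLinearMap.comp_apply, hS1, lpDual_apply] at h1
    rw [hD, h1, ← hST, hS1]
  obtain ⟨e, he⟩ := exists_conjLinear_equiv
    (E := allowableSubspace (ratHartogs m n) q p)
    (F := StrongDual ℂ (bergmanSpace (ratHartogs m n) p)) D hinj hsurj
  exact ⟨e, he⟩

/-- By Hahn–Banach and reflexivity it suffices to test on `g ∈ A^q` whose coefficients vanish on the
difference set. Coefficients at indices not `L^q`-allowable vanish anyway, so such a `g` belongs to
`G`. -/
theorem mem_closure_span_bergmanCoeff (hm : 0 < m) (hn : 0 < n) (hp' : p ≠ ∞) (hq' : q ≠ ∞)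
    {l : StrongDual ℂ (bergmanSpace (ratHartogs m n) q)}
    (hl : ∀ g ∈ allowableSubspace (ratHartogs m n) q p, l g = 0) :
    l ∈ (Submodule.span ℂ ((fun α => bergmanCoeff (r := q) hm hn α) ''
      (allowable (ratHartogs m n) q \ allowable (ratHartogs m n) p))).topologicalClosure := by
  refine mem_topologicalClosure_span (F := StrongDual ℂ (bergmanSpace (ratHartogs m n) q))
    fun φ hφ => ?_
  obtain ⟨g, hg⟩ := exists_eq_eval_of_isClosed hp' hq' (isClosed_bergmanSpace hm hn) φ
  refine (hg l).trans (hl g ((mem_allowableSubspace_iff hm hn g).2 fun α hα => ?_))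
  by_cases hαq : α ∈ allowable (ratHartogs m n) q
  · exact (hg _).symm.trans (hφ _ ⟨α, ⟨hαq, hα⟩, rfl⟩)
  · exact bergmanCoeff_eq_zero_of_notMem_allowable hm hn hq' g hαq

set_option maxHeartbeats 2000000 in
-- Precomposition with the projection of `A^q` onto `G` is an idempotent of the dual. Its range
-- consists of the pairings with `A^p`, by adjointness and Riesz representation, and its kernel is
-- the annihilator of `G`.
theorem dual_decomposition (hm : 0 < m) (hn : 0 < n) (hp : 2 < p) (hp' : p ≠ ∞) :
    (∃ e : bergmanSpace (ratHartogs m n) p ≃L⋆[ℂ] (dualityMap (ratHartogs m n) q p).range,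
        ∀ g : bergmanSpace (ratHartogs m n) p,
          (e g : StrongDual ℂ (bergmanSpace (ratHartogs m n) q))
            = dualityMap (ratHartogs m n) q p g) ∧
      Submodule.IsTopCompl (dualityMap (ratHartogs m n) q p).range
        (Submodule.span ℂ ((fun α => bergmanCoeff (r := q) hm hn α) ''
          (allowable (ratHartogs m n) q \ allowable (ratHartogs m n) p))).topologicalClosure := by
  obtain ⟨S, T, hST, hT, hS1, hT1⟩ := exists_bergman_projections (q := q) hm hn hp hp'
  have hq' : q ≠ ∞ := conjExponent_ne_top hp
  have := completeSpace_bergmanSpace (r := p) hm hn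
  set D := dualityMap (ratHartogs m n) q p
  have hD : ∀ g f, D g f = ∫ z in ratHartogs m n, f.1 z * conj (g.1 z) := fun g f => rfl
  have hTS : ∀ (f : Lp ℂ q (volume.restrict (ratHartogs m n)))
      (x : Lp ℂ p (volume.restrict (ratHartogs m n))),
      ∫ z in ratHartogs m n, (T f).1 z * conj (x z)
        = ∫ z in ratHartogs m n, f z * conj ((S x).1 z) := fun f x => by
    have h := congrArg conj (hST x f)
    rw [← integral_conj, ← integral_conj] at h
    simp only [map_mul, Complex.conj_conj] at h
    simp only [mul_comm] at h ⊢
    exact h.symm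
  have hTT : ∀ y, T (T y).1 = T y := fun y => hT1 _ (hT y)
  let P : bergmanSpace (ratHartogs m n) q →L[ℂ] bergmanSpace (ratHartogs m n) q :=
    T.comp (bergmanSpace (ratHartogs m n) q).subtypeL
  let Λ : StrongDual ℂ (bergmanSpace (ratHartogs m n) q)
      →L[ℂ] StrongDual ℂ (bergmanSpace (ratHartogs m n) q) := ContinuousLinearMap.precomp ℂ P
  have hΛ : ∀ l f, Λ l f = l (T f.1) := fun l f => rfl
  have hidem : IsIdempotentElem Λ :=
    ContinuousLinearMap.ext fun l => ContinuousLinearMap.ext fun f => by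
      change l (T (T f.1).1) = l (T f.1)
      rw [hTT]
  have hDT : ∀ g y, D g (T y) = ∫ z in ratHartogs m n, y z * conj (g.1 z) := fun g y => by
    rw [hD, hTS, hS1]
  have hrange : ∀ l, (∃ g, D g = l) ↔ ∃ k, Λ k = l := by
    intro l
    constructor
    · rintro ⟨g, rfl⟩
      refine ⟨D g, ContinuousLinearMap.ext fun f => ?_⟩
      exact hDT g f.1
    · rintro ⟨l, rfl⟩
      obtain ⟨x, hx⟩ := exists_eq_lpDual hq' hp' (l.comp T)
      refine ⟨S x, ContinuousLinearMap.ext fun f => ?_⟩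
      change D (S x) f = l (T f.1)
      have h1 : (l.comp T) f.1 = lpDual x f.1 := by rw [hx]
      -- The representation is evaluated at `T f` rather than `f`: as `T` is idempotent the left
      -- side is unchanged, while on the right adjointness replaces `x` by `S x ∈ A^p`.
      have h2 : (l.comp T) (T f.1).1 = lpDual x (T f.1).1 := by rw [hx]
      rw [ContinuousLinearMap.comp_apply, hTT, lpDual_apply, hTS] at h2
      rw [hD, h2]
  have hinj : ∀ g, D g = 0 → g = 0 := fun g hg => by
    refine Subtype.ext (lpDual_injective (r := q) fun y => ?_)
    have h1 : D g (T y) = 0 := by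
      rw [hg]
      rfl
    rw [hDT] at h1
    rwa [lpDual_apply]
  have hker : Λ.ker = (Submodule.span ℂ ((fun α => bergmanCoeff (r := q) hm hn α) ''
      (allowable (ratHartogs m n) q \ allowable (ratHartogs m n) p))).topologicalClosure := by
    refine le_antisymm (fun l hl => ?_) ?_
    · refine mem_closure_span_bergmanCoeff hm hn hp' hq' fun g hg => ?_
      rw [← hT1 g hg, ← hΛ, show Λ l = 0 from hl]
      rfl
    · refine Submodule.topologicalClosure_minimal _ (Submodule.span_le.2 ?_) Λ.isClosed_ker
      rintro _ ⟨α, hα, rfl⟩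
      refine ContinuousLinearMap.ext fun f => ?_
      exact (mem_allowableSubspace_iff hm hn _).1 (hT f.1) α hα.2
  exact exists_equiv_range_and_isTopCompl (E := bergmanSpace (ratHartogs m n) p)
    (F := StrongDual ℂ (bergmanSpace (ratHartogs m n) q)) hinj hidem hrange hker

end Duality

end

set_option maxHeartbeats 2000000 in
theorem propositionT (m n : ℕ) (hm : 0 < m) (hn : 0 < n) (hmn : m.Coprime n)
    (p q : ℝ≥0∞) [Fact (1 ≤ p)] [Fact (1 ≤ q)] [ENNReal.HolderConjugate p q]
    (hp : 2 < p) (hp' : p ≠ ∞) (H : Set (ℂ × ℂ)) (hH : H = genHartogs ((m : ℝ) / (n : ℝ))) :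
    -- the space of functions involving only `L^p`-allowable monomials is proper in `A^q`
    allowableSubspace H q p ≠ ⊤ ∧
    -- `A^p(H)'` is identified with it, conjugate-linearly by the `L²` pairing, and also linearly
    (∃ e : allowableSubspace H q p ≃L⋆[ℂ] StrongDual ℂ (bergmanSpace H p),
      ∀ g : allowableSubspace H q p, e g = dualityMap H p q (g : bergmanSpace H q)) ∧
    Nonempty (StrongDual ℂ (bergmanSpace H p) ≃L[ℂ] allowableSubspace H q p) ∧
    -- the coefficient functionals `a_α` on `A^q(H)` are well defined and bounded
    ∃ a : ℤ × ℤ → StrongDual ℂ (bergmanSpace H q),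
      (∀ (f : bergmanSpace H q) (c : ℤ × ℤ → ℂ),
        IsLaurentExpansion f c ↔ c = fun α => a α f) ∧
      -- `A^p(H)` embeds in `A^q(H)'` by the `L²` pairing
      (∃ e : bergmanSpace H p ≃L⋆[ℂ] (dualityMap H q p).range,
        ∀ g : bergmanSpace H p, (e g : StrongDual ℂ (bergmanSpace H q)) = dualityMap H q p g) ∧
      -- topological direct sum decomposition of `A^q(H)'`
      Submodule.IsTopCompl (dualityMap H q p).range
        (Submodule.span ℂ (a '' (allowable H q \ allowable H p))).topologicalClosure ∧
      Nonempty (StrongDual ℂ (bergmanSpace H q) ≃L[ℂ] (bergmanSpace H p ×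
        (Submodule.span ℂ (a '' (allowable H q \ allowable H p))).topologicalClosure)) := by
  rw [genHartogs_eq_ratHartogs hn] at hH
  subst hH
  obtain ⟨e₁, he₁⟩ := exists_allowableSubspace_equiv_dual (q := q) hm hn hp hp'
  obtain ⟨⟨e₂, he₂⟩, htop⟩ := dual_decomposition (q := q) hm hn hp hp'
  have h₁ := nonempty_linear_equiv_of_conjLinear (E := allowableSubspace (ratHartogs m n) q p)
    (F := StrongDual ℂ (bergmanSpace (ratHartogs m n) p)) e₁ (allowableConjEquiv m n q p)
  have h₂ := nonempty_linear_equiv_prod (E := bergmanSpace (ratHartogs m n) p)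
    (F := StrongDual ℂ (bergmanSpace (ratHartogs m n) q)) e₂ (bergmanConjEquiv m n p) htop
  refine ⟨allowableSubspace_ne_top hm hn hp hp', ⟨e₁, he₁⟩, h₁, fun α => bergmanCoeff hm hn α,
    ?_, ?_, ?_, ?_⟩
  · exact isLaurentExpansion_iff hm hn
  · exact ⟨e₂, he₂⟩
  · exact htop
  · exact h₂
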